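/- Let $\mathbb N=\{1,2,\dots\}$, let $(V_n)_{n\in\mathbb N}$ be a bounded real sequence, and let $H$ be the Schrödinger operator on $\ell^2(\mathbb N)$, $(H\psi)_n=\psi_{n+1}+\psi_{n-1}+V_n\psi_n$ for $n\ge 2$ and $(H\psi)_1=\psi_2+V_1\psi_1$. Put $$P(q,T)=\sum_{n>q}\frac2T\int_0^\infty|\langle\delta_n,e^{-itH}\delta_1\rangle|^2e^{-2t/T}\,dt ,$$ $$\alpha_u^+=\sup\Big\{a>0:\limsup_{T\to\infty}\tfrac{\log P(T^a,T)}{\log T}>-\infty\Big\},\qquad \alpha_u^-=\sup\Big\{a>0:\liminf_{T\to\infty}\tfrac{\log P(T^a,T)}{\log T}>-\infty\Big\},$$ with $\sup\emptyset=0$. For $q\ge2$ let $H^q(\pi/2)$ be the restriction of $H$ to $\{1,\dots,q\}$ with boundary condition $\psi(q+1)=i\,\psi(1)$, i.e. the Hermitian $q\times q$ matrix which is the sum of the tridiagonal matrix with diagonal $V_1,\dots,V_q$ and off-diagonal entries $1$, and of the corner terms $-i$ at position $(1,q)$ and $i$ at position $(q,1)$. Let $\mathfrak E_q\subset\mathbb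 R$ be its set of eigenvalues. Let $(q_\ell)_{\ell\ge1}$ be integers with $q_\ell>1$ and $q_\ell\to\infty$, let $(\alpha_\ell)$, $(\xi_\ell)$ be real sequences, $\mu\ge1$, $0<\omega<1$, $\zeta>0$, put $\varepsilon_\ell=q_\ell^{-1/\alpha_\ell}$, and for each $\ell$ let $U_\ell$ be a finite set of closed bounded intervals. Denote the length of $I$ by $|I|$. Assume: (a) (*uniform clustering*) For every $\ell$ the set $U_\ell$ consists of at most $q_\ell$ pairwise disjoint intervals of length at most $\varepsilon_\ell$, which cover $\mathfrak E_{q_\ell}$ and each of which contains at least $q_\ell^{\xi_\ell}$ points of $\mathfrak E_{q_\ell}$. The sequence $(\varepsilon_\ell)$ is strictly decreasing. There is $C_1>0$ with $|I|\ge C_1q_\ell^{-\mu/\alpha_\ell}$ for all $\ell$ and $I\in U_\ell$. There is $\delta>0$ with $\delta<\xi_\ell<1-\delta$ and $\delta<\alpha_\ell<1$ for all $\ell$. With $\bar\xi_\ell=\log\big(\max_{I\in U_\ell}\#(\mathfrak E_{q_\ell}\cap I)\big)/\log q_\ell$ there is a constant $C_2$ with $\bar\xi_\ell-\xi_\ell\le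 C_2/\log q_\ell$ for all $\ell$. (b) (*nice scaling with exponents $\mu$ and $\omega$*) There are constants $C,C_3>0$ and, for every $0<\varepsilon<1$, a finite set $U_\varepsilon$ of (possibly overlapping) closed bounded intervals with $C\varepsilon^\mu\le|I|\le\varepsilon$ for all $I\in U_\varepsilon$, such that $U_{\varepsilon_\ell}=U_\ell$ for all $\ell$ and, whenever $1>\varepsilon_1'>\varepsilon_2'>0$, every interval of $U_{\varepsilon_2'}$ is contained in some interval of $U_{\varepsilon_1'}$, and every $I\in U_{\varepsilon_1'}$ meets at most $C_3(\varepsilon_1'/\varepsilon_2')^\omega$ intervals of $U_{\varepsilon_2'}$. (c) $2\omega\,\frac{\mu-1}{\mu-\omega}+\zeta<\xi_\ell\alpha_\ell$ for all $\ell$. Then $\alpha_u^-\le\liminf_{\ell\to\infty}\alpha_\ell$. If, moreover, $(q_\ell)$ is exponentially growing, i.e. $\sup_\ell q_{\ell+1}/q_\ell<\infty$ and $\inf_\ell q_{\ell+1}/q_\ell>1$, then $\alpha_u^+\le\limsup_{\ell\to\infty}\alpha_\ell$. -/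

import Mathlib

open Filter Topology Set
open scoped ENNReal

namespace Schrodinger

noncomputable section

/-! ### The half-line operator -/

/-- The Hilbert space `ℓ²(ℕ)`, where `ℕ = {1, 2, 3, …}`. -/
abbrev HalfLine : Type := lp (fun _ : ℕ+ => ℂ) 2

/-- The standard basis vector `δ_n`. -/
def delta (n : ℕ+) : HalfLine := lp.single 2 n (1 : ℂ)

theorem summable_sq (ψ : HalfLine) : Summable fun n : ℕ+ => ‖ψ n‖ ^ 2 := by
  have h := (memℓp_gen_iff (by norm_num : 0 < (2 : ℝ≥0∞).toReal)).1 (lp.memℓp ψ)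
  simpa using h

theorem norm_sq_eq (ψ : HalfLine) : ‖ψ‖ ^ 2 = ∑' n : ℕ+, ‖ψ n‖ ^ 2 := by
  have h := lp.norm_rpow_eq_tsum (by norm_num : 0 < (2 : ℝ≥0∞).toReal) ψ
  simpa using h

theorem memLp_two_of_summable {f : ℕ+ → ℂ} (h : Summable fun n => ‖f n‖ ^ 2) :
    Memℓp (E := fun _ : ℕ+ => ℂ) f 2 := by
  refine (memℓp_gen_iff (by norm_num : 0 < (2 : ℝ≥0∞).toReal)).2 ?_
  simpa using h

theorem succ_injective : Function.Injective fun n : ℕ+ => n + 1 :=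
  fun _ _ h => add_right_cancel h

/-- The shift `(Sψ)_n = ψ_{n+1}`. -/
def shift : HalfLine →L[ℂ] HalfLine :=
  LinearMap.mkContinuous
    { toFun := fun ψ => ⟨fun n => ψ (n + 1),
        memLp_two_of_summable ((summable_sq ψ).comp_injective succ_injective)⟩
      map_add' := fun _ _ => rfl
      map_smul' := fun _ _ => rfl }
    1
    (by
      intro ψ
      rw [one_mul]
      refine le_of_sq_le_sq ?_ (norm_nonneg _)
      rw [norm_sq_eq, norm_sq_eq]
      exact tsum_comp_le_tsum_of_inj (summable_sq ψ) (fun _ => sq_nonneg _) succ_injective)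

theorem potential_bound {V : ℕ+ → ℝ} {M : ℝ} (hM : ∀ n, |V n| ≤ M) (ψ : HalfLine) (n : ℕ+) :
    ‖(V n : ℂ) * ψ n‖ ^ 2 ≤ M ^ 2 * ‖ψ n‖ ^ 2 := by
  rw [norm_mul, mul_pow, Complex.norm_real, Real.norm_eq_abs]
  gcongr
  exact hM n

/-- Multiplication by a bounded real potential, `(Vψ)_n = V_n ψ_n`. -/
def potential (V : ℕ+ → ℝ) (hV : ∃ M, ∀ n, |V n| ≤ M) : HalfLine →L[ℂ] HalfLine :=
  LinearMap.mkContinuousOfExistsBound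
    { toFun := fun ψ => ⟨fun n => (V n : ℂ) * ψ n, memLp_two_of_summable (by
        obtain ⟨M, hM⟩ := hV
        exact Summable.of_nonneg_of_le (fun _ => sq_nonneg _) (potential_bound hM ψ)
          ((summable_sq ψ).mul_left _))⟩
      map_add' := fun ψ φ => lp.ext (funext fun n => mul_add (V n : ℂ) (ψ n) (φ n))
      map_smul' := fun c ψ => lp.ext (funext fun n => mul_left_comm (V n : ℂ) c (ψ n)) }
    (by
      obtain ⟨M, hM⟩ := hV
      have hM0 : 0 ≤ M := (abs_nonneg _).trans (hM 1)
      refine ⟨M, fun ψ => le_of_sq_le_sq ?_ (mul_nonneg hM0 (norm_nonneg _))⟩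
      rw [mul_pow, norm_sq_eq, norm_sq_eq, ← tsum_mul_left]
      exact Summable.tsum_le_tsum (potential_bound hM ψ)
        (Summable.of_nonneg_of_le (fun _ => sq_nonneg _) (potential_bound hM ψ)
          ((summable_sq ψ).mul_left _)) ((summable_sq ψ).mul_left _))

/-- The discrete Schrödinger operator `H = Δ + V` on `ℓ²(ℕ)`; the coordinate formula is
`operator_apply` below. -/
def operator (V : ℕ+ → ℝ) (hV : ∃ M, ∀ n, |V n| ≤ M) : HalfLine →L[ℂ] HalfLine :=
  shift + ContinuousLinearMap.adjoint shift + potential V hV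

theorem shift_delta (n m : ℕ+) : (shift (delta n)) m = if m + 1 = n then 1 else 0 := by
  change (lp.single 2 n (1 : ℂ) : HalfLine) (m + 1) = _
  rw [lp.single_apply]
  simp [Pi.single_apply]

theorem inner_delta (n : ℕ+) (ψ : HalfLine) : inner ℂ (delta n) ψ = ψ n := by
  rw [delta, lp.inner_single_left]
  simp

/-- `(Hψ)_n = ψ_{n+1} + ψ_{n-1} + V_n ψ_n`, with `(Hψ)_1 = ψ_2 + V_1 ψ_1`. -/
theorem operator_apply (V : ℕ+ → ℝ) (hV : ∃ M, ∀ n, |V n| ≤ M) (ψ : HalfLine) (n : ℕ+) :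
    (operator V hV ψ) n = ψ (n + 1) + (if 1 < n then ψ (n - 1) else 0) + (V n : ℂ) * ψ n := by
  have key : (ContinuousLinearMap.adjoint shift ψ) n = if 1 < n then ψ (n - 1) else 0 := by
    rw [← inner_delta, ContinuousLinearMap.adjoint_inner_right]
    split_ifs with h
    · have e : shift (delta n) = delta (n - 1) := by
        refine lp.ext (funext fun m => ?_)
        rw [shift_delta, delta, lp.single_apply, Pi.single_apply]
        have : m + 1 = n ↔ m = n - 1 := by
          constructor
          · rintro rfl
            exact (PNat.add_sub).symm
          · rintro rfl
            rw [add_comm]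
            exact PNat.add_sub_of_lt h
        simp [this]
      rw [e, inner_delta]
    · have e : shift (delta n) = 0 := by
        refine lp.ext (funext fun m => ?_)
        rw [shift_delta, if_neg]
        · rfl
        · rintro rfl
          exact h (PNat.lt_add_left 1 m)
      rw [e, inner_zero_left]
  rw [← key]
  rfl

/-- The unitary group `e^{-itH}`. -/
def evolution (V : ℕ+ → ℝ) (hV : ∃ M, ∀ n, |V n| ≤ M) (t : ℝ) : HalfLine →L[ℂ] HalfLine :=
  NormedSpace.exp ((-(Complex.I * (t : ℂ))) • operator V hV)

/-- `P(q, T) = ∑_{n > q} (2/T) ∫_0^∞ |⟨δ_n, e^{-itH} δ_1⟩|² e^{-2t/T} dt`, as an extended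
nonnegative real. -/
def tailProb (V : ℕ+ → ℝ) (hV : ∃ M, ∀ n, |V n| ≤ M) (q T : ℝ) : ℝ≥0∞ :=
  ∑' n : {n : ℕ+ // q < (n : ℝ)}, ENNReal.ofReal (2 / T) *
    ∫⁻ t in Ioi (0 : ℝ), ENNReal.ofReal
      (‖inner ℂ (delta n) (evolution V hV t (delta 1))‖ ^ 2 * Real.exp (-2 * t / T))

/-! ### The transport exponents of the fast part of the wave packet -/

/-- `log P(T^a, T) / log T`, as an extended real. -/
def decayRate (V : ℕ+ → ℝ) (hV : ∃ M, ∀ n, |V n| ≤ M) (a T : ℝ) : EReal :=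
  ENNReal.log (tailProb V hV (T ^ a) T) / (Real.log T : EReal)

/-- `α_u⁺ = sup {a > 0 | limsup_{T → ∞} log P(T^a, T) / log T > -∞}` (with `sup ∅ = 0`). -/
def alphaUPlus (V : ℕ+ → ℝ) (hV : ∃ M, ∀ n, |V n| ≤ M) : ℝ≥0∞ :=
  ⨆ a ∈ {a : ℝ | 0 < a ∧ ⊥ < limsup (fun T : ℝ => decayRate V hV a T) atTop}, ENNReal.ofReal a

/-- `α_u⁻ = sup {a > 0 | liminf_{T → ∞} log P(T^a, T) / log T > -∞}` (with `sup ∅ = 0`). -/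
def alphaUMinus (V : ℕ+ → ℝ) (hV : ∃ M, ∀ n, |V n| ≤ M) : ℝ≥0∞ :=
  ⨆ a ∈ {a : ℝ | 0 < a ∧ ⊥ < liminf (fun T : ℝ => decayRate V hV a T) atTop}, ENNReal.ofReal a

/-- A sequence of nonnegative numbers with `sup a_{n+1}/a_n < ∞` and `inf a_{n+1}/a_n > 1`. -/
def ExponentiallyGrowing (a : ℕ → ℝ) : Prop :=
  (∀ n, 0 ≤ a n) ∧ BddAbove (range fun n => a (n + 1) / a n) ∧ 1 < ⨅ n, a (n + 1) / a n

/-! ### Finite-volume eigenvalues and their clustering -/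

/-- The matrix `H^q(k)`: the restriction of `H` to `{1, …, q}` with boundary condition
`ψ(q+1) = e^{ik} ψ(1)`. The index `i : Fin q` stands for the site `i + 1`. -/
def truncation (V : ℕ+ → ℝ) (q : ℕ) (k : ℝ) : Matrix (Fin q) (Fin q) ℂ :=
  Matrix.of fun i j =>
    (if i = j then (V (i : ℕ).succPNat : ℂ) else 0)
    + (if (i : ℕ) + 1 = j ∨ (j : ℕ) + 1 = i then 1 else 0)
    + (if (i : ℕ) = 0 ∧ (j : ℕ) + 1 = q then Complex.exp (-(Complex.I * (k : ℂ))) else 0)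
    + (if (i : ℕ) + 1 = q ∧ (j : ℕ) = 0 then Complex.exp (Complex.I * (k : ℂ)) else 0)

/-- The set `𝔈_q` of the eigenvalues of `H^q(π/2)`. -/
def eigenvalueSet (V : ℕ+ → ℝ) (q : ℕ) : Set ℝ :=
  {E : ℝ | Module.End.HasEigenvalue (Matrix.toLin' (truncation V q (Real.pi / 2))) (E : ℂ)}

/-- `𝔈_q` is `(ε, ξ)`-clustered by the finite collection `U` of closed bounded intervals. -/
structure ClusteredBy (V : ℕ+ → ℝ) (q : ℕ) (ε ξ : ℝ) (U : Finset (NonemptyInterval ℝ)) :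
    Prop where
  card_le : U.card ≤ q
  disjoint : (U : Set (NonemptyInterval ℝ)).PairwiseDisjoint fun I => (I : Set ℝ)
  length_le : ∀ I ∈ U, I.length ≤ ε
  cover : eigenvalueSet V q ⊆ ⋃ I ∈ U, (I : Set ℝ)
  many : ∀ I ∈ U, (q : ℝ) ^ ξ ≤ ((eigenvalueSet V q ∩ (I : Set ℝ)).ncard : ℝ)

/-- The length scale `ε_ℓ = q_ℓ^{-1/α_ℓ}`. -/
def scale (q : ℕ → ℕ) (α : ℕ → ℝ) (ℓ : ℕ) : ℝ := (q ℓ : ℝ) ^ (-(1 / α ℓ))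

/-- `ξ̄ = log (sup_j #(𝔈_q ∩ I_j)) / log q`. -/
def upperExponent (V : ℕ+ → ℝ) (q : ℕ) (U : Finset (NonemptyInterval ℝ)) : ℝ :=
  Real.log ((U.sup fun I => (eigenvalueSet V q ∩ (I : Set ℝ)).ncard : ℕ) : ℝ) / Real.log q

/-- `{𝔈_{q_ℓ}}` is uniformly clustered by `{U_ℓ}` with exponents `{α_ℓ, ξ_ℓ, μ}`. -/
structure UniformlyClustered (V : ℕ+ → ℝ) (q : ℕ → ℕ) (U : ℕ → Finset (NonemptyInterval ℝ))
    (α ξ : ℕ → ℝ) (μ : ℝ) : Prop where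
  clustered : ∀ ℓ, ClusteredBy V (q ℓ) (scale q α ℓ) (ξ ℓ) (U ℓ)
  scale_lt : ∀ ℓ₁ ℓ₂, ℓ₁ < ℓ₂ → scale q α ℓ₂ < scale q α ℓ₁
  one_le_mu : 1 ≤ μ
  length_ge : ∃ C₁ : ℝ, 0 < C₁ ∧ ∀ ℓ, ∀ I ∈ U ℓ, C₁ * (q ℓ : ℝ) ^ (-(μ / α ℓ)) ≤ I.length
  exponents : ∃ δ : ℝ, 0 < δ ∧ ∀ ℓ, δ < ξ ℓ ∧ ξ ℓ < 1 - δ ∧ δ < α ℓ ∧ α ℓ < 1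
  upper : ∃ C₂ : ℝ, ∀ ℓ, upperExponent V (q ℓ) (U ℓ) - ξ ℓ ≤ C₂ / Real.log (q ℓ)

/-- The sequence `{U_ℓ}`, whose intervals have length between `C ε_ℓ^μ` and `ε_ℓ`, scales nicely
with exponents `μ` and `ω`: it extends to a family `W ε`, `0 < ε < 1`, with `W ε_ℓ = U_ℓ`. The
intervals of `W ε` may overlap. -/
def ScalesNicely (U : ℕ → Finset (NonemptyInterval ℝ)) (ε : ℕ → ℝ) (μ ω : ℝ) : Prop :=
  Antitone ε ∧ 1 ≤ μ ∧ 0 < ω ∧ ω < 1 ∧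
  ∃ C : ℝ, 0 < C ∧
    (∀ ℓ, ∀ I ∈ U ℓ, C * ε ℓ ^ μ ≤ I.length ∧ I.length ≤ ε ℓ) ∧
    ∃ W : ℝ → Finset (NonemptyInterval ℝ),
      (∀ ℓ, W (ε ℓ) = U ℓ) ∧
      (∀ e, 0 < e → e < 1 → ∀ I ∈ W e, C * e ^ μ ≤ I.length ∧ I.length ≤ e) ∧
      (∀ e₁ e₂, 0 < e₂ → e₂ < e₁ → e₁ < 1 →
        ∀ J ∈ W e₂, ∃ I ∈ W e₁, (J : Set ℝ) ⊆ (I : Set ℝ)) ∧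
      ∃ C₃ : ℝ, 0 < C₃ ∧ ∀ e₁ e₂, 0 < e₂ → e₂ < e₁ → e₁ < 1 → ∀ I ∈ W e₁,
        ({J : NonemptyInterval ℝ | J ∈ W e₂ ∧ ((J : Set ℝ) ∩ (I : Set ℝ)).Nonempty}.ncard : ℝ)
          ≤ C₃ * (e₁ / e₂) ^ ω

end

end Schrodinger

/-! Let D be the discriminant, the trace of the transfer matrix over q sites, and write q, ε, ξ for
q_ℓ, ε_ℓ, ξ_ℓ. By Floquet theory the eigenvalues of H^q(π/2) are the zeros of D
(`mem_eigenvalueSet_iff`). The current of a Floquet solution with unimodular multiplier is the same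
at both ends of the period, so D, D - 2 and D + 2 have only real roots (`isDiscriminant_discr`).
Plancherel turns P(Q, T) into an integral over E of the tail of (H - E - i/T)⁻¹ δ_1. Currents and
the Wronskian bound this tail by a power of T times |D(E + i/T)|⁻² (`tail_le`, `tailProb_le`). It
thus suffices that |D(E + iη)| ≥ exp(ε^(-ζ/3)) for all real E and all η ≥ ε, once ℓ is large.

This is `exists_scale_bound`, where E is compared with a threshold d = ε^β. If a root lies within d
of E, its cluster supplies at least X = q^ξ roots within 2d. Between them D + 2 and D - 2 have a
proportional number of roots, so moving up by ε gives growth exp(c X (ε/d)²)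
(`IsDiscriminant.le_norm_aeval_of_near`). If all roots are at least d away, then |D| ≥ 2 somewhere
in a cluster bordering the gap, and a step h = ε^(1-s) into the gap gains h/ε for each root of the
cluster. Roots across the gap cost exp(O(h ∑ 1/|r - a|)). Nice scaling allows at most a multiple of
ε^(-ω) X R^(ω/μ) roots within R of a. Since ω/μ < 1, the sum is controlled by its value at scale d,
and the loss is only exp(O(X)) (`exists_count_bound`, `sum_one_div_le`,
`IsDiscriminant.le_abs_eval_of_far`). This balance fixes β, and the first case then asks that X
exceed ε^(-2ω(μ-1)/(μ-ω)) by a power of 1/ε, which is assumption (c).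

Hence P(Q, T) is superpolynomially small for 1 ≤ T ≤ 1/ε and Q ≥ q + 1. For the lower exponent take
T = 1/ε_ℓ, so that q_ℓ = T^α_ℓ. For the upper one, bounded ratios q_{ℓ+1}/q_ℓ provide a suitable ℓ
for every large T. -/

namespace Schrodinger

section

open Polynomial

/-! ### Real-rooted polynomials -/

/-- `p` is monic and nonconstant, and `p - 2`, `p`, `p + 2` have only real roots. -/
structure IsDiscriminant (p : ℝ[X]) : Prop where
  monic : p.Monic
  degree_pos : 0 < p.natDegree
  splits : p.Splits
  splits_sub : (p - C 2).Splits
  splits_add : (p + C 2).Splits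

/-- Laguerre's inequality, by induction on the roots: for f = (X - a) g one has f'² - f f'' = g² +
(x - a)² (g'² - g g''). -/
theorem laguerre_nonneg (s : Multiset ℝ) (x : ℝ) :
    0 ≤ (derivative (s.map fun a => X - C a).prod).eval x ^ 2
      - (s.map fun a => X - C a).prod.eval x
        * (derivative (derivative (s.map fun a => X - C a).prod)).eval x := by
  induction s using Multiset.induction_on with
  | empty => simp
  | cons a s ih =>
    simp only [Multiset.map_cons, Multiset.prod_cons]
    set g := (s.map fun a => X - C a).prod
    simp only [derivative_mul, derivative_add, derivative_sub, derivative_X, derivative_C,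
      eval_add, eval_mul, eval_sub, eval_X, eval_C, sub_zero, one_mul]
    nlinarith [sq_nonneg (g.eval x), mul_nonneg (sq_nonneg (x - a)) ih]

/-- Splitting off one root leaves the summand g², which is positive away from the roots and makes
the inequality strict. -/
theorem laguerre_pos {p : ℝ[X]} (hm : p.Monic) (hd : 0 < p.natDegree) (hs : p.Splits) {x : ℝ}
    (hx : p.eval x ≠ 0) :
    0 < (derivative p).eval x ^ 2 - p.eval x * (derivative (derivative p)).eval x := by
  have hp := hs.eq_prod_roots_of_monic hm
  have hne : p.roots ≠ 0 := hs.roots_ne_zero hd.ne'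
  obtain ⟨a, ha⟩ := Multiset.exists_mem_of_ne_zero hne
  obtain ⟨s, hs'⟩ := Multiset.exists_cons_of_mem ha
  rw [hs'] at hp
  have h0 := laguerre_nonneg s x
  rw [hp] at hx ⊢
  simp only [Multiset.map_cons, Multiset.prod_cons] at hx ⊢
  set g := (s.map fun a => X - C a).prod
  simp only [derivative_mul, derivative_add, derivative_sub, derivative_X, derivative_C,
      eval_add, eval_mul, eval_sub, eval_X, eval_C, sub_zero, one_mul] at hx ⊢
  have hg : g.eval x ≠ 0 := right_ne_zero_of_mul hx
  have : 0 < g.eval x ^ 2 := by positivity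
  nlinarith [mul_nonneg (sq_nonneg (x - a)) h0]

namespace IsDiscriminant

variable {p : ℝ[X]}

theorem degree_pos' (h : IsDiscriminant p) : 0 < p.degree :=
  natDegree_pos_iff_degree_pos.1 h.degree_pos

theorem degree_C_lt (h : IsDiscriminant p) (c : ℝ) : (C c).degree < p.degree :=
  degree_C_le.trans_lt h.degree_pos'

theorem monic_sub (h : IsDiscriminant p) : (p - C 2).Monic :=
  h.monic.sub_of_left (h.degree_C_lt 2)

theorem monic_add (h : IsDiscriminant p) : (p + C 2).Monic :=
  h.monic.add_of_left (h.degree_C_lt 2)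

theorem natDegree_sub (_h : IsDiscriminant p) : (p - C 2).natDegree = p.natDegree :=
  natDegree_sub_C

theorem natDegree_add (_h : IsDiscriminant p) : (p + C 2).natDegree = p.natDegree :=
  natDegree_add_C

theorem laguerre_sub (h : IsDiscriminant p) {x : ℝ} (hx : p.eval x ≠ 2) :
    0 < (derivative p).eval x ^ 2 - (p.eval x - 2) * (derivative (derivative p)).eval x := by
  have := laguerre_pos h.monic_sub (by rw [h.natDegree_sub]; exact h.degree_pos) h.splits_sub
    (x := x) (by simpa [sub_eq_zero] using hx)
  simpa using this

theorem laguerre_add (h : IsDiscriminant p) {x : ℝ} (hx : p.eval x ≠ -2) :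
    0 < (derivative p).eval x ^ 2 - (p.eval x + 2) * (derivative (derivative p)).eval x := by
  have := laguerre_pos h.monic_add (by rw [h.natDegree_add]; exact h.degree_pos) h.splits_add
    (x := x) (by simpa [add_eq_zero_iff_eq_neg] using hx)
  simpa using this

/-- At a critical point with 0 < p < 2, Laguerre's inequality for p forces p'' < 0, while the one
for p - 2 forces p'' > 0. -/
theorem two_le_of_critical (h : IsDiscriminant p) {x : ℝ} (h' : (derivative p).eval x = 0)
    (hx : 0 < p.eval x) : 2 ≤ p.eval x := by
  by_contra! hlt
  have h1 := laguerre_pos h.monic h.degree_pos h.splits hx.ne'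
  have h2 := h.laguerre_sub hlt.ne
  rw [h'] at h1 h2
  have h3 : (derivative (derivative p)).eval x < 0 := by
    by_contra! hc
    nlinarith [mul_nonneg hx.le hc]
  nlinarith

theorem le_neg_two_of_critical (h : IsDiscriminant p) {x : ℝ} (h' : (derivative p).eval x = 0)
    (hx : p.eval x < 0) : p.eval x ≤ -2 := by
  by_contra! hlt
  have h1 := laguerre_pos h.monic h.degree_pos h.splits hx.ne
  have h2 := h.laguerre_add hlt.ne'
  rw [h'] at h1 h2
  have h3 : 0 < (derivative (derivative p)).eval x := by
    by_contra! hc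
    nlinarith [mul_nonneg_of_nonpos_of_nonpos hx.le hc]
  nlinarith

/-- At a double root the inequalities for p - 2 and p + 2 would give p'' > 0 and p'' < 0. -/
theorem derivative_ne_zero_of_root (h : IsDiscriminant p) {x : ℝ} (hx : p.eval x = 0) :
    (derivative p).eval x ≠ 0 := by
  intro h'
  have h1 := h.laguerre_sub (x := x) (by rw [hx]; norm_num)
  have h2 := h.laguerre_add (x := x) (by rw [hx]; norm_num)
  rw [h', hx] at h1 h2
  linarith

theorem ne_zero (h : IsDiscriminant p) : p ≠ 0 := h.monic.ne_zero

theorem nodup_roots (h : IsDiscriminant p) : p.roots.Nodup := by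
  classical
  refine Multiset.nodup_iff_count_le_one.2 fun x => ?_
  by_contra! hlt
  rw [count_roots, one_lt_rootMultiplicity_iff_isRoot h.ne_zero] at hlt
  exact h.derivative_ne_zero_of_root hlt.1 hlt.2

/-- Between three roots of `p` the value `2` is taken. -/
theorem exists_eval_eq_two (h : IsDiscriminant p) {a b c : ℝ} (hab : a < b) (hbc : b < c)
    (ha : p.eval a = 0) (hb : p.eval b = 0) (hc : p.eval c = 0) :
    ∃ x ∈ Ioo a c, p.eval x = 2 := by
  have hcont : ContinuousOn (fun x => p.eval x) (Icc a c) := p.continuous.continuousOn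
  obtain ⟨x, hx, hmax⟩ := isCompact_Icc.exists_isMaxOn (nonempty_Icc.2 (hab.trans hbc).le) hcont
  -- If the maximum were at most 0, the middle root would be an interior local maximum, hence a
  -- double root.
  have hpos : 0 < p.eval x := by
    by_contra! hle
    have hloc : IsLocalMax (fun x => p.eval x) b := by
      filter_upwards [Icc_mem_nhds hab hbc] with y hy
      rw [hb]
      exact (hmax hy).trans hle
    have := hloc.deriv_eq_zero
    rw [Polynomial.deriv] at this
    exact h.derivative_ne_zero_of_root hb this
  have hxa : a < x := lt_of_le_of_ne hx.1 (by rintro rfl; exact hpos.ne' ha)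
  have hxc : x < c := lt_of_le_of_ne hx.2 (by rintro rfl; exact hpos.ne' hc)
  have hd := (hmax.isLocalMax (Icc_mem_nhds hxa hxc)).deriv_eq_zero
  rw [Polynomial.deriv] at hd
  have h2 := h.two_le_of_critical hd hpos
  obtain ⟨y, hy, hy2⟩ := intermediate_value_Icc hxa.le (p.continuous.continuousOn (s := Icc a x))
    (show (2 : ℝ) ∈ Icc (p.eval a) (p.eval x) from ⟨by rw [ha]; norm_num, h2⟩)
  refine ⟨y, ⟨lt_of_le_of_ne hy.1 ?_, hy.2.trans_lt hxc⟩, hy2⟩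
  rintro rfl
  simp only at hy2
  linarith

theorem exists_eval_eq_neg_two (h : IsDiscriminant p) {a b c : ℝ} (hab : a < b) (hbc : b < c)
    (ha : p.eval a = 0) (hb : p.eval b = 0) (hc : p.eval c = 0) :
    ∃ x ∈ Ioo a c, p.eval x = -2 := by
  have hcont : ContinuousOn (fun x => p.eval x) (Icc a c) := p.continuous.continuousOn
  obtain ⟨x, hx, hmin⟩ := isCompact_Icc.exists_isMinOn (nonempty_Icc.2 (hab.trans hbc).le) hcont
  have hneg : p.eval x < 0 := by
    by_contra! hle
    have hloc : IsLocalMin (fun x => p.eval x) b := by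
      filter_upwards [Icc_mem_nhds hab hbc] with y hy
      rw [hb]
      exact hle.trans (hmin hy)
    have := hloc.deriv_eq_zero
    rw [Polynomial.deriv] at this
    exact h.derivative_ne_zero_of_root hb this
  have hxa : a < x := lt_of_le_of_ne hx.1 (by rintro rfl; exact hneg.ne ha)
  have hxc : x < c := lt_of_le_of_ne hx.2 (by rintro rfl; exact hneg.ne hc)
  have hd := (hmin.isLocalMin (Icc_mem_nhds hxa hxc)).deriv_eq_zero
  rw [Polynomial.deriv] at hd
  have h2 := h.le_neg_two_of_critical hd hneg
  obtain ⟨y, hy, hy2⟩ := intermediate_value_Icc' hxa.le (p.continuous.continuousOn (s := Icc a x))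
    (show (-2 : ℝ) ∈ Icc (p.eval x) (p.eval a) from ⟨h2, by rw [ha]; norm_num⟩)
  refine ⟨y, ⟨lt_of_le_of_ne hy.1 ?_, hy.2.trans_lt hxc⟩, hy2⟩
  rintro rfl
  simp only at hy2
  linarith

/-- Between two roots of `p` there is a point where `|p| ≥ 2`. -/
theorem exists_two_le_abs (h : IsDiscriminant p) {a b : ℝ} (hab : a < b)
    (ha : p.eval a = 0) (hb : p.eval b = 0) : ∃ x ∈ Ioo a b, 2 ≤ |p.eval x| := by
  obtain ⟨x, hx, hx0⟩ : ∃ x ∈ Ioo a b, p.eval x ≠ 0 := by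
    by_contra! hcon
    refine h.ne_zero (Polynomial.eq_zero_of_infinite_isRoot p ((Ioo_infinite hab).mono ?_))
    exact fun x hx => hcon x hx
  have hcont : ContinuousOn (fun x => |p.eval x|) (Icc a b) := p.continuous.abs.continuousOn
  obtain ⟨y, hy, hmax⟩ := isCompact_Icc.exists_isMaxOn (nonempty_Icc.2 hab.le) hcont
  have hpos : 0 < |p.eval y| := (abs_pos.2 hx0).trans_le (hmax (Ioo_subset_Icc_self hx))
  have hya : a < y := lt_of_le_of_ne hy.1 (by rintro rfl; simp [ha] at hpos)
  have hyb : y < b := lt_of_le_of_ne hy.2 (by rintro rfl; simp [hb] at hpos)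
  have hloc := hmax.isLocalMax (Icc_mem_nhds hya hyb)
  refine ⟨y, ⟨hya, hyb⟩, ?_⟩
  rcases lt_or_gt_of_ne (abs_pos.1 hpos) with hn | hp
  · have : IsLocalMin (fun x => p.eval x) y := by
      filter_upwards [hloc] with z hz
      rw [abs_of_neg hn] at hz
      linarith [neg_abs_le (p.eval z)]
    have hd := this.deriv_eq_zero
    rw [Polynomial.deriv] at hd
    rw [abs_of_neg hn]
    linarith [h.le_neg_two_of_critical hd hn]
  · have : IsLocalMax (fun x => p.eval x) y := by
      filter_upwards [hloc] with z hz
      rw [abs_of_pos hp] at hz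
      exact (le_abs_self _).trans hz
    have hd := this.deriv_eq_zero
    rw [Polynomial.deriv] at hd
    rw [abs_of_pos hp]
    exact h.two_le_of_critical hd hp

end IsDiscriminant

end

end Schrodinger

namespace Schrodinger

section

open Polynomial

/-! ### Growth of a discriminant off the real axis -/

theorem norm_multiset_prod {𝕜 : Type*} [NormedField 𝕜] (s : Multiset ℝ) (f : ℝ → 𝕜) :
    ‖(s.map f).prod‖ = (s.map fun r => ‖f r‖).prod := by
  induction s using Multiset.induction_on with
  | empty => simp
  | cons a s ih => simp [ih]

theorem norm_aeval_eq_prod {p : ℝ[X]} (hs : p.Splits) (hm : p.Monic) (z : ℂ) :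
    ‖aeval z p‖ = (p.roots.map fun r : ℝ => ‖z - r‖).prod := by
  conv_lhs => rw [hs.eq_prod_roots_of_monic hm]
  rw [map_multiset_prod, Multiset.map_map, ← norm_multiset_prod]
  simp

theorem abs_eval_eq_prod {p : ℝ[X]} (hs : p.Splits) (hm : p.Monic) (x : ℝ) :
    |p.eval x| = (p.roots.map fun r : ℝ => |x - r|).prod := by
  rw [hs.eval_eq_prod_roots_of_monic hm, ← Real.norm_eq_abs, norm_multiset_prod]
  rfl

theorem norm_sub_ofReal (E η r : ℝ) :
    ‖((E : ℂ) + η * Complex.I) - r‖ = Real.sqrt ((E - r) ^ 2 + η ^ 2) := by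
  have : ((E : ℂ) + η * Complex.I) - r = ((E - r : ℝ) : ℂ) + (η : ℝ) * Complex.I := by
    push_cast; ring
  rw [this, Complex.norm_add_mul_I]

theorem abs_sub_le_norm_sub (E η r : ℝ) : |E - r| ≤ ‖((E : ℂ) + η * Complex.I) - r‖ := by
  rw [norm_sub_ofReal]
  exact Real.abs_le_sqrt (by nlinarith [sq_nonneg η])

/-- Since (E - r)² ≤ R², the term η² is at least (η/R)² (E - r)². Each root within R therefore
yields the same relative gain when moving up by η. -/
theorem sqrt_mul_abs_sub_le_norm_sub {E η r R : ℝ} (hR : 0 < R) (hr : |E - r| ≤ R) :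
    Real.sqrt (1 + (η / R) ^ 2) * |E - r| ≤ ‖((E : ℂ) + η * Complex.I) - r‖ := by
  rw [norm_sub_ofReal]
  refine Real.le_sqrt_of_sq_le ?_
  rw [mul_pow, Real.sq_sqrt (by positivity), sq_abs, add_mul, one_mul]
  have h1 : (E - r) ^ 2 ≤ R ^ 2 := by
    rw [← sq_abs]
    gcongr
  have : (η / R) ^ 2 * (E - r) ^ 2 ≤ η ^ 2 := by
    rw [div_pow, div_mul_eq_mul_div, div_le_iff₀ (by positivity)]
    gcongr
  linarith

/-- A product of factors improves by `g` for each factor that satisfies `P`. -/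
theorem prod_mul_pow_le_prod (s : Multiset ℝ) (f₁ f₂ : ℝ → ℝ) (P : ℝ → Prop) [DecidablePred P]
    {g : ℝ} (hg : 0 ≤ g) (h0 : ∀ r, 0 ≤ f₁ r) (hle : ∀ r, f₁ r ≤ f₂ r)
    (hP : ∀ r, P r → g * f₁ r ≤ f₂ r) :
    g ^ (s.countP P) * (s.map f₁).prod ≤ (s.map f₂).prod := by
  induction s using Multiset.induction_on with
  | empty => simp
  | cons a s ih =>
    have hs : 0 ≤ (s.map f₁).prod := Multiset.prod_nonneg (by simpa using fun r _ => h0 r)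
    simp only [Multiset.map_cons, Multiset.prod_cons]
    by_cases ha : P a
    · rw [Multiset.countP_cons_of_pos _ ha, pow_succ]
      calc _ = (g * f₁ a) * (g ^ s.countP P * (s.map f₁).prod) := by ring
        _ ≤ f₂ a * (s.map f₂).prod :=
          mul_le_mul (hP a ha) ih (by positivity) ((h0 a).trans (hle a))
    · rw [Multiset.countP_cons_of_neg _ ha]
      calc _ = f₁ a * (g ^ s.countP P * (s.map f₁).prod) := by ring
        _ ≤ f₂ a * (s.map f₂).prod :=
          mul_le_mul (hle a) ih (by positivity) ((h0 a).trans (hle a))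

/-- If a real-rooted `p` has at least `N` roots within `R` of `E`, then it grows vertically above
`E` by a factor of at least `√(1 + (η / R)²) ^ N`. -/
theorem pow_mul_abs_eval_le_norm_aeval {p : ℝ[X]} (hs : p.Splits) (hm : p.Monic) {E η R : ℝ}
    (hR : 0 < R) (S : Finset ℝ) (hS : ∀ x ∈ S, p.eval x = 0 ∧ |E - x| ≤ R) {N : ℕ}
    (hN : N ≤ S.card) :
    Real.sqrt (1 + (η / R) ^ 2) ^ N * |p.eval E| ≤ ‖aeval ((E : ℂ) + η * Complex.I) p‖ := by
  classical
  have hg : 1 ≤ Real.sqrt (1 + (η / R) ^ 2) := by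
    rw [Real.one_le_sqrt]
    nlinarith [sq_nonneg (η / R)]
  have hcount : S.card ≤ p.roots.countP (fun r => |E - r| ≤ R) := by
    rw [Multiset.countP_eq_card_filter, ← Finset.card_val]
    refine Multiset.card_le_card ((Multiset.le_iff_subset S.nodup).2 fun x hx => ?_)
    rw [Multiset.mem_filter, mem_roots hm.ne_zero]
    exact hS x hx
  rw [norm_aeval_eq_prod hs hm, abs_eval_eq_prod hs hm]
  refine le_trans ?_ (prod_mul_pow_le_prod p.roots _ _ (fun r => |E - r| ≤ R)
    (zero_le_one.trans hg) (fun r => abs_nonneg (E - r)) (fun r => abs_sub_le_norm_sub E η r)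
    fun r hr => sqrt_mul_abs_sub_le_norm_sub hR hr)
  have h0 : 0 ≤ (p.roots.map fun r : ℝ => |E - r|).prod :=
    Multiset.prod_nonneg fun a ha => by
      obtain ⟨r, -, rfl⟩ := Multiset.mem_map.1 ha
      exact abs_nonneg _
  gcongr
  exact hN.trans hcount

/-- Between the elements of `S` with indices `2i` and `2i + 2` pick a point each. -/
theorem exists_finset_between {S : Finset ℝ} {N : ℕ} (hN : 2 * N + 1 ≤ S.card) (P : ℝ → Prop)
    (h : ∀ a ∈ S, ∀ b ∈ S, ∀ c ∈ S, a < b → b < c → ∃ x ∈ Ioo a c, P x) :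
    ∃ S' : Finset ℝ, S'.card = N ∧
      ∀ x ∈ S', P x ∧ (∃ a ∈ S, a ≤ x) ∧ ∃ b ∈ S, x ≤ b := by
  classical
  set e := S.orderEmbOfFin rfl
  have he : ∀ i, e i ∈ S := fun i => S.orderEmbOfFin_mem rfl i
  have key : ∀ i : Fin N, ∃ x ∈ Ioo (e ⟨2 * i, by omega⟩) (e ⟨2 * i + 2, by omega⟩), P x :=
    fun i => h _ (he _) _ (he ⟨2 * i + 1, by omega⟩) _ (he _)
      (e.strictMono (by simp [Fin.lt_def])) (e.strictMono (by simp [Fin.lt_def]))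
  choose f hf hP using key
  have hmono : StrictMono f := by
    intro i j hij
    refine (hf i).2.trans_le (le_trans (e.monotone ?_) (hf j).1.le)
    rw [Fin.le_def]
    have : (i : ℕ) < j := hij
    simp only
    omega
  refine ⟨Finset.univ.image f, ?_, fun x hx => ?_⟩
  · rw [Finset.card_image_of_injective _ hmono.injective]
    simp
  · obtain ⟨i, -, rfl⟩ := Finset.mem_image.1 hx
    exact ⟨hP i, ⟨_, he _, (hf i).1.le⟩, ⟨_, he _, (hf i).2.le⟩⟩

/-- Above a point `E` that is within `R` of a set of `2 N + 1` roots, a discriminant is large. -/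
theorem IsDiscriminant.le_norm_aeval_of_near {p : ℝ[X]} (h : IsDiscriminant p) {E η R : ℝ}
    (hR : 0 < R) (S : Finset ℝ) (hS : ∀ x ∈ S, p.eval x = 0 ∧ |E - x| ≤ R) {N : ℕ}
    (hN : 2 * N + 1 ≤ S.card) :
    2 * Real.sqrt (1 + (η / R) ^ 2) ^ N - 2 ≤ ‖aeval ((E : ℂ) + η * Complex.I) p‖ := by
  have hbetween : ∀ {a b x : ℝ}, |E - a| ≤ R → |E - b| ≤ R → a ≤ x → x ≤ b → |E - x| ≤ R := by
    intro a b x ha hb hax hxb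
    rw [abs_le] at *
    constructor <;> linarith
  have hg : 0 ≤ Real.sqrt (1 + (η / R) ^ 2) ^ N := by positivity
  -- As p may vanish at E, the growth estimate is applied to whichever of p + 2 and p - 2 has
  -- modulus at least 2 there. Its roots near E are the points between the given roots where p is -2
  -- or 2. Returning to p costs 2.
  rcases le_total 0 (p.eval E) with h0 | h0
  · obtain ⟨S', hcard, hS'⟩ := exists_finset_between hN (fun x => p.eval x = -2)
      fun a ha b hb c hc hab hbc =>
        h.exists_eval_eq_neg_two hab hbc (hS a ha).1 (hS b hb).1 (hS c hc).1
    have := pow_mul_abs_eval_le_norm_aeval h.splits_add h.monic_add (E := E) (η := η) hR S'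
      (fun x hx => by
        obtain ⟨hx2, ⟨a, ha, hax⟩, b, hb, hxb⟩ := hS' x hx
        refine ⟨by simp [hx2], hbetween (hS a ha).2 (hS b hb).2 hax hxb⟩) hcard.ge
    have h2 : 2 ≤ |(p + C 2).eval E| := by
      rw [eval_add, eval_C, abs_of_nonneg (by linarith)]
      linarith
    have h3 : ‖aeval ((E : ℂ) + η * Complex.I) (p + C 2)‖
        ≤ ‖aeval ((E : ℂ) + η * Complex.I) p‖ + 2 := by
      rw [map_add, aeval_C]
      refine (norm_add_le _ _).trans ?_
      simp
    nlinarith [mul_le_mul_of_nonneg_left h2 hg]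
  · obtain ⟨S', hcard, hS'⟩ := exists_finset_between hN (fun x => p.eval x = 2)
      fun a ha b hb c hc hab hbc =>
        h.exists_eval_eq_two hab hbc (hS a ha).1 (hS b hb).1 (hS c hc).1
    have := pow_mul_abs_eval_le_norm_aeval h.splits_sub h.monic_sub (E := E) (η := η) hR S'
      (fun x hx => by
        obtain ⟨hx2, ⟨a, ha, hax⟩, b, hb, hxb⟩ := hS' x hx
        refine ⟨by simp [hx2], hbetween (hS a ha).2 (hS b hb).2 hax hxb⟩) hcard.ge
    have h2 : 2 ≤ |(p - C 2).eval E| := by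
      rw [eval_sub, eval_C, abs_of_nonpos (by linarith)]
      linarith
    have h3 : ‖aeval ((E : ℂ) + η * Complex.I) (p - C 2)‖
        ≤ ‖aeval ((E : ℂ) + η * Complex.I) p‖ + 2 := by
      rw [map_sub, aeval_C]
      refine (norm_sub_le _ _).trans ?_
      simp
    nlinarith [mul_le_mul_of_nonneg_left h2 hg]

/-- On vertical lines the modulus of a real-rooted polynomial increases away from the axis. -/
theorem norm_aeval_mono {p : ℝ[X]} (hs : p.Splits) (hm : p.Monic) (E : ℝ) {η η' : ℝ}
    (h0 : 0 ≤ η) (h : η ≤ η') :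
    ‖aeval ((E : ℂ) + η * Complex.I) p‖ ≤ ‖aeval ((E : ℂ) + η' * Complex.I) p‖ := by
  rw [norm_aeval_eq_prod hs hm, norm_aeval_eq_prod hs hm]
  refine Multiset.prod_map_le_prod_map₀ _ _ (fun r _ => norm_nonneg _) fun r _ => ?_
  rw [norm_sub_ofReal, norm_sub_ofReal]
  gcongr

theorem abs_eval_le_norm_aeval {p : ℝ[X]} (hs : p.Splits) (hm : p.Monic) (E η : ℝ) :
    |p.eval E| ≤ ‖aeval ((E : ℂ) + η * Complex.I) p‖ := by
  simpa using pow_mul_abs_eval_le_norm_aeval hs hm (E := E) (η := η) one_pos ∅ (by simp)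
    (Nat.zero_le _)

end

end Schrodinger

namespace Schrodinger

section

open Polynomial

/-! ### Growth of a discriminant in a gap between clusters -/

/-- Moving from a point `u` within a cluster to a point at distance `h` outside, a product gains
a factor `h / ε` for each element of the cluster, and loses a factor close to `1` for each far
point on the other side. -/
theorem prod_abs_sub_gain {ι : Type*} [DecidableEq ι] (Z I : Finset ι) (t : ι → ℝ) {ε h u : ℝ}
    (hε : 0 < ε) (hεh : ε ≤ h) (hIZ : I ⊆ Z) (hI : ∀ r ∈ I, -ε ≤ t r ∧ t r ≤ 0)
    (hZ : ∀ r ∈ Z, t r ≤ 0 ∨ 4 * h ≤ t r) (hu : -ε ≤ u) (hu0 : u ≤ 0) :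
    (∏ r ∈ Z, |u - t r|) * ((h / ε) ^ I.card *
      Real.exp (-(4 * h * ∑ r ∈ Z with 0 < t r, 1 / t r))) ≤ ∏ r ∈ Z, |h - t r| := by
  have hh : 0 < h := hε.trans_le hεh
  have e1 : (h / ε) ^ I.card = ∏ r ∈ Z, if r ∈ I then h / ε else 1 := by
    rw [Finset.prod_ite_mem, Finset.inter_eq_right.2 hIZ, Finset.prod_const]
  have e2 : Real.exp (-(4 * h * ∑ r ∈ Z with 0 < t r, 1 / t r))
      = ∏ r ∈ Z, if 0 < t r then Real.exp (-(4 * h * (1 / t r))) else 1 := by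
    rw [← Finset.prod_filter, ← Real.exp_sum, Finset.mul_sum, Finset.sum_neg_distrib]
  rw [e1, e2, ← Finset.prod_mul_distrib, ← Finset.prod_mul_distrib]
  refine Finset.prod_le_prod (fun r _ => ?_) fun r hr => ?_
  · have h1 : 0 ≤ if r ∈ I then h / ε else 1 := by split_ifs <;> positivity
    have h2 : 0 ≤ if 0 < t r then Real.exp (-(4 * h * (1 / t r))) else 1 := by
      split_ifs <;> positivity
    positivity
  -- Factor by factor: a cluster point grows from at most ε to at least h, other points on the near
  -- side lose nothing, and a point beyond the gap loses at most exp(-4h/t), by exp(-x) ≤ 1/(1 + x)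
  -- and t ≥ 4h.
  · rcases hZ r hr with h0 | h0
    · rw [if_neg h0.not_gt, mul_one, abs_of_nonneg (by linarith : 0 ≤ h - t r)]
      split_ifs with hrI
      · have h3 : |u - t r| ≤ ε := by
          rw [abs_le]
          constructor <;> linarith [hI r hrI]
        calc |u - t r| * (h / ε) ≤ ε * (h / ε) := by gcongr
          _ = h := by field_simp
          _ ≤ h - t r := by linarith
      · rw [mul_one, abs_le]
        constructor <;> linarith
    · have ht : 0 < t r := by linarith
      have hrI : r ∉ I := fun hrI => by linarith [hI r hrI]
      rw [if_neg hrI, if_pos ht, one_mul, abs_of_nonpos (by linarith : u - t r ≤ 0),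
        abs_of_nonpos (by linarith : h - t r ≤ 0)]
      have h4 : Real.exp (-(4 * h * (1 / t r))) ≤ 1 / (1 + 4 * h / t r) := by
        rw [Real.exp_neg, ← one_div]
        refine one_div_le_one_div_of_le (by positivity) ?_
        have := Real.add_one_le_exp (4 * h * (1 / t r))
        calc 1 + 4 * h / t r = 4 * h * (1 / t r) + 1 := by ring
          _ ≤ _ := this
      calc -(u - t r) * Real.exp (-(4 * h * (1 / t r)))
          ≤ (h + t r) * (1 / (1 + 4 * h / t r)) := by
            refine mul_le_mul (by linarith) h4 (by positivity) (by linarith)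
        _ = (h + t r) * t r / (t r + 4 * h) := by field_simp
        _ ≤ -(h - t r) := by
          rw [div_le_iff₀ (by linarith)]
          nlinarith

/-- `Real.log` is even, so the function is log |x - r|, which is concave on each side of r. -/
theorem concaveOn_log_sub {a b r : ℝ} (hr : r < a ∨ b < r) :
    ConcaveOn ℝ (Icc a b) fun x => Real.log (x - r) := by
  rcases hr with hr | hr
  · have := strictConcaveOn_log_Ioi.concaveOn.translate_right (-r)
    refine (this.subset (fun x hx => ?_) (convex_Icc a b)).congr fun x _ => ?_
    · simp only [mem_preimage, mem_Ioi]
      linarith [hx.1]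
    · simp [sub_eq_neg_add]
  · have := strictConcaveOn_log_Iio.concaveOn.translate_right (-r)
    refine (this.subset (fun x hx => ?_) (convex_Icc a b)).congr fun x _ => ?_
    · simp only [mem_preimage, mem_Iio]
      linarith [hx.2]
    · simp [sub_eq_neg_add]

theorem concaveOn_finset_sum {ι : Type*} (Z : Finset ι) (f : ι → ℝ → ℝ) {s : Set ℝ}
    (hs : Convex ℝ s) (h : ∀ i ∈ Z, ConcaveOn ℝ s (f i)) :
    ConcaveOn ℝ s fun x => ∑ i ∈ Z, f i x := by
  classical
  induction Z using Finset.induction_on with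
  | empty => simpa using concaveOn_const 0 hs
  | insert a Z ha ih =>
    simp only [Finset.sum_insert ha]
    exact (h a (Finset.mem_insert_self _ _)).add
      (ih fun i hi => h i (Finset.mem_insert_of_mem hi))

/-- On an interval without roots, `∏ |x - r|` is at least its minimum over the end points. -/
theorem le_prod_abs_sub_of_mem_Icc (Z : Finset ℝ) {a b x L : ℝ} (hx : x ∈ Icc a b)
    (hZ : ∀ r ∈ Z, r < a ∨ b < r) (hL : 0 < L) (ha : L ≤ ∏ r ∈ Z, |a - r|)
    (hb : L ≤ ∏ r ∈ Z, |b - r|) : L ≤ ∏ r ∈ Z, |x - r| := by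
  have hab : a ≤ b := hx.1.trans hx.2
  have hlog : ∀ y ∈ Icc a b, 0 < ∏ r ∈ Z, |y - r| ∧
      Real.log (∏ r ∈ Z, |y - r|) = ∑ r ∈ Z, Real.log (y - r) := by
    intro y hy
    have hne : ∀ r ∈ Z, |y - r| ≠ 0 := by
      intro r hr h0
      rw [abs_eq_zero, sub_eq_zero] at h0
      rcases hZ r hr with h | h <;> linarith [hy.1, hy.2]
    refine ⟨Finset.prod_pos fun r hr => lt_of_le_of_ne (abs_nonneg _) (hne r hr).symm, ?_⟩
    rw [Real.log_prod hne]
    simp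
  have hc := concaveOn_finset_sum Z (fun r x => Real.log (x - r)) (convex_Icc a b)
    fun r hr => concaveOn_log_sub (hZ r hr)
  have hmin := hc.min_le_of_mem_Icc (left_mem_Icc.2 hab) (right_mem_Icc.2 hab) hx
  rw [← (hlog a (left_mem_Icc.2 hab)).2, ← (hlog b (right_mem_Icc.2 hab)).2,
    ← (hlog x hx).2] at hmin
  rw [← Real.log_le_log_iff hL (hlog x hx).1]
  exact (le_min (Real.log_le_log hL ha) (Real.log_le_log hL hb)).trans hmin

namespace IsDiscriminant

variable {p : ℝ[X]}

theorem abs_eval_eq (h : IsDiscriminant p) (x : ℝ) :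
    |p.eval x| = ∏ r ∈ p.roots.toFinset, |x - r| := by
  rw [abs_eval_eq_prod h.splits h.monic, Finset.prod_eq_multiset_prod, Multiset.toFinset_val,
    h.nodup_roots.dedup]

theorem mem_rootsFinset (h : IsDiscriminant p) {x : ℝ} :
    x ∈ p.roots.toFinset ↔ p.eval x = 0 := by
  rw [Multiset.mem_toFinset, mem_roots h.ne_zero, IsRoot.def]

/-- At distance `h` from an end point `a` of a cluster which ends at a gap, a discriminant is
large. Here `σ = ±1` is the direction of the gap. -/
theorem le_abs_eval_near_cluster (hp : IsDiscriminant p) {σ a ε h d B : ℝ} (hσ : σ = 1 ∨ σ = -1)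
    (I : Finset ℝ) (hI : ∀ r ∈ I, p.eval r = 0 ∧ |a - r| ≤ ε) (haI : a ∈ I) {m : ℕ}
    (hm2 : 2 ≤ m) (hm : m ≤ I.card) (hε : 0 < ε) (hεh : ε ≤ h)
    (hd : 4 * h ≤ d) (hgap : ∀ r ∈ p.roots.toFinset, σ * (r - a) ≤ 0 ∨ d ≤ σ * (r - a))
    (hB : ∑ r ∈ p.roots.toFinset with d ≤ |r - a|, 1 / |r - a| ≤ B) :
    2 * ((h / ε) ^ m * Real.exp (-(4 * h * B))) ≤ |p.eval (a + σ * h)| := by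
  have hh : 0 < h := hε.trans_le hεh
  have hσ2 : |σ| = 1 := by rcases hσ with rfl | rfl <;> simp
  have hσσ : σ * σ = 1 := by rcases hσ with rfl | rfl <;> norm_num
  have habs : ∀ s r : ℝ, |a + σ * s - r| = |s - σ * (r - a)| := by
    intro s r
    have : a + σ * s - r = σ * (s - σ * (r - a)) := by linear_combination (r - a) * hσσ
    rw [this, abs_mul, hσ2, one_mul]
  have hIt : ∀ r ∈ I, -ε ≤ σ * (r - a) ∧ σ * (r - a) ≤ 0 := by
    intro r hr
    have h1 : |σ * (r - a)| ≤ ε := by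
      rw [abs_mul, hσ2, one_mul, abs_sub_comm]; exact (hI r hr).2
    refine ⟨(abs_le.1 h1).1, ?_⟩
    rcases hgap r (hp.mem_rootsFinset.2 (hI r hr).1) with h2 | h2
    · exact h2
    · linarith [(abs_le.1 h1).2]
  obtain ⟨r', hr', hne⟩ := Finset.exists_mem_ne (by omega : 1 < I.card) a
  -- The starting point with |p| ≥ 2 lies between `a` and a second root of the cluster; this is
  -- where 2 ≤ m enters. The coordinate x is measured from `a` in the direction of the gap.
  obtain ⟨x, hx, hx2⟩ : ∃ x, x ∈ Icc (-ε) 0 ∧ 2 ≤ |p.eval (a + σ * x)| := by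
    have hlt : σ * (r' - a) < 0 := lt_of_le_of_ne (hIt r' hr').2 (by
      intro h0
      rcases mul_eq_zero.1 h0 with h1 | h1
      · rw [h1] at hσ2; simp at hσ2
      · exact hne (by linarith))
    have h1 := (hIt r' hr').1
    rcases hσ with rfl | rfl
    · obtain ⟨x, hx, hx2⟩ := hp.exists_two_le_abs (by linarith : r' < a) (hI r' hr').1 (hI a haI).1
      exact ⟨x - a, ⟨by linarith [hx.1], by linarith [hx.2]⟩, by simpa using hx2⟩
    · obtain ⟨x, hx, hx2⟩ := hp.exists_two_le_abs (by linarith : a < r') (hI a haI).1 (hI r' hr').1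
      exact ⟨a - x, ⟨by linarith [hx.2], by linarith [hx.1]⟩, by simpa using hx2⟩
  have hgain := prod_abs_sub_gain p.roots.toFinset I (fun r => σ * (r - a)) hε hεh
    (fun r hr => hp.mem_rootsFinset.2 (hI r hr).1) hIt
    (fun r hr => (hgap r hr).imp_right hd.trans) hx.1 hx.2
  simp only [← habs] at hgain
  rw [← hp.abs_eval_eq, ← hp.abs_eval_eq] at hgain
  refine le_trans ?_ hgain
  -- Roots with positive coordinate lie beyond the gap, hence at distance at least `d` from `a`.
  have hsum : ∑ r ∈ p.roots.toFinset with 0 < σ * (r - a), 1 / (σ * (r - a)) ≤ B := by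
    have hpos : ∀ r, 0 < σ * (r - a) → σ * (r - a) = |r - a| := by
      intro r h0
      rw [← abs_of_pos h0, abs_mul, hσ2, one_mul]
    rw [Finset.sum_congr rfl fun r hr => by rw [hpos r (Finset.mem_filter.1 hr).2]]
    refine (Finset.sum_le_sum_of_subset_of_nonneg (fun r hr => ?_) fun r _ _ => ?_).trans hB
    · obtain ⟨hr1, hr2⟩ := Finset.mem_filter.1 hr
      refine Finset.mem_filter.2 ⟨hr1, ?_⟩
      rw [← hpos r hr2]
      exact (hgap r hr1).resolve_left hr2.not_ge
    · positivity
  have h1 : 1 ≤ h / ε := by rwa [le_div_iff₀ hε, one_mul]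
  have h2 : (h / ε) ^ m ≤ (h / ε) ^ I.card := pow_le_pow_right₀ h1 hm
  gcongr

/-- A discriminant is large at a point `E` whose distance from the roots is at least `d`, if
each root belongs to a cluster of `m` roots and far roots are sparse. -/
theorem le_abs_eval_of_far (hp : IsDiscriminant p) {E ε h d B : ℝ} {m : ℕ} (hm2 : 2 ≤ m)
    (hε : 0 < ε) (hεh : ε ≤ h) (hd : 4 * h ≤ d)
    (hclus : ∀ a, p.eval a = 0 → ∃ I : Finset ℝ,
      (∀ r ∈ I, p.eval r = 0 ∧ |a - r| ≤ ε) ∧ a ∈ I ∧ m ≤ I.card)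
    (hB : ∀ a, p.eval a = 0 →
      ∑ r ∈ p.roots.toFinset with d ≤ |r - a|, 1 / |r - a| ≤ B)
    (hfar : ∀ r, p.eval r = 0 → d ≤ |E - r|) :
    2 * ((h / ε) ^ m * Real.exp (-(4 * h * B))) ≤ |p.eval E| := by
  have hh : 0 < h := hε.trans_le hεh
  set Z := p.roots.toFinset with hZdef
  have hZ : ∀ r, r ∈ Z ↔ p.eval r = 0 := fun r => hp.mem_rootsFinset
  set L := 2 * ((h / ε) ^ m * Real.exp (-(4 * h * B))) with hL
  have hL0 : 0 < L := by positivity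
  have hsep : ∀ r ∈ Z, r ≤ E - d ∨ E + d ≤ r := by
    intro r hr
    have := hfar r ((hZ r).1 hr)
    rcases le_abs.1 this with h1 | h1
    · left; linarith
    · right; linarith
  have hne : Z.Nonempty := by
    obtain ⟨r, hr⟩ := Multiset.exists_mem_of_ne_zero (hp.splits.roots_ne_zero hp.degree_pos.ne')
    exact ⟨r, Multiset.mem_toFinset.2 hr⟩
  have hleft : ∀ a ∈ Z, a ≤ E → (∀ r ∈ Z, r ≤ E → r ≤ a) → L ≤ |p.eval (a + h)| := by
    intro a ha haE hmax
    obtain ⟨I, hI, haI, hm⟩ := hclus a ((hZ a).1 ha)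
    have := hp.le_abs_eval_near_cluster (σ := 1) (Or.inl rfl) I hI haI hm2 hm hε hεh hd
      (fun r hr => ?_) (hB a ((hZ a).1 ha))
    · simpa using this
    · rcases hsep r hr with h1 | h1
      · left; linarith [hmax r hr (by linarith)]
      · right; linarith
  have hright : ∀ a ∈ Z, E ≤ a → (∀ r ∈ Z, E ≤ r → a ≤ r) → L ≤ |p.eval (a - h)| := by
    intro a ha haE hmin
    obtain ⟨I, hI, haI, hm⟩ := hclus a ((hZ a).1 ha)
    have := hp.le_abs_eval_near_cluster (σ := -1) (Or.inr rfl) I hI haI hm2 hm hε hεh hd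
      (fun r hr => ?_) (hB a ((hZ a).1 ha))
    · simpa [← sub_eq_add_neg] using this
    · rcases hsep r hr with h1 | h1
      · right; linarith
      · left; linarith [hmin r hr (by linarith)]
  have hexL : ∀ r ∈ Z, r ≤ E → ∃ a ∈ Z, a ≤ E ∧ ∀ r ∈ Z, r ≤ E → r ≤ a := by
    intro r hr hrE
    obtain ⟨a, ha, hmax⟩ := (Z.filter (· ≤ E)).exists_max_image id
      ⟨r, Finset.mem_filter.2 ⟨hr, hrE⟩⟩
    rw [Finset.mem_filter] at ha
    exact ⟨a, ha.1, ha.2, fun r hr hrE => hmax r (Finset.mem_filter.2 ⟨hr, hrE⟩)⟩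
  have hexR : ∀ r ∈ Z, E ≤ r → ∃ a ∈ Z, E ≤ a ∧ ∀ r ∈ Z, E ≤ r → a ≤ r := by
    intro r hr hrE
    obtain ⟨a, ha, hmin⟩ := (Z.filter (E ≤ ·)).exists_min_image id
      ⟨r, Finset.mem_filter.2 ⟨hr, hrE⟩⟩
    rw [Finset.mem_filter] at ha
    exact ⟨a, ha.1, ha.2, fun r hr hrE => hmin r (Finset.mem_filter.2 ⟨hr, hrE⟩)⟩
  by_cases hl : ∃ r ∈ Z, r ≤ E
  · obtain ⟨r, hr, hrE⟩ := hl
    obtain ⟨a, ha, haE, hmax⟩ := hexL r hr hrE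
    have hLa := hleft a ha haE hmax
    have haE' : a ≤ E - d := (hsep a ha).resolve_right (by linarith)
    by_cases hu : ∃ r ∈ Z, E ≤ r
    · obtain ⟨r, hr, hrE⟩ := hu
      obtain ⟨b, hb, hbE, hmin⟩ := hexR r hr hrE
      have hLb := hright b hb hbE hmin
      have hbE' : E + d ≤ b := (hsep b hb).resolve_left (by linarith)
      rw [hp.abs_eval_eq] at *
      -- With roots on both sides, E lies in the root-free interval between the two shifted points,
      -- and concavity of log |p| reduces to its end points.
      refine le_prod_abs_sub_of_mem_Icc Z (a := a + h) (b := b - h)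
        ⟨by linarith, by linarith⟩ (fun r hr => ?_) hL0 hLa hLb
      rcases hsep r hr with h1 | h1
      · left; linarith [hmax r hr (by linarith)]
      · right; linarith [hmin r hr (by linarith)]
    · push Not at hu
      rw [hp.abs_eval_eq] at *
      -- With all roots on the left, moving from a + h on to E increases every factor.
      refine hLa.trans (Finset.prod_le_prod (fun r _ => abs_nonneg _) fun r hr => ?_)
      have h1 := hmax r hr (hu r hr).le
      rw [abs_of_nonneg (by linarith), abs_of_nonneg (by linarith)]
      linarith
  · push Not at hl
    obtain ⟨r, hr⟩ := hne
    obtain ⟨b, hb, hbE, hmin⟩ := hexR r hr (hl r hr).le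
    have hLb := hright b hb hbE hmin
    have hbE' : E + d ≤ b := (hsep b hb).resolve_left (by linarith)
    rw [hp.abs_eval_eq] at *
    refine hLb.trans (Finset.prod_le_prod (fun r _ => abs_nonneg _) fun r hr => ?_)
    have h1 := hmin r hr (hl r hr).le
    rw [abs_of_nonpos (by linarith), abs_of_nonpos (by linarith)]
    linarith

end IsDiscriminant

/-! ### Counting -/

/-- A sum of `1 / r` over a set with at most `A D ^ κ` points below `D`, with `κ < 1`. -/
theorem sum_one_div_le {ι : Type*} (Z : Finset ι) (t : ι → ℝ) {A κ d : ℝ}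
    (hA : 0 ≤ A) (hκ : κ < 1) (hd : 0 < d)
    (hcount : ∀ D, d ≤ D → ((Z.filter fun r => t r ≤ D).card : ℝ) ≤ A * D ^ κ) :
    ∑ r ∈ Z with d ≤ t r, 1 / t r ≤ 2 / (1 - (2 : ℝ) ^ (κ - 1)) * (A * d ^ (κ - 1)) := by
  classical
  -- Dyadic layers [e, 2e]: each contributes at most 2 A e^(κ-1), and doubling e multiplies this
  -- bound by ρ < 1. The geometric series gives 2/(1 - ρ).
  set ρ : ℝ := (2 : ℝ) ^ (κ - 1) with hρ
  have hρ1 : ρ < 1 := Real.rpow_lt_one_of_one_lt_of_neg one_lt_two (by linarith)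
  have hρ0 : 0 < ρ := by positivity
  have hlayer : ∀ e, d ≤ e →
      ∑ r ∈ Z with e ≤ t r ∧ t r ≤ 2 * e, 1 / t r ≤ 2 * (A * e ^ (κ - 1)) := by
    intro e he
    have he0 : 0 < e := hd.trans_le he
    calc ∑ r ∈ Z with e ≤ t r ∧ t r ≤ 2 * e, 1 / t r
        ≤ ∑ r ∈ Z with e ≤ t r ∧ t r ≤ 2 * e, 1 / e := by
          refine Finset.sum_le_sum fun r hr => ?_
          exact one_div_le_one_div_of_le he0 (Finset.mem_filter.1 hr).2.1
      _ = ((Z.filter fun r => e ≤ t r ∧ t r ≤ 2 * e).card : ℝ) * (1 / e) := by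
          rw [Finset.sum_const, nsmul_eq_mul]
      _ ≤ ((Z.filter fun r => t r ≤ 2 * e).card : ℝ) * (1 / e) := by
          gcongr
          exact fun h => h.2
      _ ≤ (A * (2 * e) ^ κ) * (1 / e) := by
          gcongr
          exact hcount _ (by linarith)
      _ = (2 : ℝ) ^ κ * (A * e ^ (κ - 1)) := by
          rw [Real.mul_rpow two_pos.le he0.le, Real.rpow_sub_one he0.ne']
          ring
      _ ≤ 2 * (A * e ^ (κ - 1)) := by
          gcongr
          calc (2 : ℝ) ^ κ ≤ 2 ^ (1 : ℝ) := Real.rpow_le_rpow_of_exponent_le one_le_two hκ.le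
            _ = 2 := Real.rpow_one 2
  have hmain : ∀ n : ℕ, ∀ e, d ≤ e → (∀ r ∈ Z, t r < 2 ^ n * e) →
      ∑ r ∈ Z with e ≤ t r, 1 / t r ≤ 2 / (1 - ρ) * (A * e ^ (κ - 1)) := by
    intro n
    induction n with
    | zero =>
      intro e he hlt
      rw [Finset.filter_false_of_mem fun r hr => by simpa using hlt r hr, Finset.sum_empty]
      have : 0 < 1 - ρ := by linarith
      have : 0 < e := hd.trans_le he
      positivity
    | succ n ih =>
      intro e he hlt
      have he0 : 0 < e := hd.trans_le he
      have hih := ih (2 * e) (by linarith) fun r hr => by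
        have := hlt r hr
        rw [pow_succ] at this
        linarith
      have hsplit : (Z.filter fun r => e ≤ t r)
          ⊆ (Z.filter fun r => e ≤ t r ∧ t r ≤ 2 * e) ∪ Z.filter fun r => 2 * e ≤ t r := by
        intro r hr
        simp only [Finset.mem_union, Finset.mem_filter] at hr ⊢
        rcases le_total (t r) (2 * e) with h | h
        · exact Or.inl ⟨hr.1, hr.2, h⟩
        · exact Or.inr ⟨hr.1, h⟩
      have hnn : ∀ r ∈ (Z.filter fun r => e ≤ t r ∧ t r ≤ 2 * e) ∪ Z.filter fun r => 2 * e ≤ t r,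
          0 ≤ 1 / t r := by
        intro r hr
        simp only [Finset.mem_union, Finset.mem_filter] at hr
        have : 0 < t r := by rcases hr with h | h <;> linarith [h.2]
        positivity
      have hρe : (2 * e) ^ (κ - 1) = ρ * e ^ (κ - 1) := Real.mul_rpow two_pos.le he0.le
      calc ∑ r ∈ Z with e ≤ t r, 1 / t r
          ≤ ∑ r ∈ (Z.filter fun r => e ≤ t r ∧ t r ≤ 2 * e) ∪ Z.filter fun r => 2 * e ≤ t r,
              1 / t r := Finset.sum_le_sum_of_subset_of_nonneg hsplit fun r hr _ => hnn r hr
        _ ≤ ∑ r ∈ Z with e ≤ t r ∧ t r ≤ 2 * e, 1 / t r + ∑ r ∈ Z with 2 * e ≤ t r, 1 / t r := by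
            rw [← Finset.sum_union_inter]
            refine le_add_of_nonneg_right (Finset.sum_nonneg fun r hr => hnn r ?_)
            exact Finset.mem_union_left _ (Finset.mem_inter.1 hr).1
        _ ≤ 2 * (A * e ^ (κ - 1)) + 2 / (1 - ρ) * (A * (2 * e) ^ (κ - 1)) :=
            add_le_add (hlayer e he) hih
        _ = 2 / (1 - ρ) * (A * e ^ (κ - 1)) := by
            rw [hρe]
            have : 1 - ρ ≠ 0 := by linarith
            field_simp
            ring
  obtain ⟨M, hM⟩ := (Z.image t).finite_toSet.bddAbove
  obtain ⟨n, hn⟩ := pow_unbounded_of_one_lt (M / d) one_lt_two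
  refine hmain n d le_rfl fun r hr => ?_
  rw [div_lt_iff₀ hd] at hn
  exact (hM (by simpa using ⟨r, hr, rfl⟩)).trans_lt hn

end

end Schrodinger

namespace Schrodinger

section

open Polynomial ComplexConjugate

/-! ### Solutions of the difference equation -/

/-- `ψ` solves `ψ_{n+2} + ψ_n = (z - v_n) ψ_{n+1}` for `n < q`. -/
def IsSol (v : ℕ → ℝ) (z : ℂ) (q : ℕ) (ψ : ℕ → ℂ) : Prop :=
  ∀ n < q, ψ (n + 2) + ψ n = (z - v n) * ψ (n + 1)

/-- The current of a solution. -/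
def current (ψ : ℕ → ℂ) (n : ℕ) : ℝ := (conj (ψ n) * ψ (n + 1)).im

/-- The potential is real, so only Im z changes the current. -/
theorem IsSol.current_succ {v : ℕ → ℝ} {z : ℂ} {q : ℕ} {ψ : ℕ → ℂ} (h : IsSol v z q ψ) {n : ℕ}
    (hn : n < q) : current ψ (n + 1) = current ψ n + z.im * ‖ψ (n + 1)‖ ^ 2 := by
  have h1 : ψ (n + 2) = (z - v n) * ψ (n + 1) - ψ n := by rw [← h n hn]; ring
  rw [current, current, show n + 1 + 1 = n + 2 from rfl, h1, Complex.sq_norm,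
    Complex.normSq_apply]
  simp only [Complex.mul_im, Complex.sub_re, Complex.sub_im, Complex.mul_re, Complex.conj_re,
    Complex.conj_im, Complex.ofReal_re, Complex.ofReal_im]
  ring

theorem IsSol.current_eq {v : ℕ → ℝ} {z : ℂ} {q : ℕ} {ψ : ℕ → ℂ} (h : IsSol v z q ψ) {n : ℕ}
    (hn : n ≤ q) :
    current ψ n = current ψ 0 + z.im * ∑ k ∈ Finset.range n, ‖ψ (k + 1)‖ ^ 2 := by
  induction n with
  | zero => simp
  | succ n ih =>
    rw [h.current_succ hn, ih (Nat.le_of_succ_le hn), Finset.sum_range_succ]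
    ring

theorem IsSol.wronskian {v : ℕ → ℝ} {z : ℂ} {q : ℕ} {ψ χ : ℕ → ℂ} (h : IsSol v z q ψ)
    (h' : IsSol v z q χ) {n : ℕ} (hn : n ≤ q) :
    ψ (n + 1) * χ n - ψ n * χ (n + 1) = ψ 1 * χ 0 - ψ 0 * χ 1 := by
  induction n with
  | zero => simp
  | succ n ih =>
    rw [← ih (Nat.le_of_succ_le hn)]
    linear_combination (χ (n + 1)) * h n hn - ψ (n + 1) * h' n hn

theorem IsSol.combine {v : ℕ → ℝ} {z : ℂ} {q : ℕ} {ψ χ : ℕ → ℂ} (h : IsSol v z q ψ)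
    (h' : IsSol v z q χ) (a b : ℂ) : IsSol v z q fun n => a * ψ n + b * χ n := by
  intro n hn
  linear_combination a * h n hn + b * h' n hn

theorem IsSol.ext {v : ℕ → ℝ} {z : ℂ} {q : ℕ} {ψ χ : ℕ → ℂ} (h : IsSol v z q ψ)
    (h' : IsSol v z q χ) (h0 : ψ 0 = χ 0) (h1 : ψ 1 = χ 1) {n : ℕ} (hn : n ≤ q) :
    ψ n = χ n ∧ ψ (n + 1) = χ (n + 1) := by
  induction n with
  | zero => exact ⟨h0, h1⟩
  | succ n ih =>
    obtain ⟨e0, e1⟩ := ih (Nat.le_of_succ_le hn)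
    refine ⟨e1, ?_⟩
    linear_combination h n hn - h' n hn - e0 + (z - v n) * e1

/-- The polynomial solution with initial values `a`, `b` at the sites `0`, `1`. -/
noncomputable def solPoly (v : ℕ → ℝ) (a b : ℝ) : ℕ → ℝ[X]
  | 0 => C a
  | 1 => C b
  | n + 2 => (X - C (v n)) * solPoly v a b (n + 1) - solPoly v a b n

/-- The values of `solPoly` at `z`. -/
noncomputable def sol (v : ℕ → ℝ) (a b : ℝ) (z : ℂ) (n : ℕ) : ℂ := aeval z (solPoly v a b n)

theorem sol_zero (v : ℕ → ℝ) (a b : ℝ) (z : ℂ) : sol v a b z 0 = a := by simp [sol, solPoly]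

theorem sol_one (v : ℕ → ℝ) (a b : ℝ) (z : ℂ) : sol v a b z 1 = b := by simp [sol, solPoly]

theorem isSol_sol (v : ℕ → ℝ) (a b : ℝ) (z : ℂ) (q : ℕ) : IsSol v z q (sol v a b z) := by
  intro n _
  simp only [sol, solPoly, map_sub, map_mul, aeval_X, aeval_C, Complex.coe_algebraMap]
  ring

/-- The discriminant (trace of the transfer matrix over `q` sites). -/
noncomputable def discr (v : ℕ → ℝ) (q : ℕ) : ℝ[X] := solPoly v 0 1 (q + 1) + solPoly v 1 0 q

theorem aeval_discr (v : ℕ → ℝ) (q : ℕ) (z : ℂ) :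
    aeval z (discr v q) = sol v 0 1 z (q + 1) + sol v 1 0 z q := by
  simp [discr, sol]

/-- Unimodularity of the transfer matrix, by constancy of the Wronskian. -/
theorem sol_det (v : ℕ → ℝ) (z : ℂ) (q : ℕ) :
    sol v 0 1 z (q + 1) * sol v 1 0 z q - sol v 0 1 z q * sol v 1 0 z (q + 1) = 1 := by
  rw [(isSol_sol v 0 1 z q).wronskian (isSol_sol v 1 0 z q) le_rfl]
  simp [sol_zero, sol_one]

theorem IsSol.eq_sol {v : ℕ → ℝ} {z : ℂ} {q : ℕ} {ψ : ℕ → ℂ} (h : IsSol v z q ψ) {n : ℕ}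
    (hn : n ≤ q + 1) : ψ n = ψ 1 * sol v 0 1 z n + ψ 0 * sol v 1 0 z n := by
  have h' := (isSol_sol v 0 1 z q).combine (isSol_sol v 1 0 z q) (ψ 1) (ψ 0)
  have key := fun {m : ℕ} (hm : m ≤ q) =>
    h.ext h' (by simp [sol_zero]) (by simp [sol_one]) hm
  rcases Nat.lt_or_ge n (q + 1) with h1 | h1
  · exact (key (by omega)).1
  · obtain rfl : n = q + 1 := by omega
    exact (key le_rfl).2

/-- The degree bound on the preceding polynomial is carried through the induction so that
subtracting it leaves the leading term intact. -/
theorem monic_solPoly (v : ℕ → ℝ) (n : ℕ) :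
    (solPoly v 0 1 (n + 1)).Monic ∧ (solPoly v 0 1 (n + 1)).natDegree = n ∧
      (solPoly v 0 1 n).degree < (n : ℕ) := by
  induction n with
  | zero => simp [solPoly]
  | succ n ih =>
    obtain ⟨hm, hd, hlt⟩ := ih
    have hprod : ((X - C (v n)) * solPoly v 0 1 (n + 1)).Monic := (monic_X_sub_C _).mul hm
    have hdeg : ((X - C (v n)) * solPoly v 0 1 (n + 1)).natDegree = n + 1 := by
      rw [(monic_X_sub_C _).natDegree_mul hm, natDegree_X_sub_C, hd, add_comm]
    have hdeg' : (solPoly v 0 1 n).degree < ((X - C (v n)) * solPoly v 0 1 (n + 1)).degree := by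
      rw [degree_eq_natDegree hprod.ne_zero, hdeg]
      exact hlt.trans (by exact_mod_cast Nat.lt_succ_self n)
    refine ⟨hprod.sub_of_left hdeg', ?_, ?_⟩
    · rw [solPoly, sub_eq_add_neg, natDegree_add_eq_left_of_degree_lt (by rwa [degree_neg]), hdeg]
    · rw [degree_eq_natDegree hm.ne_zero, hd]
      exact_mod_cast Nat.lt_succ_self n

theorem degree_solPoly_lt (v : ℕ → ℝ) (n : ℕ) :
    (solPoly v 1 0 (n + 1)).degree < ((n + 1 : ℕ) : WithBot ℕ) ∧
      (solPoly v 1 0 n).degree < ((n + 2 : ℕ) : WithBot ℕ) := by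
  induction n with
  | zero =>
    simp [solPoly]
  | succ n ih =>
    refine ⟨?_, ih.1.trans (by exact_mod_cast (by omega))⟩
    rw [solPoly]
    refine (degree_sub_le _ _).trans_lt (max_lt ?_ ih.2)
    rw [degree_mul, degree_X_sub_C]
    have h1 := ih.1
    generalize (solPoly v 1 0 (n + 1)).degree = d at *
    cases d with
    | bot => exact WithBot.bot_lt_coe _
    | coe d =>
      have : d < n + 1 := WithBot.coe_lt_coe.1 h1
      exact WithBot.coe_lt_coe.2 (show 1 + d < n + 1 + 1 by omega)

theorem monic_discr (v : ℕ → ℝ) {q : ℕ} (hq : 0 < q) : (discr v q).Monic := by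
  obtain ⟨n, rfl⟩ : ∃ n, q = n + 1 := ⟨q - 1, by omega⟩
  obtain ⟨hm, hd, -⟩ := monic_solPoly v (n + 1)
  refine hm.add_of_left ?_
  rw [degree_eq_natDegree hm.ne_zero, hd]
  exact (degree_solPoly_lt v n).1

theorem natDegree_discr (v : ℕ → ℝ) {q : ℕ} (hq : 0 < q) : (discr v q).natDegree = q := by
  obtain ⟨n, rfl⟩ : ∃ n, q = n + 1 := ⟨q - 1, by omega⟩
  obtain ⟨hm, hd, -⟩ := monic_solPoly v (n + 1)
  have h1 : (solPoly v 1 0 (n + 1)).degree < (solPoly v 0 1 (n + 1 + 1)).degree := by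
    rw [degree_eq_natDegree hm.ne_zero, hd]
    exact (degree_solPoly_lt v n).1
  rw [discr, natDegree_add_eq_left_of_degree_lt h1, hd]

/-! ### Floquet solutions -/

/-- The transfer matrix has determinant 1 and trace w + w⁻¹, so w is an eigenvalue. An eigenvector
provides the values at the sites 1 and 0. -/
theorem exists_floquet {v : ℕ → ℝ} {q : ℕ} {z w : ℂ} (hw : w ≠ 0)
    (h : aeval z (discr v q) = w + w⁻¹) :
    ∃ ψ : ℕ → ℂ, IsSol v z q ψ ∧ ψ (q + 1) = w * ψ 1 ∧ ψ q = w * ψ 0 ∧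
      (ψ 0 ≠ 0 ∨ ψ 1 ≠ 0) := by
  set a := sol v 0 1 z (q + 1) with ha
  set b := sol v 1 0 z (q + 1) with hb
  set c := sol v 0 1 z q with hc
  set d := sol v 1 0 z q with hd
  have hdet : a * d - c * b = 1 := sol_det v z q
  rw [aeval_discr] at h
  have h0 : Matrix.det !![a - w, b; c, d - w] = 0 := by
    rw [Matrix.det_fin_two_of]
    have : w * w⁻¹ = 1 := mul_inv_cancel₀ hw
    linear_combination hdet - w * h - this
  obtain ⟨x, hx, hx0⟩ := Matrix.exists_mulVec_eq_zero_iff.2 h0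
  have e0 := congrFun hx0 0
  have e1 := congrFun hx0 1
  simp [Matrix.mulVec, dotProduct, Fin.sum_univ_two] at e0 e1
  refine ⟨_, (isSol_sol v 0 1 z q).combine (isSol_sol v 1 0 z q) (x 0) (x 1), ?_, ?_, ?_⟩
  · simp only [sol_one, Complex.ofReal_one, Complex.ofReal_zero]
    linear_combination e0
  · simp only [sol_zero, Complex.ofReal_one, Complex.ofReal_zero]
    linear_combination e1
  · simp only [sol_zero, sol_one, Complex.ofReal_one, Complex.ofReal_zero, mul_zero, mul_one,
      zero_add, add_zero]
    by_contra! hcon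
    refine hx (funext fun i => ?_)
    fin_cases i
    exacts [hcon.2, hcon.1]

theorem discr_of_floquet {v : ℕ → ℝ} {q : ℕ} {z w : ℂ} (hw : w ≠ 0) {ψ : ℕ → ℂ}
    (hψ : IsSol v z q ψ) (h1 : ψ (q + 1) = w * ψ 1) (h0 : ψ q = w * ψ 0)
    (hne : ψ 0 ≠ 0 ∨ ψ 1 ≠ 0) : aeval z (discr v q) = w + w⁻¹ := by
  set a := sol v 0 1 z (q + 1) with ha
  set b := sol v 1 0 z (q + 1) with hb
  set c := sol v 0 1 z q with hc
  set d := sol v 1 0 z q with hd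
  have hdet : a * d - c * b = 1 := sol_det v z q
  have e1 : ψ (q + 1) = ψ 1 * a + ψ 0 * b := hψ.eq_sol le_rfl
  have e0 : ψ q = ψ 1 * c + ψ 0 * d := hψ.eq_sol (Nat.le_succ q)
  rw [h1] at e1
  rw [h0] at e0
  have hww : w * w⁻¹ = 1 := mul_inv_cancel₀ hw
  have key : (a - w) * (d - w) - b * c = 0 := by
    rcases hne with h | h
    · refine (mul_eq_zero.1 (?_ : ψ 0 * _ = 0)).resolve_left h
      linear_combination (w - a) * e0 + c * e1
    · refine (mul_eq_zero.1 (?_ : ψ 1 * _ = 0)).resolve_left h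
      linear_combination (w - d) * e1 + b * e0
  rw [aeval_discr]
  refine mul_left_cancel₀ hw ?_
  linear_combination hdet - key - hww

/-- For |w| = 1 the current agrees at 0 and q, yet it changes by Im z times the sum of |ψ|² over the
sites 1, …, q, and this sum cannot vanish. -/
theorem im_eq_zero_of_discr {v : ℕ → ℝ} {q : ℕ} (hq : 0 < q) {z w : ℂ} (hw : ‖w‖ = 1)
    (h : aeval z (discr v q) = w + w⁻¹) : z.im = 0 := by
  have hw0 : w ≠ 0 := by rintro rfl; simp at hw
  obtain ⟨ψ, hψ, h1, h0, hne⟩ := exists_floquet hw0 h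
  have hc := hψ.current_eq le_rfl
  have hc' : current ψ q = current ψ 0 := by
    rw [current, current, h1, h0, map_mul]
    have : conj w * w = 1 := by
      rw [← Complex.normSq_eq_conj_mul_self, Complex.normSq_eq_norm_sq, hw]; simp
    congr 1
    linear_combination (conj (ψ 0) * ψ 1) * this
  rw [hc', left_eq_add] at hc
  refine (mul_eq_zero.1 hc).resolve_right fun hs => ?_
  rw [Finset.sum_eq_zero_iff_of_nonneg fun _ _ => by positivity] at hs
  have z1 : ψ 1 = 0 := by simpa using hs 0 (Finset.mem_range.2 hq)
  have zq : ψ q = 0 := by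
    have := hs (q - 1) (Finset.mem_range.2 (by omega))
    rw [Nat.sub_add_cancel hq] at this
    simpa using this
  rw [zq, zero_eq_mul] at h0
  exact hne.elim (fun h => h (h0.resolve_left hw0)) fun h => h z1

theorem splits_discr_sub {v : ℕ → ℝ} {q : ℕ} (hq : 0 < q) {w : ℂ} (hw : ‖w‖ = 1) {c : ℝ}
    (hc : (c : ℂ) = w + w⁻¹) : (discr v q - C c).Splits := by
  refine (IsAlgClosed.splits ((discr v q - C c).map (algebraMap ℝ ℂ))).of_splits_map_of_injective
    (algebraMap ℝ ℂ).injective fun z hz => ?_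
  have hz' := isRoot_of_mem_roots hz
  rw [IsRoot.def, eval_map_algebraMap, map_sub, aeval_C, sub_eq_zero] at hz'
  have := im_eq_zero_of_discr hq hw (hz'.trans hc)
  exact ⟨z.re, Complex.ext (by simp) (by simp [this])⟩

/-- The multipliers i, 1 and -1 make w + w⁻¹ equal to 0, 2 and -2, the three values at which real
roots are required. -/
theorem isDiscriminant_discr (v : ℕ → ℝ) {q : ℕ} (hq : 0 < q) : IsDiscriminant (discr v q) where
  monic := monic_discr v hq
  degree_pos := by rwa [natDegree_discr v hq]
  splits := by
    simpa using splits_discr_sub (v := v) hq (w := Complex.I) (by simp) (c := 0) (by simp)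
  splits_sub := splits_discr_sub (v := v) hq (w := 1) (by simp) (c := 2) (by norm_num)
  splits_add := by
    simpa using splits_discr_sub (v := v) hq (w := -1) (by simp) (c := -2) (by norm_num)

theorem aeval_discr_ofReal (v : ℕ → ℝ) (q : ℕ) (E : ℝ) :
    aeval (E : ℂ) (discr v q) = ((discr v q).eval E : ℝ) := by
  rw [← Complex.coe_algebraMap, aeval_algebraMap_apply, coe_aeval_eq_eval, Complex.coe_algebraMap]

/-- Where |ψ| is maximal for a Floquet solution, the recursion gives |E - v| ≤ 2. The multiplier is
unimodular, so the maximum over 1, …, q also dominates the sites 0 and q + 1. -/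
theorem abs_le_of_discr_eq_zero {v : ℕ → ℝ} {M : ℝ} (hM : ∀ n, |v n| ≤ M) {q : ℕ} (hq : 0 < q)
    {E : ℝ} (h : (discr v q).eval E = 0) : |E| ≤ M + 2 := by
  obtain ⟨ψ, hψ, h1, h0, hne⟩ := exists_floquet (v := v) (q := q) (z := E) Complex.I_ne_zero
    (by rw [aeval_discr_ofReal, h]; simp)
  have n1 : ‖ψ (q + 1)‖ = ‖ψ 1‖ := by rw [h1, norm_mul, Complex.norm_I, one_mul]
  have n0 : ‖ψ q‖ = ‖ψ 0‖ := by rw [h0, norm_mul, Complex.norm_I, one_mul]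
  obtain ⟨k, hk, hmax⟩ := (Finset.range q).exists_max_image (fun k => ‖ψ (k + 1)‖)
    ⟨0, Finset.mem_range.2 hq⟩
  rw [Finset.mem_range] at hk
  have hq' : ‖ψ q‖ ≤ ‖ψ (k + 1)‖ := by
    have := hmax (q - 1) (Finset.mem_range.2 (by omega))
    rwa [Nat.sub_add_cancel hq] at this
  have hall : ∀ n ≤ q + 1, ‖ψ n‖ ≤ ‖ψ (k + 1)‖ := by
    intro n hn
    rcases Nat.eq_zero_or_pos n with rfl | hpos
    · rw [← n0]; exact hq'
    · rcases Nat.lt_or_ge n (q + 1) with hlt | hge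
      · have := hmax (n - 1) (Finset.mem_range.2 (by omega))
        rwa [Nat.sub_add_cancel hpos] at this
      · obtain rfl : n = q + 1 := by omega
        rw [n1]
        exact hmax 0 (Finset.mem_range.2 hq)
  have hpos : 0 < ‖ψ (k + 1)‖ := by
    rcases hne with h | h
    · exact (norm_pos_iff.2 h).trans_le (hall 0 (by omega))
    · exact (norm_pos_iff.2 h).trans_le (hall 1 (by omega))
  have hrec : |E - v k| * ‖ψ (k + 1)‖ ≤ 2 * ‖ψ (k + 1)‖ := by
    have : ‖((E : ℂ) - v k) * ψ (k + 1)‖ = |E - v k| * ‖ψ (k + 1)‖ := by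
      rw [norm_mul, ← Complex.ofReal_sub, Complex.norm_real, Real.norm_eq_abs]
    rw [← this, ← hψ k hk]
    refine (norm_add_le _ _).trans ?_
    linarith [hall (k + 2) (by omega), hall k (by omega)]
  have h2 := le_of_mul_le_mul_right hrec hpos
  calc |E| = |(E - v k) + v k| := by ring_nf
    _ ≤ |E - v k| + |v k| := abs_add_le _ _
    _ ≤ M + 2 := by linarith [hM k]

/-! ### The eigenvalues of the truncation -/

/-- The potential, indexed by `ℕ`. -/
def pot (V : ℕ+ → ℝ) (n : ℕ) : ℝ := V n.succPNat

/-- The corner entries supply the neighbours that the tridiagonal part lacks at the first and last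
sites. -/
theorem truncation_mulVec (V : ℕ+ → ℝ) {q : ℕ} (k : ℝ) (ψ : ℕ → ℂ)
    (h1 : ψ (q + 1) = Complex.exp (Complex.I * k) * ψ 1)
    (h0 : ψ 0 = Complex.exp (-(Complex.I * k)) * ψ q) (i : Fin q) :
    ((truncation V q k).mulVec fun j : Fin q => ψ (j + 1)) i
      = ψ (i + 2) + ψ i + pot V i * ψ (i + 1) := by
  obtain ⟨m, rfl⟩ : ∃ m, q = m + 1 := ⟨q - 1, by have := i.2; omega⟩
  obtain ⟨i, hi⟩ := i
  have hadj : ∀ j : ℕ, (if i + 1 = j ∨ j + 1 = i then (1 : ℂ) else 0)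
      = (if i + 1 = j then 1 else 0) + if j + 1 = i then 1 else 0 := by
    intro j
    by_cases h : i + 1 = j
    · rw [if_pos (Or.inl h), if_pos h, if_neg (by omega), add_zero]
    · simp [h]
  have hsum := Fin.sum_univ_eq_sum_range (α := ℂ) (fun j => ((if i = j then (pot V i : ℂ) else 0)
    + ((if i + 1 = j then 1 else 0) + if j + 1 = i then 1 else 0)
    + (if i = 0 ∧ j + 1 = m + 1 then Complex.exp (-(Complex.I * (k : ℂ))) else 0)
    + (if i + 1 = m + 1 ∧ j = 0 then Complex.exp (Complex.I * (k : ℂ)) else 0)) * ψ (j + 1)) (m + 1)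
  have e1 : ((truncation V (m + 1) k).mulVec fun j : Fin (m + 1) => ψ (j + 1)) ⟨i, hi⟩
      = ∑ j : Fin (m + 1), ((if i = j then (pot V i : ℂ) else 0)
    + ((if i + 1 = j then 1 else 0) + if (j : ℕ) + 1 = i then 1 else 0)
    + (if i = 0 ∧ (j : ℕ) + 1 = m + 1 then Complex.exp (-(Complex.I * (k : ℂ))) else 0)
    + (if i + 1 = m + 1 ∧ (j : ℕ) = 0 then Complex.exp (Complex.I * (k : ℂ)) else 0))
      * ψ (j + 1) := by
    change ∑ j : Fin (m + 1), truncation V (m + 1) k ⟨i, hi⟩ j * ψ (j + 1) = _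
    refine Finset.sum_congr rfl fun j _ => ?_
    rw [← hadj, truncation, Matrix.of_apply]
    simp only [Fin.ext_iff, pot]
  rw [e1, hsum]
  simp only [add_mul, Finset.sum_add_distrib, ite_mul, zero_mul, one_mul, ite_and,
    add_left_inj]
  have hnext : (∑ j ∈ Finset.range (m + 1), if i + 1 = j then ψ (j + 1) else 0)
      + (∑ j ∈ Finset.range (m + 1), if i = m then
        if j = 0 then Complex.exp (Complex.I * k) * ψ (j + 1) else 0 else 0) = ψ (i + 2) := by
    rw [Finset.sum_ite_eq]
    rcases Nat.lt_or_ge i m with h | h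
    · simp [h, h.ne]
    · obtain rfl : i = m := by omega
      simp [h1]
  have hprev : (∑ j ∈ Finset.range (m + 1), if j + 1 = i then ψ (j + 1) else 0)
      + (∑ j ∈ Finset.range (m + 1), if i = 0 then
        if j = m then Complex.exp (-(Complex.I * k)) * ψ (j + 1) else 0 else 0) = ψ i := by
    cases i with
    | zero => simp [h0]
    | succ i => simp [show i < m + 1 by omega]
  have hdiag : (∑ j ∈ Finset.range (m + 1), if i = j then (pot V i : ℂ) * ψ (j + 1) else 0)
      = pot V i * ψ (i + 1) := by
    simp [hi]
  rw [hdiag, ← hnext, ← hprev]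
  ring

/-- An eigenvector, extended to the sites 0 and q + 1 by the boundary condition, is a Floquet
solution with multiplier i, and i + i⁻¹ = 0. -/
theorem mem_eigenvalueSet_iff (V : ℕ+ → ℝ) {q : ℕ} (hq : 0 < q) (E : ℝ) :
    E ∈ eigenvalueSet V q ↔ (discr (pot V) q).eval E = 0 := by
  have hI : Complex.exp (Complex.I * ((Real.pi / 2 : ℝ) : ℂ)) = Complex.I := by
    rw [mul_comm]; push_cast; exact Complex.exp_pi_div_two_mul_I
  have hI' : Complex.exp (-(Complex.I * ((Real.pi / 2 : ℝ) : ℂ))) = Complex.I⁻¹ := by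
    rw [Complex.exp_neg, hI]
  rw [eigenvalueSet, mem_ofPred_eq]
  constructor
  · intro h
    obtain ⟨x, hx⟩ := h.exists_hasEigenvector
    have hx0 := hx.2
    have hxe := hx.apply_eq_smul
    rw [Matrix.toLin'_apply] at hxe
    set ψ : ℕ → ℂ := fun n => if n = 0 then Complex.I⁻¹ * x ⟨q - 1, by omega⟩ else
      if hn : n - 1 < q then x ⟨n - 1, hn⟩ else Complex.I * x ⟨0, hq⟩ with hψ
    have hψx : ∀ j : Fin q, ψ (j + 1) = x j := by
      intro j
      simp [hψ]
    have hψ0 : ψ 0 = Complex.I⁻¹ * ψ q := by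
      have : q ≠ 0 := hq.ne'
      simp [hψ, this, hq]
    have hψ1 : ψ (q + 1) = Complex.I * ψ 1 := by
      simp [hψ, hq]
    have hx' : (fun j : Fin q => ψ (j + 1)) = x := funext hψx
    have hsol : IsSol (pot V) E q ψ := by
      intro n hn
      have := congrFun hxe ⟨n, hn⟩
      rw [← hx', truncation_mulVec V _ ψ (by rw [hI, hψ1]) (by rw [hI', hψ0])] at this
      simp only [Pi.smul_apply, smul_eq_mul] at this
      linear_combination this
    have hne : ψ 0 ≠ 0 ∨ ψ 1 ≠ 0 := by
      by_contra! hcon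
      refine hx0 (funext fun j => ?_)
      rw [← hψx, (hsol.eq_sol (n := j + 1) (by omega)), hcon.1, hcon.2]
      simp
    have hD := discr_of_floquet Complex.I_ne_zero hsol hψ1
      (by rw [hψ0, mul_inv_cancel_left₀ Complex.I_ne_zero]) hne
    rw [aeval_discr_ofReal] at hD
    simpa using hD
  · intro h
    obtain ⟨ψ, hψ, h1, h0, hne⟩ := exists_floquet (v := pot V) (q := q) (z := E) Complex.I_ne_zero
      (by rw [aeval_discr_ofReal, h]; simp)
    refine Module.End.hasEigenvalue_of_hasEigenvector (x := fun j : Fin q => ψ (j + 1)) ⟨?_, ?_⟩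
    · rw [Module.End.mem_eigenspace_iff, Matrix.toLin'_apply]
      ext i
      rw [truncation_mulVec V _ ψ (by rw [hI, h1]) (by
        rw [hI', h0, inv_mul_cancel_left₀ Complex.I_ne_zero]), hψ i i.2]
      simp only [pot, Pi.smul_apply, smul_eq_mul]
      ring
    · intro h
      have hz : ∀ j, j < q → ψ (j + 1) = 0 := fun j hj => congrFun h ⟨j, hj⟩
      have z1 := hz 0 hq
      have zq := hz (q - 1) (by omega)
      rw [Nat.sub_add_cancel hq, h0, mul_eq_zero] at zq
      exact hne.elim (fun h => h (zq.resolve_left Complex.I_ne_zero)) fun h => h z1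

end

end Schrodinger

namespace Schrodinger

section

open Polynomial ComplexConjugate

/-! ### Decay of the resolvent in terms of the discriminant -/

/-- The current of this solution starts from 0 and accumulates the nonnegative terms Im z |φ_k|², so
it dominates each of them. -/
theorem norm_sq_mul_im_le_current_sol (v : ℕ → ℝ) {z : ℂ} (hz : 0 < z.im) {q k : ℕ}
    (hk : k < q) : z.im * ‖sol v 0 1 z (k + 1)‖ ^ 2 ≤ current (sol v 0 1 z) q := by
  rw [(isSol_sol v 0 1 z q).current_eq le_rfl]
  have h0 : current (sol v 0 1 z) 0 = 0 := by simp [current, sol_zero]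
  rw [h0, zero_add]
  gcongr
  exact Finset.single_le_sum (f := fun k => ‖sol v 0 1 z (k + 1)‖ ^ 2)
    (fun _ _ => by positivity) (Finset.mem_range.2 hk)

theorem sol_ne_zero (v : ℕ → ℝ) {z : ℂ} (hz : 0 < z.im) {q : ℕ} (hq : 0 < q) :
    sol v 0 1 z q ≠ 0 ∧ sol v 0 1 z (q + 1) ≠ 0 := by
  have h := norm_sq_mul_im_le_current_sol v hz hq
  have h1 : sol v 0 1 z (0 + 1) = 1 := by simpa using sol_one v 0 1 z
  rw [h1, norm_one, one_pow, mul_one] at h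
  constructor <;> intro h0 <;> simp [current, h0] at h <;> linarith

/-- Let χ be the solution with χ_0 = 1 and χ_{q+1} = 0, and m = χ_1, a Weyl function of the finite
box. The discriminant is φ_{q+1} - m φ_q + χ_q, and the current identity for χ bounds |m| and |χ_q|
by 1/Im z. -/
theorem norm_discr_le (v : ℕ → ℝ) {z : ℂ} (hz : 0 < z.im) {q : ℕ} (hq : 0 < q) :
    ‖aeval z (discr v q)‖
      ≤ ‖sol v 0 1 z (q + 1)‖ + (z.im)⁻¹ * ‖sol v 0 1 z q‖ + (z.im)⁻¹ := by
  set m : ℂ := -(sol v 1 0 z (q + 1) / sol v 0 1 z (q + 1)) with hm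
  have hχ := (isSol_sol v 1 0 z q).combine (isSol_sol v 0 1 z q) 1 m
  set χ : ℕ → ℂ := fun n => 1 * sol v 1 0 z n + m * sol v 0 1 z n with hχdef
  have h0 : χ 0 = 1 := by simp [hχdef, sol_zero]
  have h1 : χ 1 = m := by simp [hχdef, sol_one]
  have hend : χ (q + 1) = 0 := by
    simp only [hχdef, hm]
    field_simp [(sol_ne_zero v hz hq).2]
    ring
  have hc := hχ.current_eq le_rfl
  have hcq : current χ q = 0 := by simp [current, hend]
  have hc0 : current χ 0 = m.im := by simp [current, h0, h1]
  rw [hcq, hc0] at hc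
  have hsum : ∀ k < q, z.im * ‖χ (k + 1)‖ ^ 2 ≤ ‖m‖ := by
    intro k hk
    have hle : ‖χ (k + 1)‖ ^ 2 ≤ ∑ k ∈ Finset.range q, ‖χ (k + 1)‖ ^ 2 :=
      Finset.single_le_sum (f := fun k => ‖χ (k + 1)‖ ^ 2)
        (fun _ _ => by positivity) (Finset.mem_range.2 hk)
    have := mul_le_mul_of_nonneg_left hle hz.le
    have h2 := (abs_le.1 (Complex.abs_im_le_norm m)).1
    linarith
  have hmle : ‖m‖ ≤ (z.im)⁻¹ := by
    have := hsum 0 hq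
    rw [zero_add, h1] at this
    rcases (norm_nonneg m).eq_or_lt with h | h
    · rw [← h]; positivity
    · rw [← one_div, le_div_iff₀ hz]
      nlinarith
  have hχq : ‖χ q‖ ≤ (z.im)⁻¹ := by
    have := hsum (q - 1) (by omega)
    rw [Nat.sub_add_cancel hq] at this
    refine abs_le_of_sq_le_sq' ?_ (by positivity) |>.2
    rw [inv_pow, ← one_div, le_div_iff₀ (by positivity)]
    have h3 : z.im * (z.im * ‖χ q‖ ^ 2) ≤ z.im * (z.im)⁻¹ :=
      mul_le_mul_of_nonneg_left (this.trans hmle) hz.le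
    rw [mul_inv_cancel₀ hz.ne'] at h3
    linarith
  have e : aeval z (discr v q) = sol v 0 1 z (q + 1) + -(m * sol v 0 1 z q) + χ q := by
    rw [aeval_discr, hχdef]
    ring
  rw [e]
  refine (norm_add₃_le).trans ?_
  rw [norm_neg, norm_mul]
  gcongr

/-- A square summable solution with `u_0 = -1` decays at least like the inverse of the solution
which vanishes at `0`. -/
theorem tail_mul_sol_le (v : ℕ → ℝ) {z : ℂ} (hz : 0 < z.im) {q : ℕ} (hq : 0 < q) {u : ℕ → ℂ}
    (hu : ∀ n, IsSol v z n u) (hu0 : u 0 = -1) (hs : Summable fun n => ‖u n‖ ^ 2) :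
    (∑' n, ‖u (q + 1 + n)‖ ^ 2) * (z.im * ‖sol v 0 1 z q‖) ^ 2 ≤ 1 := by
  set φ := sol v 0 1 z with hφ
  -- The current of u tends to 0 at infinity, so its value at q is minus the sum of all later
  -- increments.
  have hcur : current u q = -(z.im * ∑' n, ‖u (q + 1 + n)‖ ^ 2) := by
    have hS : Summable fun n => ‖u (q + 1 + n)‖ ^ 2 := by
      simpa [add_comm] using (summable_nat_add_iff (q + 1)).2 hs
    have hlim : Tendsto (fun n => current u (q + n)) atTop (𝓝 0) := by
      have hn : Tendsto (fun n => ‖u n‖) atTop (𝓝 0) := by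
        have := hs.tendsto_atTop_zero.sqrt
        simpa using this
      have h2 : Tendsto (fun n => ‖u n‖ * ‖u (n + 1)‖) atTop (𝓝 0) := by
        simpa using hn.mul ((tendsto_add_atTop_iff_nat 1).2 hn)
      have h3 : Tendsto (fun n => current u n) atTop (𝓝 0) := by
        refine squeeze_zero_norm (fun n => ?_) h2
        rw [current, Real.norm_eq_abs]
        refine (Complex.abs_im_le_norm _).trans ?_
        rw [norm_mul, Complex.norm_conj]
      simpa [add_comm] using (tendsto_add_atTop_iff_nat q).2 h3
    have heq : ∀ n, current u (q + n)
        = current u q + z.im * ∑ k ∈ Finset.range n, ‖u (q + 1 + k)‖ ^ 2 := by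
      intro n
      induction n with
      | zero => simp
      | succ n ih =>
        rw [← add_assoc, (hu (q + n + 1)).current_succ (Nat.lt_succ_self _), ih,
          Finset.sum_range_succ, show q + 1 + n = q + n + 1 by ring]
        ring
    have hlim2 : Tendsto (fun n => current u (q + n)) atTop
        (𝓝 (current u q + z.im * ∑' n, ‖u (q + 1 + n)‖ ^ 2)) := by
      simp only [heq]
      exact (hS.hasSum.tendsto_sum_nat.const_mul _).const_add _
    have := tendsto_nhds_unique hlim hlim2
    linarith
  set S := ∑' n, ‖u (q + 1 + n)‖ ^ 2 with hSdef
  have hS0 : 0 ≤ S := tsum_nonneg fun _ => by positivity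
  have hW : φ (q + 1) * u q - φ q * u (q + 1) = -1 := by
    rw [hφ, (isSol_sol v 0 1 z q).wronskian (hu q) le_rfl, hu0]
    simp [sol_zero, sol_one]
  have hφc : z.im * ‖φ q‖ ^ 2 ≤ current φ q := by
    have := norm_sq_mul_im_le_current_sol v hz (k := q - 1) (q := q) (by omega)
    rwa [Nat.sub_add_cancel hq] at this
  -- Multiply the Wronskian by conj (φ_q u_q) and take imaginary parts. The current of u at q is
  -- nonpositive, so both terms on the left are nonnegative and each is bounded separately.
  have hkey : current φ q * ‖u q‖ ^ 2 - ‖φ q‖ ^ 2 * current u q ≤ ‖φ q‖ * ‖u q‖ := by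
    have h1 : conj (φ q * u q) * (φ (q + 1) * u q - φ q * u (q + 1))
        = (conj (φ q) * φ (q + 1)) * (conj (u q) * u q)
          - (conj (φ q) * φ q) * (conj (u q) * u (q + 1)) := by
      rw [map_mul]; ring
    have h2 : ∀ w : ℂ, conj w * w = ((‖w‖ ^ 2 : ℝ) : ℂ) := by
      intro w
      rw [← Complex.normSq_eq_conj_mul_self, Complex.normSq_eq_norm_sq]
    rw [h2, h2, hW] at h1
    have h3 := congrArg Complex.im h1
    rw [Complex.sub_im, Complex.im_mul_ofReal, Complex.im_ofReal_mul] at h3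
    rw [current, current, ← h3, ← norm_mul]
    refine (Complex.im_le_norm _).trans ?_
    rw [norm_mul, Complex.norm_conj, norm_neg, norm_one, mul_one]
  rw [hcur] at hkey
  set f := ‖φ q‖ with hf
  set x := ‖u q‖ with hx
  have hf0 : 0 ≤ f := norm_nonneg _
  have hx0 : 0 ≤ x := norm_nonneg _
  set η := z.im with hη
  have h4 : η * f ^ 2 * x ^ 2 + f ^ 2 * (η * S) ≤ f * x := by
    nlinarith [mul_le_mul_of_nonneg_right hφc (sq_nonneg x)]
  have h5 : η * (f * x) ≤ 1 := by
    have : η * (f * x) * (f * x) ≤ 1 * (f * x) := by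
      have : 0 ≤ f ^ 2 * (η * S) := by positivity
      nlinarith
    rcases (mul_nonneg hf0 hx0).eq_or_lt with h | h
    · rw [← h]; simp
    · exact le_of_mul_le_mul_right this h
  have h6 : f ^ 2 * (η * S) ≤ f * x := by
    have : 0 ≤ η * f ^ 2 * x ^ 2 := by positivity
    linarith
  calc S * (η * f) ^ 2 = η * (f ^ 2 * (η * S)) := by ring
    _ ≤ η * (f * x) := by gcongr
    _ ≤ 1 := h5

/-- The tail of a square summable solution is controlled by the discriminant. -/
theorem tail_le (v : ℕ → ℝ) {z : ℂ} (hz : 0 < z.im) (hz1 : z.im ≤ 1) {q : ℕ} (hq : 0 < q)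
    {u : ℕ → ℂ} (hu : ∀ n, IsSol v z n u) (hu0 : u 0 = -1) (hs : Summable fun n => ‖u n‖ ^ 2)
    (hD : 2 ≤ z.im * ‖aeval z (discr v q)‖) :
    ∑' n, ‖u (q + 2 + n)‖ ^ 2 ≤ 16 / (z.im ^ 4 * ‖aeval z (discr v q)‖ ^ 2) := by
  set D := ‖aeval z (discr v q)‖ with hDdef
  set η := z.im with hη
  set S := ∑' n, ‖u (q + 2 + n)‖ ^ 2 with hS
  have hsum : ∀ k, Summable fun n => ‖u (k + n)‖ ^ 2 := fun k => by
    simpa [add_comm] using (summable_nat_add_iff k).2 hs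
  have hS0 : 0 ≤ S := tsum_nonneg fun _ => by positivity
  have hS1 : S ≤ ∑' n, ‖u (q + 1 + n)‖ ^ 2 := by
    rw [(hsum (q + 1)).tsum_eq_zero_add]
    have : (fun n => ‖u (q + 1 + (n + 1))‖ ^ 2) = fun n => ‖u (q + 2 + n)‖ ^ 2 := by
      funext n
      rw [show q + 1 + (n + 1) = q + 2 + n by ring]
    rw [this]
    exact le_add_of_nonneg_left (by positivity)
  have hle := norm_discr_le v hz hq
  have hη1 : 1 ≤ η⁻¹ := (one_le_inv₀ hz).2 hz1
  have hD0 : 0 < D := by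
    by_contra! h
    nlinarith
  -- φ is the larger of |φ_q| and |φ_{q+1}|; the tail starts at q + 2 to allow either choice. From
  -- ηD ≤ 2φ + 1 and 1 ≤ ηD/2 follows φ ≥ ηD/4.
  obtain ⟨φ, hφ, hSφ⟩ : ∃ φ : ℝ, η * D / 4 ≤ φ ∧ S * (η * φ) ^ 2 ≤ 1 := by
    have hinv : η * η⁻¹ = 1 := mul_inv_cancel₀ hz.ne'
    have h3 : η * D ≤ η * ‖sol v 0 1 z (q + 1)‖ + ‖sol v 0 1 z q‖ + 1 := by
      refine (mul_le_mul_of_nonneg_left hle hz.le).trans (le_of_eq ?_)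
      rw [← hη]
      linear_combination (‖sol v 0 1 z q‖ + 1) * hinv
    have h4 : η * ‖sol v 0 1 z (q + 1)‖ ≤ ‖sol v 0 1 z (q + 1)‖ :=
      mul_le_of_le_one_left (norm_nonneg _) hz1
    rcases le_total ‖sol v 0 1 z q‖ ‖sol v 0 1 z (q + 1)‖ with h | h
    · refine ⟨‖sol v 0 1 z (q + 1)‖, by linarith, ?_⟩
      exact tail_mul_sol_le v hz (Nat.succ_pos q) hu hu0 hs
    · refine ⟨‖sol v 0 1 z q‖, by linarith, ?_⟩
      refine le_trans ?_ (tail_mul_sol_le v hz hq hu hu0 hs)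
      gcongr
  rw [le_div_iff₀ (by positivity)]
  have : S * (η * (η * D / 4)) ^ 2 ≤ S * (η * φ) ^ 2 := by gcongr
  calc S * (η ^ 4 * D ^ 2) = 16 * (S * (η * (η * D / 4)) ^ 2) := by ring
    _ ≤ 16 * 1 := by gcongr; exact this.trans hSφ
    _ = 16 := by norm_num

end

end Schrodinger

namespace Schrodinger

section

open MeasureTheory FourierTransform SchwartzMap

/-! ### Plancherel's theorem for functions in `L¹ ∩ L²` -/

theorem lintegral_enorm_sq_coeFn (f : Lp (α := ℝ) ℂ 2 volume) : ∫⁻ x, ‖f x‖ₑ ^ 2 = ‖f‖ₑ ^ 2 := by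
  rw [Lp.enorm_def, eLpNorm_eq_lintegral_rpow_enorm_toReal two_ne_zero ENNReal.ofNat_ne_top]
  simp only [ENNReal.toReal_ofNat, ENNReal.rpow_ofNat, one_div]
  rw [← ENNReal.rpow_natCast, ← ENNReal.rpow_mul]
  simp

/-- Both transforms are tested against smooth compactly supported functions. In each case the
Fourier transform can be moved onto the test function, where it is the Schwartz one. -/
theorem fourier_toLp_ae_eq {f : ℝ → ℂ} (hf : Integrable f) (hf2 : MemLp f 2) :
    (𝓕 (hf2.toLp f : Lp (α := ℝ) ℂ 2 volume) : Lp (α := ℝ) ℂ 2 volume) =ᵐ[volume] 𝓕 f := by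
  set G : Lp (α := ℝ) ℂ 2 volume := 𝓕 (hf2.toLp f : Lp (α := ℝ) ℂ 2 volume) with hG
  have hcont : Continuous (𝓕 f) :=
    VectorFourier.fourierIntegral_continuous Real.continuous_fourierChar
      (by fun_prop) hf
  refine ae_eq_of_integral_contDiff_smul_eq ((Lp.memLp G).locallyIntegrable (by norm_num))
    hcont.locallyIntegrable fun g g_smooth g_cpt => ?_
  have hg₁ : HasCompactSupport (Complex.ofRealCLM ∘ g) := g_cpt.comp_left rfl
  have hg₂ : ContDiff ℝ ((⊤ : ℕ∞) : WithTop ℕ∞) (Complex.ofRealCLM ∘ g) := by fun_prop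
  set g' : 𝓢(ℝ, ℂ) := hg₁.toSchwartzMap hg₂ with hg'
  have hgg : ∀ x, g' x = (g x : ℂ) := fun x => rfl
  have h1 : ∫ x, g' x • G x = ∫ x, (𝓕 g') x • (hf2.toLp f : Lp (α := ℝ) ℂ 2 volume) x := by
    rw [← Lp.toTemperedDistribution_apply, ← Lp.toTemperedDistribution_apply, hG,
      ← Lp.fourier_toTemperedDistribution_eq]
    rfl
  have h2 : ∫ x, (𝓕 g') x • (hf2.toLp f : Lp (α := ℝ) ℂ 2 volume) x = ∫ x, (𝓕 g') x • f x := by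
    refine integral_congr_ae ?_
    filter_upwards [hf2.coeFn_toLp] with x hx
    rw [hx]
  have h3 : ∫ x, (𝓕 g') x • f x = ∫ x, g' x • 𝓕 f x := by
    rw [SchwartzMap.fourier_coe]
    simpa using! VectorFourier.integral_fourierIntegral_smul_eq_flip (L := innerₗ ℝ)
      (μ := volume) (ν := volume) Real.continuous_fourierChar (by fun_prop) g'.integrable hf
  have h4 := h1.trans (h2.trans h3)
  simpa only [hgg, Complex.coe_smul] using h4

theorem lintegral_enorm_sq_fourier {f : ℝ → ℂ} (hf : Integrable f) (hf2 : MemLp f 2) :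
    ∫⁻ ξ, ‖𝓕 f ξ‖ₑ ^ 2 = ∫⁻ x, ‖f x‖ₑ ^ 2 := by
  calc ∫⁻ ξ, ‖𝓕 f ξ‖ₑ ^ 2 = ∫⁻ ξ, ‖(𝓕 (hf2.toLp f : Lp (α := ℝ) ℂ 2 volume) : Lp (α := ℝ) ℂ 2 volume) ξ‖ₑ ^ 2 := by
        refine lintegral_congr_ae ?_
        filter_upwards [fourier_toLp_ae_eq hf hf2] with x hx
        rw [hx]
    _ = ∫⁻ x, ‖(hf2.toLp f : Lp (α := ℝ) ℂ 2 volume) x‖ₑ ^ 2 := by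
        rw [lintegral_enorm_sq_coeFn, lintegral_enorm_sq_coeFn, ← ofReal_norm, ← ofReal_norm,
          Lp.norm_fourier_eq]
    _ = ∫⁻ x, ‖f x‖ₑ ^ 2 := by
        refine lintegral_congr_ae ?_
        filter_upwards [hf2.coeFn_toLp] with x hx
        rw [hx]

/-! ### The resolvent as the Laplace transform of the evolution -/

theorem isSelfAdjoint_potential (V : ℕ+ → ℝ) (hV : ∃ M, ∀ n, |V n| ≤ M) :
    IsSelfAdjoint (potential V hV) := by
  rw [ContinuousLinearMap.isSelfAdjoint_iff_isSymmetric]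
  intro x y
  simp only [ContinuousLinearMap.coe_coe]
  rw [lp.inner_eq_tsum, lp.inner_eq_tsum]
  refine tsum_congr fun n => ?_
  have h : ∀ (w : HalfLine), (potential V hV w) n = (V n : ℂ) * w n := fun w => rfl
  rw [h, h]
  simp
  ring

theorem isSelfAdjoint_operator (V : ℕ+ → ℝ) (hV : ∃ M, ∀ n, |V n| ≤ M) :
    IsSelfAdjoint (operator V hV) :=
  (IsSelfAdjoint.add_star_self shift).add (isSelfAdjoint_potential V hV)

theorem evolution_mem_unitary (V : ℕ+ → ℝ) (hV : ∃ M, ∀ n, |V n| ≤ M) (t : ℝ) :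
    evolution V hV t ∈ unitary (HalfLine →L[ℂ] HalfLine) := by
  let := NormedAlgebra.restrictScalars ℚ ℂ (HalfLine →L[ℂ] HalfLine)
  refine NormedSpace.exp_mem_unitary_of_mem_skewAdjoint ?_
  exact (isSelfAdjoint_operator V hV).smul_mem_skewAdjoint (by
    rw [skewAdjoint.mem_iff]
    simp)

theorem norm_evolution_le (V : ℕ+ → ℝ) (hV : ∃ M, ∀ n, |V n| ≤ M) (t : ℝ) (ψ : HalfLine) :
    ‖evolution V hV t ψ‖ ≤ ‖ψ‖ := by
  have h : ‖evolution V hV t‖ ≤ 1 := by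
    rcases subsingleton_or_nontrivial (HalfLine →L[ℂ] HalfLine) with h | h
    · rw [Subsingleton.elim (evolution V hV t) 0, norm_zero]; exact zero_le_one
    · exact (CStarRing.norm_of_mem_unitary (evolution_mem_unitary V hV t)).le
  calc _ ≤ ‖evolution V hV t‖ * ‖ψ‖ := (evolution V hV t).le_opNorm ψ
    _ ≤ 1 * ‖ψ‖ := by gcongr
    _ = ‖ψ‖ := one_mul _

theorem norm_delta (n : ℕ+) : ‖delta n‖ = 1 := by
  rw [delta, lp.norm_single (by norm_num)]
  simp

theorem hasDerivAt_evolution (V : ℕ+ → ℝ) (hV : ∃ M, ∀ n, |V n| ≤ M) (ψ : HalfLine) (t : ℝ) :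
    HasDerivAt (fun t : ℝ => evolution V hV t ψ)
      ((-Complex.I) • operator V hV (evolution V hV t ψ)) t := by
  have h1 := hasDerivAt_exp_smul_const' (𝕂 := ℂ) (operator V hV) (-(Complex.I * (t : ℂ)))
  have h2 : HasDerivAt (fun t : ℝ => -(Complex.I * (t : ℂ))) (-Complex.I) t := by
    have := ((Complex.ofRealCLM.hasDerivAt (x := t)).const_mul Complex.I).neg
    rw [Complex.ofRealCLM_apply, Complex.ofReal_one, mul_one] at this
    exact this
  have h3 := h1.scomp t h2
  have h4 := ((ContinuousLinearMap.apply ℂ HalfLine ψ).restrictScalars ℝ).hasFDerivAt.comp_hasDerivAt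
    t h3
  exact h4

/-- The integrand `e^{izt} e^{-itH} δ_1`. -/
noncomputable def laplaceIntegrand (V : ℕ+ → ℝ) (hV : ∃ M, ∀ n, |V n| ≤ M) (z : ℂ) (t : ℝ) :
    HalfLine :=
  Complex.exp (Complex.I * z * t) • evolution V hV t (delta 1)

theorem hasDerivAt_laplaceIntegrand (V : ℕ+ → ℝ) (hV : ∃ M, ∀ n, |V n| ≤ M) (z : ℂ) (t : ℝ) :
    HasDerivAt (laplaceIntegrand V hV z)
      (Complex.I • (z • laplaceIntegrand V hV z t
        - operator V hV (laplaceIntegrand V hV z t))) t := by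
  have h1 : HasDerivAt (fun t : ℝ => Complex.exp (Complex.I * z * t))
      (Complex.exp (Complex.I * z * t) * (Complex.I * z)) t := by
    have h2 : HasDerivAt (fun t : ℝ => Complex.I * z * (t : ℂ)) (Complex.I * z) t := by
      simpa using (Complex.ofRealCLM.hasDerivAt (x := t)).const_mul (Complex.I * z)
    exact h2.cexp
  refine (h1.smul (hasDerivAt_evolution V hV (delta 1) t)).congr_deriv ?_
  simp only [laplaceIntegrand, map_smul, smul_sub, smul_smul]
  module

theorem norm_laplaceIntegrand_le (V : ℕ+ → ℝ) (hV : ∃ M, ∀ n, |V n| ≤ M) (z : ℂ) (t : ℝ) :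
    ‖laplaceIntegrand V hV z t‖ ≤ Real.exp (-z.im * t) := by
  rw [laplaceIntegrand, norm_smul, Complex.norm_exp]
  refine (mul_le_mul_of_nonneg_left (norm_evolution_le V hV t _) (Real.exp_nonneg _)).trans ?_
  rw [norm_delta, mul_one]
  simp

theorem continuous_laplaceIntegrand (V : ℕ+ → ℝ) (hV : ∃ M, ∀ n, |V n| ≤ M) (z : ℂ) :
    Continuous (laplaceIntegrand V hV z) :=
  continuous_iff_continuousAt.2 fun t => (hasDerivAt_laplaceIntegrand V hV z t).continuousAt

theorem integrableOn_laplaceIntegrand (V : ℕ+ → ℝ) (hV : ∃ M, ∀ n, |V n| ≤ M) {z : ℂ}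
    (hz : 0 < z.im) : IntegrableOn (laplaceIntegrand V hV z) (Ioi 0) :=
  (integrableOn_exp_mul_Ioi (neg_lt_zero.2 hz) 0).mono'
    (continuous_laplaceIntegrand V hV z).aestronglyMeasurable.restrict
    (ae_of_all _ fun t => norm_laplaceIntegrand_le V hV z t)

/-- The vector `(H - z)⁻¹ δ_1`, for `z` in the upper half plane. -/
noncomputable def resolventVec (V : ℕ+ → ℝ) (hV : ∃ M, ∀ n, |V n| ≤ M) (z : ℂ) : HalfLine :=
  Complex.I • ∫ t in Ioi (0 : ℝ), laplaceIntegrand V hV z t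

/-- The integrand f satisfies f' = i(z - H) f, f(0) = δ_1 and f → 0 at infinity. Integrating f' over
the half-line gives the resolvent equation. -/
theorem operator_resolventVec (V : ℕ+ → ℝ) (hV : ∃ M, ∀ n, |V n| ≤ M) {z : ℂ} (hz : 0 < z.im) :
    operator V hV (resolventVec V hV z) - z • resolventVec V hV z = delta 1 := by
  have hint := integrableOn_laplaceIntegrand V hV hz
  have hH := (operator V hV).integrable_comp hint
  have hlim : Tendsto (laplaceIntegrand V hV z) atTop (𝓝 0) := by
    refine squeeze_zero_norm (norm_laplaceIntegrand_le V hV z) ?_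
    refine Real.tendsto_exp_atBot.comp ?_
    exact tendsto_id.const_mul_atTop_of_neg (neg_lt_zero.2 hz)
  have key := integral_Ioi_of_hasDerivAt_of_tendsto'
    (fun t _ => hasDerivAt_laplaceIntegrand V hV z t)
    (((hint.smul z).sub hH).smul Complex.I) hlim
  have h0 : laplaceIntegrand V hV z 0 = delta 1 := by
    simp [laplaceIntegrand, evolution]
  have hsub : ∫ t in Ioi (0 : ℝ), (z • laplaceIntegrand V hV z t
      - operator V hV (laplaceIntegrand V hV z t))
      = z • (∫ t in Ioi (0 : ℝ), laplaceIntegrand V hV z t)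
        - operator V hV (∫ t in Ioi (0 : ℝ), laplaceIntegrand V hV z t) := by
    rw [← ContinuousLinearMap.integral_comp_comm _ hint, ← integral_smul]
    exact integral_sub (hint.smul z) hH
  rw [h0, integral_smul, hsub] at key
  rw [resolventVec, map_smul]
  have : delta 1 = -(0 - delta 1) := by simp
  rw [this, ← key]
  module

/-- The entries of `(H - z)⁻¹ δ_1` as a solution, with the value `-1` at the site `0`. -/
noncomputable def resolventSol (V : ℕ+ → ℝ) (hV : ∃ M, ∀ n, |V n| ≤ M) (z : ℂ) : ℕ → ℂ
  | 0 => -1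
  | n + 1 => resolventVec V hV z n.succPNat

/-- The source δ_1 acts at site 1 only, where the left neighbour is missing. The value -1 at site 0
absorbs it and makes the recursion homogeneous. -/
theorem isSol_resolventSol (V : ℕ+ → ℝ) (hV : ∃ M, ∀ n, |V n| ≤ M) {z : ℂ} (hz : 0 < z.im)
    (q : ℕ) : IsSol (pot V) z q (resolventSol V hV z) := by
  intro n _
  have h := congrArg (fun ψ : HalfLine => ψ n.succPNat) (operator_resolventVec V hV hz)
  simp only [lp.coeFn_sub, Pi.sub_apply, lp.coeFn_smul, Pi.smul_apply, smul_eq_mul,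
    operator_apply] at h
  have h2 : n.succPNat + 1 = (n + 1).succPNat := rfl
  rw [h2] at h
  simp only [resolventSol, pot]
  cases n with
  | zero =>
    have h1 : (delta 1 : HalfLine) (Nat.succPNat 0) = 1 := by
      rw [delta, lp.single_apply]; exact Pi.single_eq_same _ _
    rw [h1] at h
    have h3 : ¬ (1 < Nat.succPNat 0) := by decide
    rw [if_neg h3] at h
    linear_combination h
  | succ n =>
    have h1 : (delta 1 : HalfLine) (Nat.succPNat (n + 1)) = 0 := by
      rw [delta, lp.single_apply, Pi.single_eq_of_ne]
      intro h
      have := congrArg PNat.val h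
      simp at this
    rw [h1] at h
    have h3 : 1 < Nat.succPNat (n + 1) := by
      rw [← PNat.coe_lt_coe]; simp
    have h4 : Nat.succPNat (n + 1) - 1 = Nat.succPNat n := by
      rw [← PNat.coe_inj, PNat.sub_coe, if_pos h3]; simp
    rw [if_pos h3, h4] at h
    linear_combination h

theorem summable_resolventSol (V : ℕ+ → ℝ) (hV : ∃ M, ∀ n, |V n| ≤ M) (z : ℂ) :
    Summable fun n => ‖resolventSol V hV z n‖ ^ 2 := by
  rw [← summable_nat_add_iff 1]
  exact (summable_sq (resolventVec V hV z)).comp_injective Nat.succPNat_injective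

end

end Schrodinger

namespace Schrodinger

section

open MeasureTheory FourierTransform Polynomial

/-! ### The tail probability -/

/-- The `n`-th component of `e^{-ηt} e^{-itH} δ_1`, cut off to `t > 0`. -/
noncomputable def component (V : ℕ+ → ℝ) (hV : ∃ M, ∀ n, |V n| ≤ M) (η : ℝ) (n : ℕ+) : ℝ → ℂ :=
  (Ioi (0 : ℝ)).indicator fun t => inner ℂ (delta n) (laplaceIntegrand V hV (η * Complex.I) t)

theorem integrable_component (V : ℕ+ → ℝ) (hV : ∃ M, ∀ n, |V n| ≤ M) {η : ℝ} (hη : 0 < η)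
    (n : ℕ+) : Integrable (component V hV η n) := by
  rw [component, integrable_indicator_iff measurableSet_Ioi]
  exact (innerSL ℂ (delta n)).integrable_comp
    (integrableOn_laplaceIntegrand V hV (z := η * Complex.I) (by simpa using hη))

theorem norm_component_le (V : ℕ+ → ℝ) (hV : ∃ M, ∀ n, |V n| ≤ M) {η : ℝ} (hη : 0 < η)
    (n : ℕ+) (t : ℝ) : ‖component V hV η n t‖ ≤ 1 := by
  by_cases ht : t ∈ Ioi (0 : ℝ)
  · rw [component, indicator_of_mem ht]
    refine (norm_inner_le_norm _ _).trans ?_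
    rw [norm_delta, one_mul]
    refine (norm_laplaceIntegrand_le V hV _ t).trans ?_
    rw [Real.exp_le_one_iff]
    have : 0 < t := ht
    simp
    positivity
  · rw [component, indicator_of_notMem ht]
    simp

theorem memLp_component (V : ℕ+ → ℝ) (hV : ∃ M, ∀ n, |V n| ≤ M) {η : ℝ} (hη : 0 < η)
    (n : ℕ+) : MemLp (component V hV η n) 2 := by
  have hi := integrable_component V hV hη n
  rw [memLp_two_iff_integrable_sq_norm hi.aestronglyMeasurable]
  refine hi.norm.mono' (hi.norm.aestronglyMeasurable.pow 2) (ae_of_all _ fun t => ?_)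
  have h1 := norm_component_le V hV hη n t
  have h0 := norm_nonneg (component V hV η n t)
  rw [Real.norm_of_nonneg (by positivity)]
  nlinarith

/-- With the kernel exp(-2πitξ), the frequency ξ corresponds to the energy -2πξ, and the damping
exp(-ηt) supplies the imaginary part. -/
theorem enorm_fourier_component (V : ℕ+ → ℝ) (hV : ∃ M, ∀ n, |V n| ≤ M) {η : ℝ} (hη : 0 < η)
    (n : ℕ+) (ξ : ℝ) : ‖𝓕 (component V hV η n) ξ‖ₑ
      = ‖resolventVec V hV (((-2 * Real.pi * ξ : ℝ) : ℂ) + η * Complex.I) n‖ₑ := by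
  set z : ℂ := ((-2 * Real.pi * ξ : ℝ) : ℂ) + η * Complex.I with hz
  have hzim : 0 < z.im := by simpa [hz] using hη
  have h1 : 𝓕 (component V hV η n) ξ
      = ∫ t in Ioi (0 : ℝ), inner ℂ (delta n) (laplaceIntegrand V hV z t) := by
    rw [Real.fourier_eq', ← integral_indicator measurableSet_Ioi]
    refine integral_congr_ae (ae_of_all _ fun t => ?_)
    simp only [component]
    by_cases ht : t ∈ Ioi (0 : ℝ)
    · rw [indicator_of_mem ht, indicator_of_mem ht, laplaceIntegrand, laplaceIntegrand,
        inner_smul_right, inner_smul_right, smul_eq_mul, ← mul_assoc, ← Complex.exp_add]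
      congr 2
      rw [hz]
      simp
      ring
    · rw [indicator_of_notMem ht, indicator_of_notMem ht, smul_zero]
  have h2 : resolventVec V hV z n = Complex.I * 𝓕 (component V hV η n) ξ := by
    rw [h1, ← inner_delta, resolventVec, inner_smul_right]
    congr 1
    exact ((innerSL ℂ (delta n)).integral_comp_comm
      (integrableOn_laplaceIntegrand V hV hzim)).symm
  have hI : ‖Complex.I‖ₑ = 1 := by rw [← ofReal_norm, Complex.norm_I, ENNReal.ofReal_one]
  rw [h2, enorm_mul, hI, one_mul]

theorem lintegral_component (V : ℕ+ → ℝ) (hV : ∃ M, ∀ n, |V n| ≤ M) (T : ℝ)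
    (n : ℕ+) : ∫⁻ t in Ioi (0 : ℝ), ENNReal.ofReal
      (‖inner ℂ (delta n) (evolution V hV t (delta 1))‖ ^ 2 * Real.exp (-2 * t / T))
      = ∫⁻ t, ‖component V hV (1 / T) n t‖ₑ ^ 2 := by
  rw [← lintegral_indicator measurableSet_Ioi]
  refine lintegral_congr fun t => ?_
  by_cases ht : t ∈ Ioi (0 : ℝ)
  · rw [component, indicator_of_mem ht, indicator_of_mem ht, laplaceIntegrand, inner_smul_right,
      ← ofReal_norm, ← ENNReal.ofReal_pow (norm_nonneg _), norm_mul, mul_pow, mul_comm,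
      Complex.norm_exp, ← Real.exp_nat_mul]
    congr 3
    simp
    ring
  · rw [component, indicator_of_notMem ht, indicator_of_notMem ht]
    simp

/-- Plancherel is applied site by site, and the sum over sites is then taken inside the energy
integral. -/
theorem tailProb_eq_le (V : ℕ+ → ℝ) (hV : ∃ M, ∀ n, |V n| ≤ M) {T Q : ℝ} (hT : 0 < T)
    {q : ℕ} (hQ : (q : ℝ) + 1 ≤ Q) {F : ℝ → ℝ} (hF : ∀ E : ℝ,
      ∑' k, ‖resolventSol V hV (E + ((1 / T : ℝ) : ℂ) * Complex.I) (q + 2 + k)‖ ^ 2 ≤ F E) :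
    tailProb V hV Q T
      ≤ ENNReal.ofReal (2 / T) * ∫⁻ ξ, ENNReal.ofReal (F (-2 * Real.pi * ξ)) := by
  have hη : 0 < 1 / T := by positivity
  rw [tailProb, ENNReal.tsum_mul_left]
  gcongr
  have h1 : ∀ n : {n : ℕ+ // Q < (n : ℝ)}, ∫⁻ t in Ioi (0 : ℝ), ENNReal.ofReal
      (‖inner ℂ (delta n) (evolution V hV t (delta 1))‖ ^ 2 * Real.exp (-2 * t / T))
      = ∫⁻ ξ, ‖𝓕 (component V hV (1 / T) n) ξ‖ₑ ^ 2 := by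
    intro n
    rw [lintegral_component, lintegral_enorm_sq_fourier (integrable_component V hV hη n)
      (memLp_component V hV hη n)]
  rw [tsum_congr h1, ← lintegral_tsum]
  · refine lintegral_mono fun ξ => ?_
    simp only [enorm_fourier_component V hV hη]
    set z : ℂ := ((-2 * Real.pi * ξ : ℝ) : ℂ) + ((1 / T : ℝ) : ℂ) * Complex.I with hz
    have hFz := hF (-2 * Real.pi * ξ)
    rw [← hz] at hFz
    have hsum : Summable fun k => ‖resolventSol V hV z (q + 2 + k)‖ ^ 2 := by
      simpa [add_comm] using
        (summable_nat_add_iff (q + 2)).2 (summable_resolventSol V hV z)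
    refine le_trans ?_ (ENNReal.ofReal_le_ofReal hFz)
    rw [ENNReal.ofReal_tsum_of_nonneg (fun _ => by positivity) hsum]
    -- Sites n > Q ≥ q + 1 begin at q + 2, where the controlled tail of the resolvent begins.
    have hlt : ∀ n : {n : ℕ+ // Q < (n : ℝ)}, q + 2 ≤ ((n : ℕ+) : ℕ) := by
      intro n
      have h2 : (q : ℝ) + 1 < ((n : ℕ+) : ℕ) := hQ.trans_lt n.2
      have h3 : q + 1 < ((n : ℕ+) : ℕ) := by exact_mod_cast h2
      omega
    have hinj : Function.Injective fun n : {n : ℕ+ // Q < (n : ℝ)} => ((n : ℕ+) : ℕ) - (q + 2) := by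
      intro a b hab
      have ha := hlt a
      have hb := hlt b
      simp only at hab
      exact Subtype.ext (PNat.eq (by omega))
    refine le_trans (le_of_eq ?_) (ENNReal.tsum_comp_le_tsum_of_injective hinj _)
    refine tsum_congr fun n => ?_
    have h4 : q + 2 + (((n : ℕ+) : ℕ) - (q + 2)) = (n : ℕ+).natPred + 1 := by
      rw [PNat.natPred_add_one]
      have := hlt n
      omega
    rw [h4, resolventSol, PNat.succPNat_natPred,
      ENNReal.ofReal_pow (norm_nonneg _), ofReal_norm]
  · intro n
    have hcont : Continuous (𝓕 (component V hV (1 / T) n)) :=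
      VectorFourier.fourierIntegral_continuous Real.continuous_fourierChar
        (by fun_prop) (integrable_component V hV hη n)
    exact (hcont.enorm.measurable.pow_const 2).aemeasurable

/-- Each of the q ≥ 2 factors is at least |E| - K ≥ 1, so two of them already give quadratic growth.
This makes the integral over all energies converge. -/
theorem abs_discr_ge {v : ℕ → ℝ} {K : ℝ} (hK : 0 ≤ K) {q : ℕ} (hq : 2 ≤ q)
    (hroots : ∀ r, (discr v q).eval r = 0 → |r| ≤ K) {E : ℝ} (hE : K + 1 ≤ |E|) :
    (1 + E ^ 2) / (2 * (K + 1) ^ 2) ≤ |(discr v q).eval E| := by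
  have hp := isDiscriminant_discr v (by omega : 0 < q)
  have hcard : (discr v q).roots.toFinset.card = q := by
    rw [Multiset.toFinset_card_of_nodup hp.nodup_roots, ← hp.splits.natDegree_eq_card_roots,
      natDegree_discr v (by omega)]
  have h1 : (|E| - K) ^ q ≤ |(discr v q).eval E| := by
    rw [hp.abs_eval_eq]
    calc (|E| - K) ^ q = ∏ _r ∈ (discr v q).roots.toFinset, (|E| - K) := by
          rw [Finset.prod_const, hcard]
      _ ≤ _ := ?_
    refine Finset.prod_le_prod (fun _ _ => by linarith) fun r hr => ?_
    have := hroots r (hp.mem_rootsFinset.1 hr)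
    linarith [abs_sub_abs_le_abs_sub E r]
  have h2 : (|E| - K) ^ 2 ≤ (|E| - K) ^ q := pow_le_pow_right₀ (by linarith) hq
  refine le_trans ?_ (h2.trans h1)
  rw [div_le_iff₀ (by positivity)]
  have h3 : |E| ≤ (|E| - K) * (K + 1) := by nlinarith
  have h4 : |E| ^ 2 ≤ ((|E| - K) * (K + 1)) ^ 2 := by gcongr
  have h5 : 1 ≤ |E| ^ 2 := one_le_pow₀ (by linarith)
  rw [sq_abs] at h4 h5
  nlinarith

/-- If the discriminant is large above the whole real axis, the tail probability is small. -/
theorem tailProb_le (V : ℕ+ → ℝ) (hV : ∃ M, ∀ n, |V n| ≤ M) : ∃ C : ℝ, 0 < C ∧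
    ∀ (q : ℕ) (T Q B : ℝ), 2 ≤ q → 1 ≤ T → (q : ℝ) + 1 ≤ Q → 2 * T ≤ B →
      (∀ E : ℝ, B ≤ ‖aeval ((E : ℂ) + ((1 / T : ℝ) : ℂ) * Complex.I) (discr (pot V) q)‖) →
      tailProb V hV Q T ≤ ENNReal.ofReal (C * T ^ 3 / B) := by
  obtain ⟨M, hM⟩ := id hV
  have hM0 : 0 ≤ M := (abs_nonneg _).trans (hM 1)
  set K := M + 2 with hK
  refine ⟨64 * (K + 1) ^ 2 * Real.pi, by positivity, fun q T Q B hq hT hQ hB hD => ?_⟩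
  have hT0 : 0 < T := by linarith
  have hB0 : 0 < B := by linarith
  have hp := isDiscriminant_discr (pot V) (by omega : 0 < q)
  have hF : ∀ E : ℝ,
      ∑' k, ‖resolventSol V hV (E + ((1 / T : ℝ) : ℂ) * Complex.I) (q + 2 + k)‖ ^ 2
        ≤ 32 * (K + 1) ^ 2 * T ^ 4 / B * (1 + E ^ 2)⁻¹ := by
    intro E
    set z : ℂ := E + ((1 / T : ℝ) : ℂ) * Complex.I with hz
    have him : z.im = 1 / T := by simp [hz]
    have hzpos : 0 < z.im := by rw [him]; positivity
    have hz1 : z.im ≤ 1 := by rw [him, div_le_one hT0]; exact hT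
    have hDE := hD E
    set D := ‖aeval z (discr (pot V) q)‖ with hDdef
    have h2 : 2 ≤ z.im * D := by
      rw [him, div_mul_eq_mul_div, le_div_iff₀ hT0]
      linarith
    refine (tail_le (pot V) hzpos hz1 (by omega) (isSol_resolventSol V hV hzpos) rfl
      (summable_resolventSol V hV z) h2).trans ?_
    have hD1 : (1 + E ^ 2) / (2 * (K + 1) ^ 2) ≤ D := by
      rcases le_total (K + 1) |E| with h | h
      · exact (abs_discr_ge (by linarith) hq (fun r hr => abs_le_of_discr_eq_zero
          (fun n => hM _) (by omega) hr) h).trans (abs_eval_le_norm_aeval hp.splits hp.monic E _)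
      · refine le_trans ?_ (show (1 : ℝ) ≤ D by linarith)
        rw [div_le_one (by positivity)]
        have : E ^ 2 ≤ (K + 1) ^ 2 := by
          rw [← sq_abs]
          gcongr
        nlinarith
    -- One factor D is spent on the bound B, the other on decay in E.
    have hD2 : B * ((1 + E ^ 2) / (2 * (K + 1) ^ 2)) ≤ D ^ 2 := by
      rw [pow_two D]
      exact mul_le_mul hDE hD1 (by positivity) (hB0.le.trans hDE)
    calc 16 / (z.im ^ 4 * D ^ 2)
        ≤ 16 / (z.im ^ 4 * (B * ((1 + E ^ 2) / (2 * (K + 1) ^ 2)))) := by gcongr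
      _ = 32 * (K + 1) ^ 2 * T ^ 4 / B * (1 + E ^ 2)⁻¹ := by
          rw [him]
          field_simp
          ring
  refine (tailProb_eq_le V hV hT0 hQ hF).trans ?_
  set A := 32 * (K + 1) ^ 2 * T ^ 4 / B with hA
  have hA0 : 0 ≤ A := by positivity
  have hle : ∫⁻ ξ, ENNReal.ofReal (A * (1 + (-2 * Real.pi * ξ) ^ 2)⁻¹)
      ≤ ENNReal.ofReal (A * Real.pi) := by
    calc ∫⁻ ξ, ENNReal.ofReal (A * (1 + (-2 * Real.pi * ξ) ^ 2)⁻¹)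
        ≤ ∫⁻ ξ : ℝ, ENNReal.ofReal (A * (1 + ξ ^ 2)⁻¹) := by
          refine lintegral_mono fun ξ => ENNReal.ofReal_le_ofReal ?_
          have h1 : 1 ≤ (2 * Real.pi) ^ 2 := one_le_pow₀ (by linarith [Real.pi_gt_three])
          have h2 := mul_le_mul_of_nonneg_right h1 (sq_nonneg ξ)
          exact mul_le_mul_of_nonneg_left (inv_anti₀ (by positivity) (by linarith)) hA0
      _ = ENNReal.ofReal (∫ ξ : ℝ, A * (1 + ξ ^ 2)⁻¹) := by
          rw [ofReal_integral_eq_lintegral_ofReal (integrable_inv_one_add_sq.const_mul A)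
            (ae_of_all _ fun ξ => by positivity)]
      _ = ENNReal.ofReal (A * Real.pi) := by
          rw [integral_const_mul, integral_univ_inv_one_add_sq]
  refine (mul_le_mul_right hle _).trans (le_of_eq ?_)
  rw [← ENNReal.ofReal_mul (by positivity), hA]
  congr 1
  field_simp
  ring

end

end Schrodinger

namespace Schrodinger

/-! ### Counting points by means of nicely scaling covers -/

theorem mem_interval {I : NonemptyInterval ℝ} {x : ℝ} :
    x ∈ (I : Set ℝ) ↔ I.fst ≤ x ∧ x ≤ I.snd := Iff.rfl

/-- Of the intervals containing `x` two suffice to cover all others. -/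
theorem exists_two_cover [DecidableEq (NonemptyInterval ℝ)] (F : Finset (NonemptyInterval ℝ))
    (x : ℝ) : ∃ G ⊆ F, G.card ≤ 2 ∧
      ∀ J ∈ F, x ∈ (J : Set ℝ) → ∀ y ∈ (J : Set ℝ), ∃ I ∈ G, y ∈ (I : Set ℝ) := by
  classical
  by_cases h : (F.filter fun J : NonemptyInterval ℝ => x ∈ (J : Set ℝ)).Nonempty
  · obtain ⟨a, ha, hmin⟩ := Finset.exists_min_image _ (fun J : NonemptyInterval ℝ => J.fst) h
    obtain ⟨b, hb, hmax⟩ := Finset.exists_max_image _ (fun J : NonemptyInterval ℝ => J.snd) h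
    rw [Finset.mem_filter] at ha hb
    refine ⟨{a, b}, ?_, Finset.card_le_two, fun J hJ hx y hy => ?_⟩
    · intro J hJ
      rw [Finset.mem_insert, Finset.mem_singleton] at hJ
      rcases hJ with rfl | rfl
      exacts [ha.1, hb.1]
    · have hJ' : J ∈ F.filter fun J : NonemptyInterval ℝ => x ∈ (J : Set ℝ) :=
        Finset.mem_filter.2 ⟨hJ, hx⟩
      have h1 := hmin J hJ'
      have h2 := hmax J hJ'
      rw [mem_interval] at hy
      rcases le_total y x with hyx | hyx
      · exact ⟨a, by simp, mem_interval.2 ⟨h1.trans hy.1, hyx.trans (mem_interval.1 ha.2).2⟩⟩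
      · exact ⟨b, by simp, mem_interval.2 ⟨(mem_interval.1 hb.2).1.trans hyx, hy.2.trans h2⟩⟩
  · refine ⟨∅, by simp, by simp, fun J hJ hx => ?_⟩
    exact absurd ⟨J, Finset.mem_filter.2 ⟨hJ, hx⟩⟩ h

/-- The intervals of length at least `L` that meet `[x, x + k L]` are covered by `2 (k + 1)`
of them. -/
theorem exists_small_cover (F : Finset (NonemptyInterval ℝ)) {L : ℝ} (hL : 0 < L)
    (hF : ∀ J ∈ F, L ≤ J.length) (x : ℝ) (k : ℕ) : ∃ G ⊆ F, G.card ≤ 2 * (k + 1) ∧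
      ∀ J ∈ F, ∀ y ∈ (J : Set ℝ), x ≤ y → y ≤ x + k * L → ∃ I ∈ G, y ∈ (I : Set ℝ) := by
  classical
  choose g hgF hgcard hg using fun i : ℕ => exists_two_cover F (x + i * L)
  refine ⟨(Finset.range (k + 1)).biUnion g, Finset.biUnion_subset.2 fun i _ => hgF i, ?_, ?_⟩
  · refine (Finset.card_biUnion_le_card_mul _ _ 2 fun i _ => hgcard i).trans ?_
    rw [Finset.card_range, mul_comm]
  · intro J hJ y hy hxy hyk
    have hlen : L ≤ J.snd - J.fst := hF J hJ
    rw [mem_interval] at hy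
    obtain ⟨i, hi, hiJ⟩ : ∃ i : ℕ, i ≤ k ∧ x + i * L ∈ (J : Set ℝ) := by
      rcases le_total J.fst x with h | h
      · exact ⟨0, Nat.zero_le _, mem_interval.2 (by simpa using ⟨h, hxy.trans hy.2⟩)⟩
      -- The first grid point x + iL not to the left of `J.fst` lies in J, since J has length at
      -- least L.
      · have h0 : 0 ≤ (J.fst - x) / L := div_nonneg (by linarith) hL.le
        have h1 := Nat.le_ceil ((J.fst - x) / L)
        have h2 := Nat.ceil_lt_add_one h0
        rw [div_le_iff₀ hL] at h1
        have h3 : (⌈(J.fst - x) / L⌉₊ : ℝ) * L < J.fst - x + L := by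
          have := mul_lt_mul_of_pos_right h2 hL
          rwa [add_mul, div_mul_cancel₀ _ hL.ne', one_mul] at this
        refine ⟨⌈(J.fst - x) / L⌉₊, ?_, mem_interval.2 ⟨by linarith, by linarith⟩⟩
        rw [Nat.ceil_le, div_le_iff₀ hL]
        linarith [hy.1]
    obtain ⟨I, hI, hyI⟩ := hg i J hJ hiJ y (mem_interval.2 hy)
    exact ⟨I, Finset.mem_biUnion.2 ⟨i, Finset.mem_range.2 (by omega), hI⟩, hyI⟩

/-- Points in the window `[x, x + k L]`, counted by means of a fine cover `U` and a coarse
cover `W`. -/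
theorem card_window_le (Z : Finset ℝ) (U W : Finset (NonemptyInterval ℝ)) {L N₁ N₂ : ℝ}
    (hL : 0 < L) (hW : ∀ I ∈ W, L ≤ I.length)
    (hUW : ∀ J ∈ U, ∃ I ∈ W, (J : Set ℝ) ⊆ (I : Set ℝ))
    (hcard : ∀ I ∈ W, ({J : NonemptyInterval ℝ | J ∈ U ∧
      ((J : Set ℝ) ∩ (I : Set ℝ)).Nonempty}.ncard : ℝ) ≤ N₁)
    (hcover : ∀ r ∈ Z, ∃ J ∈ U, r ∈ (J : Set ℝ)) (hN₁ : 0 ≤ N₁) (hN₂ : 0 ≤ N₂)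
    (hmany : ∀ J ∈ U, (((Z : Set ℝ) ∩ (J : Set ℝ)).ncard : ℝ) ≤ N₂) (x : ℝ) (k : ℕ)
    (S : Finset ℝ) (hSZ : S ⊆ Z) (hS : ∀ r ∈ S, x ≤ r ∧ r ≤ x + k * L) :
    (S.card : ℝ) ≤ 2 * (k + 1) * (N₁ * N₂) := by
  classical
  obtain ⟨G, hGW, hG, hcov⟩ := exists_small_cover W hL hW x k
  have hsub : S ⊆ G.biUnion fun I =>
      (U.filter fun J : NonemptyInterval ℝ => ((J : Set ℝ) ∩ (I : Set ℝ)).Nonempty).biUnion fun J =>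
        Z.filter fun r => r ∈ (J : Set ℝ) := by
    intro r hr
    obtain ⟨J, hJ, hrJ⟩ := hcover r (hSZ hr)
    obtain ⟨I', hI', hJI'⟩ := hUW J hJ
    obtain ⟨I, hI, hrI⟩ := hcov I' hI' r (hJI' hrJ) (hS r hr).1 (hS r hr).2
    simp only [Finset.mem_biUnion, Finset.mem_filter]
    exact ⟨I, hI, J, ⟨hJ, r, hrJ, hrI⟩, hSZ hr, hrJ⟩
  have hZJ : ∀ J ∈ U, ((Z.filter fun r => r ∈ (J : Set ℝ)).card : ℝ) ≤ N₂ := by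
    intro J hJ
    refine le_trans (le_of_eq ?_) (hmany J hJ)
    rw [← Set.ncard_coe_finset, Finset.coe_filter]
    rfl
  have hI : ∀ I ∈ W, ((U.filter fun J : NonemptyInterval ℝ => ((J : Set ℝ) ∩ (I : Set ℝ)).Nonempty).card : ℝ)
      ≤ N₁ := by
    intro I hI
    refine le_trans (le_of_eq ?_) (hcard I hI)
    rw [← Set.ncard_coe_finset, Finset.coe_filter]
  calc (S.card : ℝ) ≤ ((G.biUnion fun I =>
      (U.filter fun J : NonemptyInterval ℝ => ((J : Set ℝ) ∩ (I : Set ℝ)).Nonempty).biUnion fun J =>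
        Z.filter fun r => r ∈ (J : Set ℝ)).card : ℝ) := by
        exact_mod_cast Finset.card_le_card hsub
    _ ≤ ∑ I ∈ G, ∑ J ∈ U.filter fun J : NonemptyInterval ℝ => ((J : Set ℝ) ∩ (I : Set ℝ)).Nonempty,
        ((Z.filter fun r => r ∈ (J : Set ℝ)).card : ℝ) := by
        exact_mod_cast Finset.card_biUnion_le.trans
          (Finset.sum_le_sum fun I _ => Finset.card_biUnion_le)
    _ ≤ ∑ I ∈ G, N₁ * N₂ := by
        refine Finset.sum_le_sum fun I hIG => ?_
        refine (Finset.sum_le_card_nsmul _ _ N₂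
          fun J hJ => hZJ J (Finset.mem_filter.1 hJ).1).trans ?_
        rw [nsmul_eq_mul]
        gcongr
        exact hI I (hGW hIG)
    _ = (G.card : ℝ) * (N₁ * N₂) := by rw [Finset.sum_const, nsmul_eq_mul]
    _ ≤ 2 * (k + 1) * (N₁ * N₂) := by
        gcongr
        exact_mod_cast hG

end Schrodinger

namespace Schrodinger

section

open Polynomial

/-! ### The lower bound for a discriminant with clustered roots -/

/-- The family `W` of covers scales nicely: the conditions on the lengths of the intervals, on
their nesting, and on the number of intervals met by an interval of a coarser cover. -/
structure IsNiceFamily (W : ℝ → Finset (NonemptyInterval ℝ)) (μ ω C C₃ : ℝ) : Prop where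
  length : ∀ e, 0 < e → e < 1 → ∀ I ∈ W e, C * e ^ μ ≤ I.length ∧ I.length ≤ e
  nested : ∀ e₁ e₂, 0 < e₂ → e₂ < e₁ → e₁ < 1 →
    ∀ J ∈ W e₂, ∃ I ∈ W e₁, (J : Set ℝ) ⊆ (I : Set ℝ)
  card_le : ∀ e₁ e₂, 0 < e₂ → e₂ < e₁ → e₁ < 1 → ∀ I ∈ W e₁,
    ({J : NonemptyInterval ℝ | J ∈ W e₂ ∧ ((J : Set ℝ) ∩ (I : Set ℝ)).Nonempty}.ncard : ℝ)
      ≤ C₃ * (e₁ / e₂) ^ ω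

/-- A window of length 2D is examined at the scale e with C e^μ = D. Boundedly many intervals of `W
e` cover its points, each meets at most C₃ (e/ε)^ω intervals of the fine cover, and e^ω is a
multiple of D^(ω/μ). For D beyond D₁, the value of C e^μ at e = 1/2, the scale 1/2 is used on all of
[-K, K]. -/
theorem exists_count_bound {μ ω C C₃ K : ℝ} (hμ : 1 ≤ μ) (hω : 0 < ω) (hC : 0 < C)
    (hC₃ : 0 < C₃) : ∃ C₅ : ℝ, 0 < C₅ ∧
    ∀ (W : ℝ → Finset (NonemptyInterval ℝ)) (Z : Finset ℝ) (ε N₂ : ℝ),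
      IsNiceFamily W μ ω C C₃ → 0 < ε → ε < 1 / 2 → 0 ≤ N₂ → (∀ r ∈ Z, |r| ≤ K) →
      (∀ r ∈ Z, ∃ J ∈ W ε, r ∈ (J : Set ℝ)) →
      (∀ J ∈ W ε, (((Z : Set ℝ) ∩ (J : Set ℝ)).ncard : ℝ) ≤ N₂) →
      ∀ a D, C * ε ^ μ < D →
        ((Z.filter fun r => |r - a| ≤ D).card : ℝ) ≤ C₅ * ε ^ (-ω) * N₂ * D ^ (ω / μ) := by
  have hμ0 : 0 < μ := by linarith
  set D₁ : ℝ := C * (1 / 2) ^ μ with hD₁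
  have hD₁0 : 0 < D₁ := by positivity
  set k : ℕ := ⌈2 * K / D₁⌉₊ with hk
  refine ⟨2 * (2 + 1) * (C₃ * (C⁻¹) ^ (ω / μ)) + 2 * (k + 1) * (C₃ * (D₁⁻¹) ^ (ω / μ)),
    by positivity, fun W Z ε N₂ hW hε hε2 hN₂ hK hcov hmany a D hD => ?_⟩
  have hD0 : 0 < D := lt_trans (by positivity) hD
  have key : ∀ {e : ℝ} (k : ℕ) (x : ℝ), ε < e → e < 1 →
      (∀ r ∈ Z.filter fun r => |r - a| ≤ D, x ≤ r ∧ r ≤ x + k * (C * e ^ μ)) →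
      ((Z.filter fun r => |r - a| ≤ D).card : ℝ) ≤ 2 * (k + 1) * (C₃ * (e / ε) ^ ω * N₂) := by
    intro e k x he he1 hwin
    have he0 : 0 < e := hε.trans he
    exact card_window_le Z (W ε) (W e) (L := C * e ^ μ) (by positivity)
      (fun I hI => (hW.length e he0 he1 I hI).1) (hW.nested e ε hε he he1)
      (hW.card_le e ε hε he he1) hcov (by positivity) hN₂ hmany x k _ (Finset.filter_subset _ _)
      hwin
  rcases le_total D D₁ with h | h
  · set e : ℝ := (D / C) ^ (1 / μ) with he
    have hDC : 0 < D / C := by positivity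
    have heμ : e ^ μ = D / C := by
      rw [he, ← Real.rpow_mul hDC.le, one_div_mul_cancel hμ0.ne', Real.rpow_one]
    have he0 : 0 < e := by positivity
    have hεe : ε < e := by
      rw [← Real.rpow_lt_rpow_iff hε.le he0.le hμ0, heμ, lt_div_iff₀ hC]
      linarith
    have he1 : e < 1 := by
      have : e ≤ 1 / 2 := by
        rw [← Real.rpow_le_rpow_iff he0.le (by norm_num) hμ0, heμ, div_le_iff₀ hC]
        linarith
      linarith
    have := key (e := e) 2 (a - D) hεe he1 fun r hr => by
      have h2 := abs_le.1 (Finset.mem_filter.1 hr).2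
      have h3 : C * e ^ μ = D := by rw [heμ]; field_simp
      rw [h3]
      constructor
      · linarith
      · push_cast; linarith
    have heω : e ^ ω = C⁻¹ ^ (ω / μ) * D ^ (ω / μ) := by
      rw [he, ← Real.rpow_mul hDC.le, ← Real.mul_rpow (by positivity) hD0.le]
      congr 1 <;> field_simp
    refine this.trans ?_
    rw [Real.div_rpow he0.le hε.le, heω, Real.rpow_neg hε.le]
    have h5 : 0 ≤ 2 * ((k : ℝ) + 1) * (C₃ * D₁⁻¹ ^ (ω / μ)) * (ε ^ ω)⁻¹ * N₂ * D ^ (ω / μ) := by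
      positivity
    push_cast
    rw [add_mul, add_mul, add_mul]
    refine le_trans (le_of_eq ?_) (le_add_of_nonneg_right h5)
    field_simp
  · have := key (e := 1 / 2) k (-K) hε2 (by norm_num) fun r hr => by
      have h2 := abs_le.1 (hK r (Finset.mem_filter.1 hr).1)
      have h3 := Nat.le_ceil (2 * K / D₁)
      rw [div_le_iff₀ hD₁0] at h3
      constructor
      · linarith
      · linarith
    refine this.trans ?_
    have h6 : (1 / 2 / ε) ^ ω ≤ ε ^ (-ω) * (D₁⁻¹ ^ (ω / μ) * D ^ (ω / μ)) := by
      have h7 : (1 : ℝ) ≤ D₁⁻¹ ^ (ω / μ) * D ^ (ω / μ) := by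
        rw [← Real.mul_rpow (by positivity) hD0.le]
        refine Real.one_le_rpow ?_ (by positivity)
        rw [← div_eq_inv_mul, le_div_iff₀ hD₁0]
        linarith
      calc (1 / 2 / ε) ^ ω ≤ (1 / ε) ^ ω := by
            gcongr
            norm_num
        _ = ε ^ (-ω) := by rw [one_div, Real.inv_rpow hε.le, Real.rpow_neg hε.le]
        _ ≤ _ := le_mul_of_one_le_right (by positivity) h7
    have h5 : 0 ≤ 2 * (2 + 1) * (C₃ * C⁻¹ ^ (ω / μ)) * ε ^ (-ω) * N₂ * D ^ (ω / μ) := by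
      positivity
    rw [add_mul, add_mul, add_mul]
    refine le_trans ?_ (le_add_of_nonneg_left h5)
    calc 2 * ((k : ℝ) + 1) * (C₃ * (1 / 2 / ε) ^ ω * N₂)
        ≤ 2 * ((k : ℝ) + 1) * (C₃ * (ε ^ (-ω) * (D₁⁻¹ ^ (ω / μ) * D ^ (ω / μ))) * N₂) := by
          gcongr
      _ = _ := by ring

theorem eventually_rpow_le {a c : ℝ} (ha : 0 < a) (hc : 0 < c) :
    ∀ᶠ ε : ℝ in 𝓝[>] 0, ε ^ a ≤ c := by
  have h : Tendsto (fun ε : ℝ => ε ^ a) (𝓝[>] 0) (𝓝 0) := by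
    have := (Real.continuousAt_rpow_const 0 a (Or.inr ha.le)).tendsto
    rw [Real.zero_rpow ha.ne'] at this
    exact this.mono_left nhdsWithin_le_nhds
  exact h.eventually (eventually_le_nhds hc)

/-- The lower bound away from the clusters. -/
theorem exp_le_abs_eval_of_far {p : ℝ[X]} (hp : IsDiscriminant p) {E ε s ω β κ X C₇ C₆ : ℝ}
    (hε : 0 < ε) (hε1 : ε < 1) (hs : 0 < s) (hX : 1 < X)
    (hclus : ∀ a, p.eval a = 0 → ∃ I : Finset ℝ,
      (∀ r ∈ I, p.eval r = 0 ∧ |a - r| ≤ ε) ∧ a ∈ I ∧ X ≤ I.card)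
    (hd : 4 * ε ^ (1 - s) ≤ ε ^ β) (hκ : κ < 1) (hβ : 1 - s - ω + β * (κ - 1) = 0)
    (hC₆ : 0 ≤ C₆)
    (hcount : ∀ a D, ε ^ β ≤ D →
      ((p.roots.toFinset.filter fun r => |r - a| ≤ D).card : ℝ) ≤ C₆ * ε ^ (-ω) * X * D ^ κ)
    (hC₇ : 4 * (2 / (1 - (2 : ℝ) ^ (κ - 1))) * C₆ ≤ C₇)
    (hlog : C₇ + 1 ≤ s * Real.log (1 / ε))
    (hfar : ∀ r, p.eval r = 0 → ε ^ β ≤ |E - r|) : Real.exp X ≤ |p.eval E| := by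
  set m := ⌈X⌉₊ with hm
  have hXm : X ≤ m := Nat.le_ceil X
  have hm2 : 2 ≤ m := by
    have : (1 : ℝ) < m := hX.trans_le hXm
    exact_mod_cast this
  set h := ε ^ (1 - s) with hh
  have hεh : ε ≤ h := by
    calc ε = ε ^ (1 : ℝ) := (Real.rpow_one ε).symm
      _ ≤ h := Real.rpow_le_rpow_of_exponent_ge hε hε1.le (by linarith)
  have hd0 : 0 < ε ^ β := by positivity
  have hfar' := hp.le_abs_eval_of_far hm2 hε hεh hd
    (fun a ha => by
      obtain ⟨I, h1, h2, h3⟩ := hclus a ha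
      exact ⟨I, h1, h2, Nat.ceil_le.2 h3⟩)
    (fun a _ => sum_one_div_le p.roots.toFinset (fun r => |r - a|) (by positivity) hκ hd0
      (hcount a)) hfar
  refine le_trans ?_ hfar'
  -- By `hβ` the powers of ε in the loss cancel, so its exponent is a constant multiple of X.
  have e1 : 4 * h * (2 / (1 - (2 : ℝ) ^ (κ - 1)) * (C₆ * ε ^ (-ω) * X * (ε ^ β) ^ (κ - 1)))
      = 4 * (2 / (1 - (2 : ℝ) ^ (κ - 1))) * C₆ * X := by
    have : h * ε ^ (-ω) * (ε ^ β) ^ (κ - 1) = 1 := by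
      rw [hh, ← Real.rpow_mul hε.le, ← Real.rpow_add hε, ← Real.rpow_add hε,
        ← sub_eq_add_neg, hβ, Real.rpow_zero]
    linear_combination 4 * (2 / (1 - (2 : ℝ) ^ (κ - 1))) * C₆ * X * this
  -- The gain (h/ε)^m = exp(m s log(1/ε)) carries a logarithm, which outweighs this constant.
  have e2 : h / ε = Real.exp (s * Real.log (1 / ε)) := by
    rw [hh, Real.rpow_sub hε, Real.rpow_one, mul_comm, ← Real.rpow_def_of_pos (by positivity),
      one_div, Real.inv_rpow hε.le]
    field_simp
  rw [e1, e2, ← Real.exp_nat_mul, ← Real.exp_add]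
  have h1 : X ≤ m * (s * Real.log (1 / ε)) + -(4 * (2 / (1 - (2 : ℝ) ^ (κ - 1))) * C₆ * X) := by
    have h2 : (m : ℝ) * (C₇ + 1) ≤ m * (s * Real.log (1 / ε)) := by gcongr
    have h3 : 4 * (2 / (1 - (2 : ℝ) ^ (κ - 1))) * C₆ * X ≤ C₇ * X := by gcongr
    have h5 : 0 ≤ C₇ := by
      refine le_trans ?_ hC₇
      have : (2 : ℝ) ^ (κ - 1) < 1 := Real.rpow_lt_one_of_one_lt_of_neg one_lt_two (by linarith)
      have : 0 < 1 - (2 : ℝ) ^ (κ - 1) := by linarith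
      positivity
    have h4 : X * (C₇ + 1) ≤ m * (C₇ + 1) := by gcongr
    linarith
  have := Real.exp_le_exp.2 h1
  have := Real.exp_pos X
  linarith

/-- The lower bound near the clusters. -/
theorem exp_le_norm_aeval_of_near {p : ℝ[X]} (hp : IsDiscriminant p) {E ε d X Y : ℝ}
    (hε : 0 < ε) (hεd : ε ≤ d) (hX : 4 ≤ X) (hY : 1 ≤ Y) (hXY : 64 * Y ≤ X * (ε / d) ^ 2)
    (hclus : ∀ a, p.eval a = 0 → ∃ I : Finset ℝ,
      (∀ r ∈ I, p.eval r = 0 ∧ |a - r| ≤ ε) ∧ a ∈ I ∧ X ≤ I.card)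
    {a : ℝ} (ha : p.eval a = 0) (hEa : |E - a| < d) :
    Real.exp Y ≤ ‖aeval ((E : ℂ) + ε * Complex.I) p‖ := by
  obtain ⟨I, hI, -, hcard⟩ := hclus a ha
  have hd : 0 < d := hε.trans_le hεd
  set N := (I.card - 1) / 2 with hN
  have h4 : 4 ≤ I.card := by exact_mod_cast hX.trans hcard
  have hnear := hp.le_norm_aeval_of_near (E := E) (η := ε) (R := 2 * d) (by positivity) I
    (fun x hx => ⟨(hI x hx).1, by
      have := (hI x hx).2
      calc |E - x| = |(E - a) + (a - x)| := by ring_nf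
        _ ≤ |E - a| + |a - x| := abs_add_le _ _
        _ ≤ 2 * d := by linarith⟩) (N := N) (by omega)
  refine le_trans ?_ hnear
  have hNX : X ≤ 4 * N := by
    have : (I.card : ℝ) ≤ 4 * N := by exact_mod_cast (by omega : I.card ≤ 4 * N)
    linarith
  set x := (ε / (2 * d)) ^ 2 with hx
  have hx0 : 0 ≤ x := by positivity
  have hx1 : x ≤ 1 := by
    refine pow_le_one₀ (by positivity) ?_
    rw [div_le_one (by positivity)]
    linarith
  have hxe : x = (ε / d) ^ 2 / 4 := by
    rw [hx]
    field_simp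
    norm_num
  -- This is exp(x/2) ≤ 1/(1 - x/2) ≤ 1 + x for 0 ≤ x ≤ 1.
  have hsqrt : Real.exp (x / 4) ≤ Real.sqrt (1 + x) := by
    refine Real.le_sqrt_of_sq_le ?_
    rw [← Real.exp_nat_mul]
    have h5 : Real.exp (-(x / 2)) ≥ 1 - x / 2 := by
      linarith [Real.add_one_le_exp (-(x / 2))]
    have h6 : Real.exp (x / 2) * Real.exp (-(x / 2)) = 1 := by rw [← Real.exp_add]; simp
    have h7 : 0 < Real.exp (x / 2) := Real.exp_pos _
    have h8 : Real.exp (((2 : ℕ) : ℝ) * (x / 4)) = Real.exp (x / 2) := by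
      congr 1; push_cast; ring
    rw [h8]
    have h9 : Real.exp (x / 2) * (1 - x / 2) ≤ 1 :=
      (mul_le_mul_of_nonneg_left h5 h7.le).trans h6.le
    nlinarith
  -- The 64 is 4 · 4 · 4: x is a quarter of (ε/d)², X ≤ 4N, and the square root yields exp(x/4).
  have h10 : Real.exp Y ≤ Real.sqrt (1 + x) ^ N := by
    calc Real.exp Y ≤ Real.exp (N * (x / 4)) := by
          rw [Real.exp_le_exp, hxe]
          have : X * (ε / d) ^ 2 ≤ 4 * N * (ε / d) ^ 2 := by gcongr
          linarith
      _ = Real.exp (x / 4) ^ N := by rw [Real.exp_nat_mul]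
      _ ≤ Real.sqrt (1 + x) ^ N := by gcongr
  have h11 : 2 ≤ Real.exp Y := by linarith [Real.add_one_le_exp Y]
  linarith

end

end Schrodinger

namespace Schrodinger

section

open Polynomial

/-! ### Uniform lower bounds on the scale of the clusters -/

/-- The threshold ε^β separates two regimes: away from the roots the bound is exp X, near them it is
exp of a multiple of X ε^(2(1-β)). As s tends to 0, 2(1-β) tends to 2ω(μ-1)/(μ-ω), the exponent in
the assumption on X. The smallness of ε does not depend on p, W or X, so the result applies along
the whole sequence. -/
theorem exists_scale_bound {μ ω ζ C C₃ C₄ K : ℝ} (hμ : 1 ≤ μ) (hω : 0 < ω) (hω1 : ω < 1)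
    (hζ : 0 < ζ) (hC : 0 < C) (hC₃ : 0 < C₃) (hC₄ : 0 < C₄) :
    ∀ᶠ ε : ℝ in 𝓝[>] 0, ∀ (p : ℝ[X]) (W : ℝ → Finset (NonemptyInterval ℝ)) (X : ℝ),
      IsDiscriminant p → IsNiceFamily W μ ω C C₃ → (∀ r, p.eval r = 0 → |r| ≤ K) →
      (∀ r, p.eval r = 0 → ∃ J ∈ W ε, r ∈ (J : Set ℝ)) →
      (∀ J ∈ W ε, X ≤ (((p.roots.toFinset : Set ℝ) ∩ (J : Set ℝ)).ncard : ℝ) ∧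
        (((p.roots.toFinset : Set ℝ) ∩ (J : Set ℝ)).ncard : ℝ) ≤ C₄ * X) →
      ε ^ (-(2 * ω * ((μ - 1) / (μ - ω)) + ζ)) ≤ X →
      ∀ E η : ℝ, ε ≤ η →
        Real.exp (ε ^ (-(ζ / 3))) ≤ ‖aeval ((E : ℂ) + η * Complex.I) p‖ := by
  obtain ⟨C₅, hC₅, hcount⟩ := exists_count_bound (K := K) hμ hω hC hC₃
  have hμω : 0 < μ - ω := by linarith
  have hμ0 : 0 < μ := by linarith
  -- The first entry keeps the contribution of s to 2(1-β) at most ζ/2.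
  set s : ℝ := min (ζ * (μ - ω) / (4 * μ)) ((1 - ω) / 2) with hs
  have hs0 : 0 < s := lt_min (by positivity) (by linarith)
  have hs1 : s * (4 * μ) ≤ ζ * (μ - ω) := by
    rw [← le_div_iff₀ (by positivity)]
    exact min_le_left _ _
  have hs2 : s ≤ (1 - ω) / 2 := min_le_right _ _
  set κ : ℝ := ω / μ with hκ
  have hκ1 : κ < 1 := by rw [hκ, div_lt_one hμ0]; linarith
  -- β is the solution of the balance `hβ0` between step length, root count and gap width.
  set β : ℝ := (1 - s - ω) * (μ / (μ - ω)) with hβ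
  have hβ0 : 1 - s - ω + β * (κ - 1) = 0 := by
    rw [hβ, hκ]
    field_simp
    ring
  have hβ1 : 1 - β = (ω * (μ - 1) + s * μ) / (μ - ω) := by
    rw [hβ]
    field_simp
    ring
  have hβs : β < 1 - s := by
    have : s < 1 - β := by
      rw [hβ1, lt_div_iff₀ hμω]
      nlinarith [mul_nonneg hω.le (by linarith : 0 ≤ μ - 1), mul_pos hs0 hω]
    linarith
  set τ : ℝ := 2 * ω * ((μ - 1) / (μ - ω)) with hτ
  have hτ0 : 0 ≤ τ := by
    have : 0 ≤ μ - 1 := by linarith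
    positivity
  have hβτ : 2 * (1 - β) ≤ τ + ζ / 2 := by
    rw [hβ1, hτ, ← sub_nonneg]
    have : 2 * ω * ((μ - 1) / (μ - ω)) + ζ / 2 - 2 * ((ω * (μ - 1) + s * μ) / (μ - ω))
        = (ζ * (μ - ω) - s * (4 * μ)) / (2 * (μ - ω)) := by
      field_simp
      ring
    rw [this]
    exact div_nonneg (by linarith) (by linarith)
  set C₇ : ℝ := 4 * (2 / (1 - (2 : ℝ) ^ (κ - 1))) * (C₅ * C₄) with hC₇
  have hlog : ∀ᶠ ε : ℝ in 𝓝[>] 0, C₇ + 1 ≤ s * Real.log (1 / ε) := by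
    have h1 : Tendsto (fun ε : ℝ => s * Real.log (1 / ε)) (𝓝[>] 0) atTop := by
      simp only [one_div]
      exact (Real.tendsto_log_atTop.comp tendsto_inv_nhdsGT_zero).const_mul_atTop hs0
    exact h1.eventually_ge_atTop _
  -- The four power conditions give, in order: ε < 1/2; C ε^μ < ε^β, the range where counting
  -- applies; 4 ε^(1-s) ≤ ε^β; and room for the factor 64 between ε^(-ζ/3) and ε^(-ζ/2).
  filter_upwards [self_mem_nhdsWithin, hlog,
    eventually_rpow_le one_pos (by norm_num : (0 : ℝ) < 1 / 3),
    eventually_rpow_le (a := μ - β) (c := 1 / (2 * C)) (by linarith) (by positivity),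
    eventually_rpow_le (a := 1 - s - β) (c := 1 / 4) (by linarith) (by norm_num),
    eventually_rpow_le (a := ζ / 6) (c := 1 / 64) (by positivity) (by norm_num)]
    with ε hε hlogε hε3 hεC hε4 hεζ
  rw [mem_Ioi] at hε
  rw [Real.rpow_one] at hε3
  have hε1 : ε < 1 := by linarith
  intro p W X hp hW hK hcov hmany hX E η hη
  have hβε : 0 < ε ^ β := by positivity
  have hmono : ∀ {a b : ℝ}, a ≤ b → ε ^ b ≤ ε ^ a := fun hab =>
    Real.rpow_le_rpow_of_exponent_ge hε hε1.le hab
  have h64 : 64 * ε ^ (-(ζ / 3)) ≤ ε ^ (-(ζ / 2)) := by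
    have : ε ^ (-(ζ / 3)) = ε ^ (-(ζ / 2)) * ε ^ (ζ / 6) := by
      rw [← Real.rpow_add hε]
      congr 1
      ring
    rw [this]
    have : 0 < ε ^ (-(ζ / 2)) := by positivity
    nlinarith
  have hY1 : 1 ≤ ε ^ (-(ζ / 3)) := by
    have := hmono (show -(ζ / 3) ≤ 0 by linarith)
    rwa [Real.rpow_zero] at this
  have hXζ : ε ^ (-(ζ / 2)) ≤ X := (hmono (by linarith)).trans hX
  have hX4 : 64 ≤ X := by linarith
  have hclus : ∀ a, p.eval a = 0 → ∃ I : Finset ℝ,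
      (∀ r ∈ I, p.eval r = 0 ∧ |a - r| ≤ ε) ∧ a ∈ I ∧ X ≤ I.card := by
    classical
    intro a ha
    obtain ⟨J, hJ, haJ⟩ := hcov a ha
    refine ⟨p.roots.toFinset.filter fun r => r ∈ (J : Set ℝ), fun r hr => ?_,
      Finset.mem_filter.2 ⟨hp.mem_rootsFinset.2 ha, haJ⟩, ?_⟩
    · obtain ⟨h1, h2⟩ := Finset.mem_filter.1 hr
      refine ⟨hp.mem_rootsFinset.1 h1, ?_⟩
      have hlen : J.snd - J.fst ≤ ε := (hW.length ε hε hε1 J hJ).2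
      rw [mem_interval] at haJ h2
      rw [abs_le]
      constructor <;> linarith [haJ.1, haJ.2, h2.1, h2.2]
    · refine (hmany J hJ).1.trans (le_of_eq ?_)
      rw [← Set.ncard_coe_finset, Finset.coe_filter]
      rfl
  refine le_trans ?_ (norm_aeval_mono hp.splits hp.monic E hε.le hη)
  by_cases hfar : ∀ r, p.eval r = 0 → ε ^ β ≤ |E - r|
  · refine le_trans ?_ (abs_eval_le_norm_aeval hp.splits hp.monic E ε)
    refine (Real.exp_le_exp.2 (by linarith)).trans
      (exp_le_abs_eval_of_far hp (s := s) (ω := ω) (β := β) (κ := κ) (X := X) (C₇ := C₇)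
        (C₆ := C₅ * C₄) hε hε1 hs0 (by linarith) hclus ?_ hκ1 hβ0 (by positivity) ?_ le_rfl
        hlogε hfar)
    · have : ε ^ (1 - s) = ε ^ β * ε ^ (1 - s - β) := by
        rw [← Real.rpow_add hε]
        congr 1
        ring
      rw [this]
      nlinarith
    · intro a D hD
      have h1 := hcount W p.roots.toFinset ε (C₄ * X) hW hε (by linarith) (by positivity)
        (fun r hr => hK r (hp.mem_rootsFinset.1 hr))
        (fun r hr => hcov r (hp.mem_rootsFinset.1 hr)) (fun J hJ => (hmany J hJ).2) a D ?_
      · refine h1.trans (le_of_eq ?_)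
        ring
      · refine lt_of_lt_of_le ?_ hD
        have : ε ^ μ = ε ^ β * ε ^ (μ - β) := by
          rw [← Real.rpow_add hε]
          congr 1
          ring
        rw [this]
        calc C * (ε ^ β * ε ^ (μ - β)) ≤ C * (ε ^ β * (1 / (2 * C))) := by gcongr
          _ = ε ^ β / 2 := by field_simp
          _ < ε ^ β := by linarith
  · push Not at hfar
    obtain ⟨a, ha, hEa⟩ := hfar
    have hεβ : ε ≤ ε ^ β := by
      have := hmono (show β ≤ 1 by linarith)
      rwa [Real.rpow_one] at this
    refine exp_le_norm_aeval_of_near hp hε hεβ (by linarith) hY1 ?_ hclus ha hEa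
    have h1 : (ε / ε ^ β) ^ 2 = ε ^ (2 * (1 - β)) := by
      have h2 : ε / ε ^ β = ε ^ (1 - β) := by rw [Real.rpow_sub hε, Real.rpow_one]
      rw [h2, ← Real.rpow_natCast, ← Real.rpow_mul hε.le]
      congr 1
      push_cast
      ring
    rw [h1]
    refine h64.trans ?_
    calc ε ^ (-(ζ / 2)) ≤ ε ^ (-(τ + ζ) + 2 * (1 - β)) := hmono (by linarith)
      _ = ε ^ (-(τ + ζ)) * ε ^ (2 * (1 - β)) := Real.rpow_add hε _ _
      _ ≤ X * ε ^ (2 * (1 - β)) := by gcongr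

end

end Schrodinger

namespace Schrodinger

section

open Polynomial

/-! ### The transport exponents -/

theorem eigenvalueSet_eq (V : ℕ+ → ℝ) {q : ℕ} (hq : 0 < q) :
    eigenvalueSet V q = ((discr (pot V) q).roots.toFinset : Set ℝ) := by
  ext E
  rw [mem_eigenvalueSet_iff V hq, Finset.mem_coe,
    (isDiscriminant_discr (pot V) hq).mem_rootsFinset]

theorem scale_pos {q : ℕ → ℕ} (hq : ∀ ℓ, 1 < q ℓ) (α : ℕ → ℝ) (ℓ : ℕ) : 0 < scale q α ℓ := by
  have : (0 : ℝ) < q ℓ := by exact_mod_cast (hq ℓ).trans' zero_lt_one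
  exact Real.rpow_pos_of_pos this _

theorem one_div_scale_rpow {q : ℕ → ℕ} {α : ℕ → ℝ} {ℓ : ℕ} (x : ℝ) :
    (1 / scale q α ℓ) ^ x = (q ℓ : ℝ) ^ (x / α ℓ) := by
  have h0 : (0 : ℝ) ≤ q ℓ := Nat.cast_nonneg _
  rw [scale, one_div, Real.rpow_neg h0, inv_inv, ← Real.rpow_mul h0]
  congr 1
  ring

theorem le_one_div_scale {q : ℕ → ℕ} (hq : ∀ ℓ, 1 < q ℓ) {α : ℕ → ℝ} {ℓ : ℕ} (hα : 0 < α ℓ)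
    (hα1 : α ℓ < 1) : (q ℓ : ℝ) ≤ 1 / scale q α ℓ := by
  have h1 : (1 : ℝ) ≤ q ℓ := by exact_mod_cast (hq ℓ).le
  calc (q ℓ : ℝ) = (q ℓ : ℝ) ^ (1 : ℝ) := (Real.rpow_one _).symm
    _ ≤ (q ℓ : ℝ) ^ (1 / α ℓ) :=
        Real.rpow_le_rpow_of_exponent_le h1 ((one_le_div hα).2 hα1.le)
    _ = 1 / scale q α ℓ := by rw [← one_div_scale_rpow, Real.rpow_one]

theorem tendsto_one_div_scale {q : ℕ → ℕ} (hq : ∀ ℓ, 1 < q ℓ) (hq_top : Tendsto q atTop atTop)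
    {α : ℕ → ℝ} (hα : ∀ ℓ, 0 < α ℓ) (hα1 : ∀ ℓ, α ℓ < 1) :
    Tendsto (fun ℓ => 1 / scale q α ℓ) atTop atTop :=
  tendsto_atTop_mono (fun ℓ => le_one_div_scale hq (hα ℓ) (hα1 ℓ))
    (tendsto_natCast_atTop_atTop.comp hq_top)

/-- A difference of exponents of order 1/log q amounts to a constant factor in the count, so all
clusters are comparable in size. -/
theorem ncard_le_of_upperExponent {V : ℕ+ → ℝ} {q : ℕ} (hq : 1 < q) {ξ C₂ : ℝ}
    {U : Finset (NonemptyInterval ℝ)} (h : upperExponent V q U - ξ ≤ C₂ / Real.log q)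
    {J : NonemptyInterval ℝ} (hJ : J ∈ U) :
    ((eigenvalueSet V q ∩ (J : Set ℝ)).ncard : ℝ) ≤ Real.exp C₂ * (q : ℝ) ^ ξ := by
  have hq0 : (1 : ℝ) < q := by exact_mod_cast hq
  have hlog : 0 < Real.log q := Real.log_pos hq0
  set N := U.sup fun I => (eigenvalueSet V q ∩ (I : Set ℝ)).ncard with hN
  have hle : (eigenvalueSet V q ∩ (J : Set ℝ)).ncard ≤ N :=
    Finset.le_sup (f := fun I : NonemptyInterval ℝ => (eigenvalueSet V q ∩ (I : Set ℝ)).ncard) hJ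
  have hle' : ((eigenvalueSet V q ∩ (J : Set ℝ)).ncard : ℝ) ≤ N := by exact_mod_cast hle
  refine hle'.trans ?_
  rcases Nat.eq_zero_or_pos N with h0 | h0
  · rw [h0, Nat.cast_zero]
    positivity
  · have hN0 : (0 : ℝ) < N := by exact_mod_cast h0
    have h1 : Real.log N ≤ C₂ + Real.log q * ξ := by
      have h2 : Real.log N / Real.log q - ξ ≤ C₂ / Real.log q := h
      rw [sub_le_iff_le_add, div_le_iff₀ hlog, add_mul, div_mul_cancel₀ _ hlog.ne'] at h2
      linarith
    rw [Real.rpow_def_of_pos (by linarith), ← Real.exp_add, ← Real.exp_log hN0]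
    exact Real.exp_le_exp.2 h1

/-- Here X = q_ℓ^ξ_ℓ. As 1/ε_ℓ = q_ℓ^(1/α_ℓ), the lower bound required of X is the assumption on ξ_ℓ
α_ℓ. -/
theorem eventually_exp_le_discr {V : ℕ+ → ℝ} (hV : ∃ M, ∀ n, |V n| ≤ M)
    {q : ℕ → ℕ} (hq : ∀ ℓ, 1 < q ℓ) (hq_top : Tendsto q atTop atTop)
    {U : ℕ → Finset (NonemptyInterval ℝ)} {α ξ : ℕ → ℝ} {μ ω ζ : ℝ}
    (hclust : UniformlyClustered V q U α ξ μ) (hscale : ScalesNicely U (scale q α) μ ω)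
    (hζ : 0 < ζ) (hexp : ∀ ℓ, 2 * ω * ((μ - 1) / (μ - ω)) + ζ < ξ ℓ * α ℓ) :
    ∀ᶠ ℓ in atTop, ∀ E η : ℝ, scale q α ℓ ≤ η → Real.exp (scale q α ℓ ^ (-(ζ / 3)))
      ≤ ‖aeval ((E : ℂ) + η * Complex.I) (discr (pot V) (q ℓ))‖ := by
  obtain ⟨M, hM⟩ := hV
  obtain ⟨δ, hδ, hδα⟩ := hclust.exponents
  obtain ⟨C₂, hC₂⟩ := hclust.upper
  obtain ⟨-, hμ, hω, hω1, C, hC, -, W, hWU, hlen, hnest, C₃, hC₃, hcard⟩ := hscale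
  have hα : ∀ ℓ, 0 < α ℓ := fun ℓ => hδ.trans (hδα ℓ).2.2.1
  have hlim : Tendsto (scale q α) atTop (𝓝[>] 0) := by
    have := tendsto_inv_atTop_nhdsGT_zero.comp
      (tendsto_one_div_scale hq hq_top hα fun ℓ => (hδα ℓ).2.2.2)
    refine this.congr fun ℓ => ?_
    simp
  have hmain := hlim.eventually (exists_scale_bound (K := M + 2) hμ hω hω1 hζ hC hC₃
    (Real.exp_pos C₂))
  filter_upwards [hmain] with ℓ hℓ
  have hqpos : 0 < q ℓ := (hq ℓ).trans' zero_lt_one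
  have hset := eigenvalueSet_eq V hqpos
  have hp := isDiscriminant_discr (pot V) hqpos
  refine hℓ (discr (pot V) (q ℓ)) W ((q ℓ : ℝ) ^ ξ ℓ) hp ⟨hlen, hnest, hcard⟩
    (fun r hr => abs_le_of_discr_eq_zero (fun n => hM _) hqpos hr) (fun r hr => ?_)
    (fun J hJ => ?_) ?_
  · have hr' : r ∈ eigenvalueSet V (q ℓ) := (mem_eigenvalueSet_iff V hqpos r).2 hr
    have := (hclust.clustered ℓ).cover hr'
    rw [hWU]
    simpa using this
  · rw [hWU] at hJ
    rw [← hset]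
    exact ⟨(hclust.clustered ℓ).many J hJ, ncard_le_of_upperExponent (hq ℓ) (hC₂ ℓ) hJ⟩
  · rw [Real.rpow_neg (scale_pos hq α ℓ).le, ← Real.inv_rpow (scale_pos hq α ℓ).le, ← one_div,
      one_div_scale_rpow]
    refine Real.rpow_le_rpow_of_exponent_le (by exact_mod_cast (hq ℓ).le) ?_
    rw [div_le_iff₀ (hα ℓ)]
    exact (hexp ℓ).le

/-- The discriminant is large at every height η ≥ ε_ℓ, so one ℓ serves all T up to 1/ε_ℓ. Replacing
ε_ℓ^(-ζ/3) by the smaller T^(ζ/3) removes ℓ from the bound. -/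
theorem exists_tailProb_bound {V : ℕ+ → ℝ} (hV : ∃ M, ∀ n, |V n| ≤ M)
    {q : ℕ → ℕ} (hq : ∀ ℓ, 1 < q ℓ) (hq_top : Tendsto q atTop atTop)
    {U : ℕ → Finset (NonemptyInterval ℝ)} {α ξ : ℕ → ℝ} {μ ω ζ : ℝ}
    (hclust : UniformlyClustered V q U α ξ μ) (hscale : ScalesNicely U (scale q α) μ ω)
    (hζ : 0 < ζ) (hexp : ∀ ℓ, 2 * ω * ((μ - 1) / (μ - ω)) + ζ < ξ ℓ * α ℓ) :
    ∃ C : ℝ, 0 < C ∧ ∀ᶠ ℓ in atTop, ∀ T Q : ℝ, 1 ≤ T → T ≤ 1 / scale q α ℓ →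
      (q ℓ : ℝ) + 1 ≤ Q →
      tailProb V hV Q T ≤ ENNReal.ofReal (C * T ^ 3 * Real.exp (-T ^ (ζ / 3))) := by
  obtain ⟨C, hC, htail⟩ := tailProb_le V hV
  obtain ⟨δ, hδ, hδα⟩ := hclust.exponents
  have hα : ∀ ℓ, 0 < α ℓ := fun ℓ => hδ.trans (hδα ℓ).2.2.1
  refine ⟨C, hC, ?_⟩
  -- At y = 1/ε_ℓ this supplies the condition 2T ≤ B of `tailProb_le`.
  have hlarge : ∀ᶠ y : ℝ in atTop, 2 * y ≤ Real.exp (y ^ (ζ / 3)) := by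
    have hc : 0 < ζ / 3 := by positivity
    have h1 := (tendsto_rpow_mul_exp_neg_mul_atTop_nhds_zero (1 / (ζ / 3)) 1 one_pos).comp
      (tendsto_rpow_atTop hc)
    filter_upwards [h1.eventually (eventually_le_nhds (show (0 : ℝ) < 1 / 2 by norm_num)),
      eventually_gt_atTop 0] with y hy hy0
    rw [Function.comp_apply, ← Real.rpow_mul hy0.le, mul_one_div_cancel hc.ne', Real.rpow_one,
      neg_one_mul, Real.exp_neg, ← div_eq_mul_inv, div_le_iff₀ (Real.exp_pos _)] at hy
    linarith
  filter_upwards [eventually_exp_le_discr hV hq hq_top hclust hscale hζ hexp,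
    (tendsto_one_div_scale hq hq_top hα fun ℓ => (hδα ℓ).2.2.2).eventually hlarge]
    with ℓ hℓ hℓ2 T Q hT hTs hQ
  have hs := scale_pos hq α ℓ
  have hT0 : 0 < T := by linarith
  have hsT : scale q α ℓ ≤ 1 / T := by
    rw [le_div_iff₀ hT0]
    rw [le_div_iff₀ hs] at hTs
    linarith
  have hpow : (1 / scale q α ℓ) ^ (ζ / 3) = scale q α ℓ ^ (-(ζ / 3)) := by
    rw [one_div, Real.inv_rpow hs.le, Real.rpow_neg hs.le]
  rw [hpow] at hℓ2
  refine (htail (q ℓ) T Q _ (hq ℓ) hT hQ (by linarith) fun E => hℓ E (1 / T) hsT).trans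
    (ENNReal.ofReal_le_ofReal ?_)
  rw [div_eq_mul_inv, ← Real.exp_neg]
  have : T ^ (ζ / 3) ≤ scale q α ℓ ^ (-(ζ / 3)) := by
    rw [← hpow]
    gcongr
  gcongr

/-- A superpolynomially small tail probability has an arbitrarily negative rate. -/
theorem eventually_rate_le {C c : ℝ} (hC : 0 < C) (hc : 0 < c) (R : ℝ) :
    ∀ᶠ T : ℝ in atTop, ∀ P : ℝ≥0∞, P ≤ ENNReal.ofReal (C * T ^ 3 * Real.exp (-T ^ c)) →
      ENNReal.log P / (Real.log T : EReal) ≤ (R : EReal) := by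
  have h1 := (tendsto_rpow_mul_exp_neg_mul_atTop_nhds_zero ((3 - R) / c) 1 one_pos).comp
    (tendsto_rpow_atTop hc)
  filter_upwards [h1.eventually (eventually_le_nhds (show (0 : ℝ) < 1 / C by positivity)),
    eventually_gt_atTop 1] with T hT hT1 P hP
  have hT0 : 0 < T := by linarith
  have hlog : 0 < Real.log T := Real.log_pos hT1
  rw [Function.comp_apply, ← Real.rpow_mul hT0.le, mul_div_cancel₀ _ hc.ne', neg_one_mul,
    Real.rpow_sub hT0, le_div_iff₀ hC, div_mul_eq_mul_div, div_mul_eq_mul_div,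
    div_le_one (by positivity)] at hT
  have h2 : P ≤ ENNReal.ofReal (Real.exp (R * Real.log T)) := by
    refine hP.trans (ENNReal.ofReal_le_ofReal ?_)
    rw [mul_comm R, ← Real.rpow_def_of_pos hT0]
    have h3 : T ^ (3 : ℝ) = T ^ 3 := by exact_mod_cast Real.rpow_natCast T 3
    rw [h3] at hT
    linarith
  rw [EReal.div_le_iff_le_mul (by exact_mod_cast hlog) (EReal.coe_ne_top _)]
  refine (ENNReal.log_le_log h2).trans (le_of_eq ?_)
  rw [ENNReal.log_ofReal_of_pos (Real.exp_pos _), Real.log_exp]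
  rw [EReal.coe_mul, mul_comm]

/-! ### From superpolynomial decay to the two exponents -/

theorem eq_bot_of_forall_le {x : EReal} (h : ∀ R : ℝ, x ≤ R) : x = ⊥ := by
  refine (EReal.eq_bot_iff_forall_lt x).2 fun y => (h (y - 1)).trans_lt ?_
  exact_mod_cast sub_one_lt y

theorem eventually_add_one_le_rpow {b : ℝ} (hb : 1 < b) (A : ℝ) :
    ∀ᶠ x : ℝ in atTop, A * x + 1 ≤ x ^ b := by
  have h1 : Tendsto (fun x : ℝ => x ^ (b - 1)) atTop atTop := tendsto_rpow_atTop (by linarith)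
  filter_upwards [h1.eventually_ge_atTop (A + 1), eventually_ge_atTop 1] with x hx hx1
  have hx0 : 0 < x := by linarith
  have : x ^ b = x * x ^ (b - 1) := by
    rw [Real.rpow_sub_one hx0.ne']
    field_simp
  rw [this]
  nlinarith

/-- The lower limit is tested along T = 1/ε_ℓ for the infinitely many ℓ with α_ℓ < b < a. There T^a
= q_ℓ^(a/α_ℓ), which is at least q_ℓ + 1 for large ℓ. -/
theorem alphaUMinus_le {V : ℕ+ → ℝ} {hV : ∃ M, ∀ n, |V n| ≤ M}
    {q : ℕ → ℕ} (hq : ∀ ℓ, 1 < q ℓ) (hq_top : Tendsto q atTop atTop) {α : ℕ → ℝ} {C c : ℝ}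
    (hα : ∀ ℓ, 0 < α ℓ) (hα1 : ∀ ℓ, α ℓ < 1) (hC : 0 < C) (hc : 0 < c)
    (htail : ∀ᶠ ℓ in atTop, ∀ T Q : ℝ, 1 ≤ T → T ≤ 1 / scale q α ℓ → (q ℓ : ℝ) + 1 ≤ Q →
      tailProb V hV Q T ≤ ENNReal.ofReal (C * T ^ 3 * Real.exp (-T ^ c))) :
    alphaUMinus V hV ≤ liminf (fun ℓ => ENNReal.ofReal (α ℓ)) atTop := by
  refine iSup₂_le fun a ⟨ha, hbot⟩ => ?_
  by_contra! hlt
  obtain ⟨b, hb1, hb2⟩ := exists_between hlt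
  have hb3 : b.toReal < a := by
    rw [← ENNReal.toReal_ofReal ha.le]
    exact ENNReal.toReal_strict_mono ENNReal.ofReal_ne_top hb2
  have hfreq : ∃ᶠ ℓ in atTop, α ℓ < b.toReal := by
    refine (frequently_lt_of_liminf_lt (by isBoundedDefault) hb1).mono fun ℓ hℓ => ?_
    exact (ENNReal.ofReal_lt_iff_lt_toReal (hα ℓ).le (ne_top_of_lt hb2)).1 hℓ
  have hb0 : 0 < b.toReal := by
    obtain ⟨ℓ, hℓ⟩ := hfreq.exists
    exact (hα ℓ).trans hℓ
  have hT := tendsto_one_div_scale hq hq_top hα hα1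
  refine hbot.ne' (eq_bot_of_forall_le fun R => ?_)
  refine liminf_le_of_frequently_le (hT.frequently ?_)
  have hq1 := (tendsto_natCast_atTop_atTop.comp hq_top).eventually
    (eventually_add_one_le_rpow ((one_lt_div hb0).2 hb3) 1)
  refine (hfreq.and_eventually (htail.and (hq1.and (hT.eventually
    (eventually_rate_le hC hc R))))).mono fun ℓ ⟨hℓ, h1, h2, h3⟩ => ?_
  have hq0 : (1 : ℝ) ≤ q ℓ := by exact_mod_cast (hq ℓ).le
  refine h3 _ (h1 _ _ (hq0.trans (le_one_div_scale hq (hα ℓ) (hα1 ℓ))) le_rfl ?_)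
  rw [one_div_scale_rpow]
  rw [Function.comp_apply, one_mul] at h2
  refine h2.trans (Real.rpow_le_rpow_of_exponent_le hq0 ?_)
  exact div_le_div_of_nonneg_left ha.le (hα ℓ) hℓ.le

/-- Every large T needs an ℓ with T ≤ 1/ε_ℓ and q_ℓ + 1 ≤ T^a. The first ℓ with T ≤ 1/ε_ℓ works: its
predecessor n has q_n = (1/ε_n)^α_n ≤ T^b with b < a, and one step enlarges q by at most the factor
A. -/
theorem alphaUPlus_le {V : ℕ+ → ℝ} {hV : ∃ M, ∀ n, |V n| ≤ M}
    {q : ℕ → ℕ} (hq : ∀ ℓ, 1 < q ℓ) (hq_top : Tendsto q atTop atTop) {α : ℕ → ℝ} {C c A : ℝ}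
    (hα : ∀ ℓ, 0 < α ℓ) (hα1 : ∀ ℓ, α ℓ < 1) (hC : 0 < C) (hc : 0 < c)
    (hmono : ∀ ℓ₁ ℓ₂, ℓ₁ < ℓ₂ → scale q α ℓ₂ < scale q α ℓ₁)
    (hA : ∀ ℓ, (q (ℓ + 1) : ℝ) ≤ A * q ℓ)
    (htail : ∀ᶠ ℓ in atTop, ∀ T Q : ℝ, 1 ≤ T → T ≤ 1 / scale q α ℓ → (q ℓ : ℝ) + 1 ≤ Q →
      tailProb V hV Q T ≤ ENNReal.ofReal (C * T ^ 3 * Real.exp (-T ^ c))) :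
    alphaUPlus V hV ≤ limsup (fun ℓ => ENNReal.ofReal (α ℓ)) atTop := by
  refine iSup₂_le fun a ⟨ha, hbot⟩ => ?_
  by_contra! hlt
  obtain ⟨b, hb1, hb2⟩ := exists_between hlt
  have hb3 : b.toReal < a := by
    rw [← ENNReal.toReal_ofReal ha.le]
    exact ENNReal.toReal_strict_mono ENNReal.ofReal_ne_top hb2
  have hev : ∀ᶠ ℓ in atTop, α ℓ < b.toReal := by
    refine (eventually_lt_of_limsup_lt hb1 (by isBoundedDefault)).mono fun ℓ hℓ => ?_
    exact (ENNReal.ofReal_lt_iff_lt_toReal (hα ℓ).le (ne_top_of_lt hb2)).1 hℓ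
  have hb0 : 0 < b.toReal := by
    obtain ⟨ℓ, hℓ⟩ := hev.exists
    exact (hα ℓ).trans hℓ
  have hTlim := tendsto_one_div_scale hq hq_top hα hα1
  obtain ⟨n₀, hn₀⟩ := eventually_atTop.1 (hev.and htail)
  refine hbot.ne' (eq_bot_of_forall_le fun R => ?_)
  refine limsup_le_of_le (by isBoundedDefault) ?_
  filter_upwards [eventually_rate_le hC hc R, eventually_gt_atTop (1 / scale q α n₀),
    eventually_ge_atTop 1, (tendsto_rpow_atTop hb0).eventually
      (eventually_add_one_le_rpow ((one_lt_div hb0).2 hb3) A)] with T hT hTn hT1 hTA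
  have hT0 : 0 < T := by linarith
  have hex : ∃ ℓ, T ≤ 1 / scale q α ℓ := (hTlim.eventually_ge_atTop T).exists
  classical
  set ℓ := Nat.find hex with hℓ
  have hℓT : T ≤ 1 / scale q α ℓ := Nat.find_spec hex
  -- The scales decrease and T > 1/ε_{n₀}, so ℓ lies beyond n₀ and its predecessor still satisfies α
  -- < b.
  have hℓn : n₀ < ℓ := by
    by_contra! hle
    have : scale q α n₀ ≤ scale q α ℓ := by
      rcases hle.eq_or_lt with h | h
      · rw [h]
      · exact (hmono _ _ h).le
    have := one_div_le_one_div_of_le (scale_pos hq α n₀) this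
    linarith
  obtain ⟨n, hn⟩ : ∃ n, ℓ = n + 1 := ⟨ℓ - 1, by omega⟩
  have hnT : 1 / scale q α n < T := by
    have := Nat.find_min hex (show n < Nat.find hex by rw [← hℓ]; omega)
    exact not_le.1 this
  have hqn : (q n : ℝ) ≤ T ^ b.toReal := by
    have h1 : (1 / scale q α n) ^ α n = (q n : ℝ) := by
      rw [one_div_scale_rpow, div_self (hα n).ne', Real.rpow_one]
    rw [← h1]
    calc (1 / scale q α n) ^ α n ≤ T ^ α n :=
          Real.rpow_le_rpow (one_div_nonneg.2 (scale_pos hq α n).le) hnT.le (hα n).le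
      _ ≤ T ^ b.toReal := Real.rpow_le_rpow_of_exponent_le hT1 (hn₀ n (by omega)).1.le
  have hA0 : 0 ≤ A := by
    by_contra! hneg
    have h1 := hA 0
    have h2 : (0 : ℝ) < q 0 := by exact_mod_cast (hq 0).trans' zero_lt_one
    have h3 : (0 : ℝ) ≤ q (0 + 1) := Nat.cast_nonneg _
    nlinarith
  refine hT _ ((hn₀ ℓ hℓn.le).2 T (T ^ a) hT1 hℓT ?_)
  rw [hn]
  calc (q (n + 1) : ℝ) + 1 ≤ A * T ^ b.toReal + 1 := by
        have := mul_le_mul_of_nonneg_left hqn hA0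
        linarith [hA n]
    _ ≤ (T ^ b.toReal) ^ (a / b.toReal) := hTA
    _ = T ^ a := by
        rw [← Real.rpow_mul hT0.le, mul_div_cancel₀ _ hb0.ne']

end

end Schrodinger

theorem mainTheorem6
    (V : ℕ+ → ℝ) (hV : ∃ M, ∀ n, |V n| ≤ M)
    (q : ℕ → ℕ) (hq : ∀ ℓ, 1 < q ℓ) (hq_top : Tendsto q atTop atTop)
    (U : ℕ → Finset (NonemptyInterval ℝ)) (α ξ : ℕ → ℝ) (μ ω ζ : ℝ)
    (hclust : Schrodinger.UniformlyClustered V q U α ξ μ)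
    (hω0 : 0 < ω) (hω1 : ω < 1)
    (hscale : Schrodinger.ScalesNicely U (Schrodinger.scale q α) μ ω)
    (hζ : 0 < ζ)
    (hexp : ∀ ℓ, 2 * ω * ((μ - 1) / (μ - ω)) + ζ < ξ ℓ * α ℓ) :
    Schrodinger.alphaUMinus V hV ≤ liminf (fun ℓ => ENNReal.ofReal (α ℓ)) atTop ∧
    (Schrodinger.ExponentiallyGrowing (fun ℓ => (q ℓ : ℝ)) →
      Schrodinger.alphaUPlus V hV ≤ limsup (fun ℓ => ENNReal.ofReal (α ℓ)) atTop) := by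
  obtain ⟨C, hC, htail⟩ :=
    Schrodinger.exists_tailProb_bound hV hq hq_top hclust hscale hζ hexp
  obtain ⟨δ, hδ, hδα⟩ := hclust.exponents
  have hα : ∀ ℓ, 0 < α ℓ := fun ℓ => hδ.trans (hδα ℓ).2.2.1
  have hα1 : ∀ ℓ, α ℓ < 1 := fun ℓ => (hδα ℓ).2.2.2
  have hc : 0 < ζ / 3 := by positivity
  refine ⟨Schrodinger.alphaUMinus_le hq hq_top hα hα1 hC hc htail, fun hgrow => ?_⟩
  obtain ⟨A, hA⟩ := hgrow.2.1
  refine Schrodinger.alphaUPlus_le (A := A) hq hq_top hα hα1 hC hc hclust.scale_lt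
    (fun ℓ => ?_) htail
  have h1 : (q (ℓ + 1) : ℝ) / q ℓ ≤ A := hA ⟨ℓ, rfl⟩
  have h2 : (0 : ℝ) < q ℓ := by exact_mod_cast (hq ℓ).trans' zero_lt_one
  rwa [div_le_iff₀ h2] at h1
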